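/- Let $\mathcal M$ be a locally cartesian closed model category (finitely complete and cocomplete), and let $\Phi$ be a model filter on $\mathcal M$: a filter on the poset of subterminal objects of $\mathcal M$ whose members are fibrant and such that cofibrations and weak equivalences are stable under $-\times U$ for $U\in\Phi$. Let $\mathcal M_\Phi$ be the filter quotient, with the objects of $\mathcal M$ and $$\mathcal M_\Phi(X,Y)=\Big(\coprod_{U\in\Phi}\mathcal M(X\times U,Y)\Big)\big/\!\sim,$$ where $f\colon X\times U\to Y$ and $g\colon X\times V\to Y$ are identified if they agree on $X\times W$ for some $W\in\Phi$ with $W\le U,V$. Let $P_\Phi\colon\mathcal M\to\mathcal M_\Phi$ be the projection. For a class $S$ of morphisms, let $S_\Phi$ be the class of the morphisms of $\mathcal M_\Phi$ that have a representative $X\times U\to Y$ such that $X\times U\to Y\times U$ is in $S$. A *notion of fibred structure* on $\mathcal M$ assigns to every morphism $f$ a small set $\mathbf F(f)$ of structures, contravariantly functorial in pullback squares; equivalently, it is a discrete fibration with small fibres $\mathbf F\to\mathbf M$ of groupoid-valued pseudofunctors on $\mathcal M^{\mathrm{op}}$, where $\mathbf M(X)$ is the core of $\mathcal M_{/X}$.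 A morphism of such pseudofunctors is an *acyclic fibration* if it has the right lifting property against $\mathcal M(-,A)\to\mathcal M(-,B)$ for all cofibrations $A\to B$. Let $\mathbf F$ be a notion of fibred structure that is *locally representable* (the pseudo-pullback of $\mathbf F\to\mathbf M$ along every $\mathcal M(-,Z)\to\mathbf M$ is representable), *covers exactly the fibrations* ($\mathbf F(f)\neq\emptyset$ if and only if $f$ is a fibration), and is *relatively acyclic* (the map from $\mathbf F$ to the pseudofunctor $\mathbf{Fib}\subseteq\mathbf M$ of fibrations is an acyclic fibration). Let $\mathbf F_\Phi$ be the induced notion of fibred structure on $\mathcal M_\Phi$: a structure on the class of $f\colon X\times U\to Y$ is an element of $\operatorname{colim}_{V\in\Phi,\,V\le U}\mathbf F(f_V)$, where $f_V\colon X\times V\to Y\times V$ is induced by $f$. A *universe* for $\mathbf F$ is an object $\mathcal U$ with a map $\mathcal M(-,\mathcal U)\to\mathbf F$ that is an acyclic fibration onto its image; let $\pi\colon\tilde{\mathcal U}\to\mathcal U$ be the fibration underlying the image of $\mathrm{id}_{\mathcal U}$. It *contains* $X$ if $X\to 1$, with some structure, is a pullback of $\pi$ with its structure along a map $1\to\mathcal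 U$. It is *univalent*, with respect to a path object $Q$ of $\tilde{\mathcal U}$ over $\mathcal U$ (a factorization of the diagonal $\tilde{\mathcal U}\to\tilde{\mathcal U}\times_{\mathcal U}\tilde{\mathcal U}$ into a weak equivalence $\tilde{\mathcal U}\to Q$ and a fibration), if the universal object of equivalences $\mathrm{Eq}(\tilde{\mathcal U})\to\mathcal U\times\mathcal U$ exists and $\mathrm{idtoequiv}\colon\mathcal U\to\mathrm{Eq}(\tilde{\mathcal U})$ is a weak equivalence. Here maps $X\to\mathrm{Eq}(\tilde{\mathcal U})$ correspond to pairs $x_1,x_2\colon X\to\mathcal U$ with a map $x_1^*\tilde{\mathcal U}\to x_2^*\tilde{\mathcal U}$ over $X$, a left and a right homotopy inverse of it over $X$, and the two fibrewise homotopies, valued in $Q$; and $\mathrm{idtoequiv}$ classifies the identity. Then $\mathcal M_\Phi$, with the classes $(\mathcal F_\Phi,\mathcal C_\Phi,\mathcal W_\Phi)$ induced by the fibrations, cofibrations and weak equivalences of $\mathcal M$, is a model category, and $\mathbf F_\Phi$ is a locally representable and relatively acyclic notion of fibred structure that covers exactly the fibrations of $\mathcal M_\Phi$ (with fibres small in the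 same sense as those of $\mathbf F$ if the subobjects of $1$ in $\mathcal M$ form a small set). The functor $P_\Phi$ preserves finite limits, finite colimits, fibrations, cofibrations and weak equivalences. Moreover, for every universe $\mathcal U$ for $\mathbf F$: 1. $P_\Phi(\mathcal U)$, with the induced map $\mathcal M_\Phi(-,P_\Phi\,\mathcal U)\to\mathbf F_\Phi$, is a universe for $\mathbf F_\Phi$. 2. If $\mathcal U$ is fibrant, then so is $P_\Phi(\mathcal U)$. 3. If $\mathcal U$ is univalent with respect to $Q$, then $P_\Phi(\mathcal U)$ is univalent with respect to $P_\Phi(Q)$. 4. If $\mathcal U$ contains $X$, then $P_\Phi(\mathcal U)$ contains $P_\Phi(X)$, and if $X$ is an empty type (initial object), a unit type (terminal object), a natural numbers object, an $n$-sphere ($n\ge 0$), or a cell complex of shape $J$ for a finite poset $J$, then so is $P_\Phi(X)$. Here an *$n$-sphere* is an object that receives a weak equivalence from the boundary of an $(n+1)$-disk. The boundary inclusion of a $k$-disk is a cofibration $S\to D$ with $D\to1$ a weak equivalence, where $S$ is initial if $k=0$, and $S$ is the pushout of two boundary inclusions of $(k-1)$-disks with the same domain if $k>0$. A *cell complex of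 shape $J$* is an object that receives a weak equivalence from the colimit of a diagram $J\to\mathcal M$ of objects weakly equivalent to $1$ via the map to $1$, whose latching maps $\operatorname{colim}_{i<j}D_i\to D_j$ are cofibrations; for instance, the torus is the cell complex of the poset of simplices of a triangulation. -/

import Mathlib

open CategoryTheory CategoryTheory.Limits Opposite HomotopicalAlgebra

universe w v u

namespace FilterQuot

/-! ### Filters of subterminal objects and the filter quotient category -/

/-- A filter of subterminal objects of `C`, i.e. a filter on the preorder of subterminal objects
(`U ≤ V` iff there is a morphism `U ⟶ V`): nonempty, upward closed and down-directed. -/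
structure SubterminalFilter (C : Type u) [Category.{v} C] where
  mem : C → Prop
  isSubterminal : ∀ {U : C}, mem U → IsSubterminal U
  nonempty : ∃ U : C, mem U
  mem_of_hom : ∀ {U V : C}, mem U → IsSubterminal V → (U ⟶ V) → mem V
  exists_le : ∀ {U V : C}, mem U → mem V →
    ∃ W : C, mem W ∧ Nonempty (W ⟶ U) ∧ Nonempty (W ⟶ V)

/-- Objects of the filter quotient `C_Φ`: the same as those of `C`. -/
structure FilterQuotient {C : Type u} [Category.{v} C] (Φ : SubterminalFilter C) where
  as : C

namespace SubterminalFilter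

variable {C : Type u} [Category.{v} C] [HasFiniteProducts C] (Φ : SubterminalFilter C)

lemma mem_terminal : Φ.mem (⊤_ C) := by
  obtain ⟨U, hU⟩ := Φ.nonempty
  exact Φ.mem_of_hom hU (isSubterminal_of_isTerminal terminalIsTerminal) (terminal.from U)

lemma mem_prod {U V : C} (hU : Φ.mem U) (hV : Φ.mem V) : Φ.mem (U ⨯ V) := by
  obtain ⟨W, hW, ⟨a⟩, ⟨b⟩⟩ := Φ.exists_le hU hV
  refine Φ.mem_of_hom hW (fun Z f g => ?_) (prod.lift a b)
  ext
  · exact Φ.isSubterminal hU _ _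
  · exact Φ.isSubterminal hV _ _

/-- A representative `X × U ⟶ Y`, `U ∈ Φ`, of a morphism `X ⟶ Y` of `C_Φ`. -/
structure LevelHom (X Y : C) where
  level : C
  mem : Φ.mem level
  hom : X ⨯ level ⟶ Y

namespace LevelHom

variable {Φ}

/-- Two representatives `X × U ⟶ Y` and `X × V ⟶ Y` are equivalent if they agree on `X × W` for some
`W ∈ Φ` with `W ≤ U, V`. -/
def Rel {X Y : C} (f g : Φ.LevelHom X Y) : Prop :=
  ∃ (W : C) (_ : Φ.mem W) (a : W ⟶ f.level) (b : W ⟶ g.level),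
    prod.map (𝟙 X) a ≫ f.hom = prod.map (𝟙 X) b ≫ g.hom

/-- Value on generalized elements. -/
noncomputable def ev {X Y : C} (f : Φ.LevelHom X Y) {T : C} (x : T ⟶ X) (t : T ⟶ f.level) : T ⟶ Y :=
  prod.lift x t ≫ f.hom

lemma ev_congr {X Y : C} (f : Φ.LevelHom X Y) {T : C} {x x' : T ⟶ X} (h : x = x')
    (t t' : T ⟶ f.level) : f.ev x t = f.ev x' t' := by
  rw [h, Φ.isSubterminal f.mem t t']

lemma comp_ev {X Y : C} (f : Φ.LevelHom X Y) {S T : C} (s : S ⟶ T) (x : T ⟶ X)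
    (t : T ⟶ f.level) : s ≫ f.ev x t = f.ev (s ≫ x) (s ≫ t) := by
  simp [ev, ← Category.assoc, prod.comp_lift]

lemma rel_of_ev {X Y : C} {f g : Φ.LevelHom X Y} {W : C} (hW : Φ.mem W) (a : W ⟶ f.level)
    (b : W ⟶ g.level) (h : f.ev prod.fst (prod.snd ≫ a) = g.ev prod.fst (prod.snd ≫ b)) :
    Rel f g := by
  refine ⟨W, hW, a, b, ?_⟩
  have e : ∀ {U : C} (c : W ⟶ U), prod.map (𝟙 X) c = prod.lift prod.fst (prod.snd ≫ c) := by
    intro U c; ext <;> simp [prod.lift_fst, prod.lift_snd]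
  rw [e, e]
  exact h

lemma Rel.ev_eq {X Y : C} {f g : Φ.LevelHom X Y} (h : Rel f g) :
    ∃ W : C, Φ.mem W ∧ Nonempty (W ⟶ f.level) ∧ Nonempty (W ⟶ g.level) ∧
      ∀ ⦃T : C⦄ (_ : T ⟶ W) (x : T ⟶ X) (s : T ⟶ f.level) (t : T ⟶ g.level),
        f.ev x s = g.ev x t := by
  obtain ⟨W, hW, a, b, h⟩ := h
  refine ⟨W, hW, ⟨a⟩, ⟨b⟩, fun T w x s t => ?_⟩
  rw [f.ev_congr rfl s (w ≫ a), g.ev_congr rfl t (w ≫ b)]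
  have := congrArg (prod.lift x w ≫ ·) h
  simpa [ev, ← Category.assoc] using this

lemma rel_equivalence (X Y : C) : Equivalence (Rel (Φ := Φ) (X := X) (Y := Y)) where
  refl f := ⟨f.level, f.mem, 𝟙 _, 𝟙 _, rfl⟩
  symm := by
    rintro f g ⟨W, hW, a, b, h⟩
    exact ⟨W, hW, b, a, h.symm⟩
  trans {f g k} h h' := by
    obtain ⟨W, hW, ⟨a⟩, ⟨b⟩, h⟩ := h.ev_eq
    obtain ⟨W', hW', ⟨a'⟩, ⟨b'⟩, h'⟩ := h'.ev_eq
    refine rel_of_ev (Φ.mem_prod hW hW') (prod.fst ≫ a) (prod.snd ≫ b') ?_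
    rw [h (prod.snd ≫ prod.fst) _ _ (prod.snd ≫ prod.fst ≫ b),
      h' (prod.snd ≫ prod.snd)]

instance setoid (X Y : C) : Setoid (Φ.LevelHom X Y) := ⟨Rel, rel_equivalence X Y⟩

variable (Φ) in
noncomputable def id (X : C) : Φ.LevelHom X X := ⟨⊤_ C, Φ.mem_terminal, prod.fst⟩

/-- The composite `X × (U × V) ⟶ Y × V ⟶ Z`. -/
noncomputable def comp {X Y Z : C} (f : Φ.LevelHom X Y) (g : Φ.LevelHom Y Z) : Φ.LevelHom X Z where
  level := f.level ⨯ g.level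
  mem := Φ.mem_prod f.mem g.mem
  hom := prod.lift (prod.map (𝟙 X) prod.fst ≫ f.hom) (prod.snd ≫ prod.snd) ≫ g.hom

@[simp]
lemma id_ev {X T : C} (x : T ⟶ X) (t : T ⟶ ⊤_ C) : (id Φ X).ev x t = x := by
  exact prod.lift_fst _ _

lemma comp_ev' {X Y Z : C} (f : Φ.LevelHom X Y) (g : Φ.LevelHom Y Z) {T : C} (x : T ⟶ X)
    (t : T ⟶ f.level ⨯ g.level) :
    (f.comp g).ev x t = g.ev (f.ev x (t ≫ prod.fst)) (t ≫ prod.snd) := by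
  have e : prod.lift x t ≫ prod.lift (prod.map (𝟙 X) prod.fst ≫ f.hom) (prod.snd ≫ prod.snd) =
      prod.lift (prod.lift x (t ≫ prod.fst) ≫ f.hom) (t ≫ prod.snd) := by
    ext
    · simp [← Category.assoc, prod.lift_fst]
    · simp [← Category.assoc, prod.lift_snd]
  dsimp only [ev]
  rw [← e, Category.assoc]
  rfl

lemma comp_rel {X Y Z : C} {f f' : Φ.LevelHom X Y} {g g' : Φ.LevelHom Y Z}
    (hf : Rel f f') (hg : Rel g g') : Rel (f.comp g) (f'.comp g') := by
  obtain ⟨W, hW, ⟨a⟩, ⟨b⟩, h⟩ := hf.ev_eq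
  obtain ⟨W', hW', ⟨a'⟩, ⟨b'⟩, h'⟩ := hg.ev_eq
  refine rel_of_ev (Φ.mem_prod hW hW') (prod.map a a') (prod.map b b') ?_
  erw [comp_ev', comp_ev']
  rw [h (prod.snd ≫ prod.fst), h' (prod.snd ≫ prod.snd)]

lemma id_comp_rel {X Y : C} (f : Φ.LevelHom X Y) : Rel ((id Φ X).comp f) f := by
  refine rel_of_ev f.mem (prod.lift (terminal.from _) (𝟙 _)) (𝟙 _) ?_
  erw [comp_ev', id_ev]
  exact ev_congr _ rfl _ _

lemma comp_id_rel {X Y : C} (f : Φ.LevelHom X Y) : Rel (f.comp (id Φ Y)) f := by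
  refine rel_of_ev f.mem (prod.lift (𝟙 _) (terminal.from _)) (𝟙 _) ?_
  erw [comp_ev', id_ev]
  exact ev_congr _ rfl _ _

lemma assoc_rel {X Y Z T : C} (f : Φ.LevelHom X Y) (g : Φ.LevelHom Y Z) (h : Φ.LevelHom Z T) :
    Rel ((f.comp g).comp h) (f.comp (g.comp h)) := by
  refine rel_of_ev ((f.comp g).comp h).mem (𝟙 _) (prod.associator f.level g.level h.level).hom ?_
  erw [comp_ev', comp_ev', comp_ev', comp_ev']
  exact ev_congr _ (ev_congr _ (ev_congr _ rfl _ _) _ _) _ _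

end LevelHom

/-- The filter quotient category `C_Φ`. -/
noncomputable instance : Category.{max u v} (FilterQuotient Φ) where
  Hom X Y := Quotient (LevelHom.setoid (Φ := Φ) X.as Y.as)
  id X := Quotient.mk _ (LevelHom.id Φ X.as)
  comp := Quotient.map₂ LevelHom.comp (fun _ _ hf _ _ hg => LevelHom.comp_rel hf hg)
  id_comp := by
    rintro X Y ⟨f⟩
    exact Quotient.sound (LevelHom.id_comp_rel f)
  comp_id := by
    rintro X Y ⟨f⟩
    exact Quotient.sound (LevelHom.comp_id_rel f)
  assoc := by
    rintro X Y Z T ⟨f⟩ ⟨g⟩ ⟨h⟩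
    exact Quotient.sound (LevelHom.assoc_rel f g h)

variable {Φ} in
/-- The class in `C_Φ` of a representative. -/
def homMk {X Y : C} (f : Φ.LevelHom X Y) : (⟨X⟩ : FilterQuotient Φ) ⟶ ⟨Y⟩ := Quotient.mk _ f

lemma homMk_surjective {X Y : C} (f : (⟨X⟩ : FilterQuotient Φ) ⟶ ⟨Y⟩) : ∃ g, homMk g = f := by
  obtain ⟨g⟩ := f
  exact ⟨g, rfl⟩

lemma homMk_eq_iff {X Y : C} (f g : Φ.LevelHom X Y) :
    homMk f = homMk g ↔ LevelHom.Rel f g := Quotient.eq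

lemma homMk_comp {X Y Z : C} (f : Φ.LevelHom X Y) (g : Φ.LevelHom Y Z) :
    homMk f ≫ homMk g = homMk (f.comp g) := rfl

/-- A morphism of `C`, as a representative at the level of the terminal object. -/
noncomputable def ofHom {X Y : C} (f : X ⟶ Y) : Φ.LevelHom X Y :=
  ⟨⊤_ C, Φ.mem_terminal, prod.fst ≫ f⟩

@[simp]
lemma ofHom_ev {X Y : C} (f : X ⟶ Y) {T : C} (x : T ⟶ X) (t : T ⟶ (Φ.ofHom f).level) :
    (Φ.ofHom f).ev x t = x ≫ f := by
  exact (prod.lift_fst_assoc _ _ _)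

/-- The projection functor `P_Φ : C ⥤ C_Φ`. -/
noncomputable def proj : C ⥤ FilterQuotient Φ where
  obj X := ⟨X⟩
  map {X Y} f := homMk (Φ.ofHom f)
  map_id X := by
    refine (Φ.homMk_eq_iff _ _).2 (LevelHom.rel_of_ev Φ.mem_terminal (𝟙 _) (𝟙 _) ?_)
    rw [ofHom_ev]
    erw [LevelHom.id_ev]
    simp
  map_comp {X Y Z} f g := by
    refine (Φ.homMk_eq_iff _ _).2 (LevelHom.rel_of_ev Φ.mem_terminal (𝟙 _)
      (prod.lift (𝟙 _) (𝟙 _)) ?_)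
    erw [LevelHom.comp_ev']
    simp

end SubterminalFilter

/-! ### Arrows, pullback squares and notions of fibred structure -/

/-- The category of arrows of `C` and pullback squares. With the codomain functor
`CartArrow.base` it is the Grothendieck construction of the pseudofunctor
`X ↦ core of (C / X)` from `Cᵒᵖ` to groupoids.

Throughout, a pseudofunctor from `Cᵒᵖ` to groupoids is represented by its Grothendieck construction,
a category over `C` that is fibred in groupoids. -/
structure CartArrow (C : Type u) [Category.{v} C] where
  {left : C}
  {right : C}
  hom : left ⟶ right

namespace CartArrow

variable {C : Type u} [Category.{v} C]

/-- A pullback square from the arrow `f` to the arrow `g`. -/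
@[ext]
structure Hom (f g : CartArrow C) where
  left : f.left ⟶ g.left
  right : f.right ⟶ g.right
  isPullback : IsPullback left f.hom g.hom right

instance : Category.{v} (CartArrow C) where
  Hom := Hom
  id f := ⟨𝟙 _, 𝟙 _, IsPullback.of_horiz_isIso ⟨by simp⟩⟩
  comp m n := ⟨m.left ≫ n.left, m.right ≫ n.right, m.isPullback.paste_horiz n.isPullback⟩
  id_comp _ := Hom.ext (Category.id_comp _) (Category.id_comp _)
  comp_id _ := Hom.ext (Category.comp_id _) (Category.comp_id _)
  assoc _ _ _ := Hom.ext (Category.assoc _ _ _) (Category.assoc _ _ _)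

variable (C) in
/-- The codomain functor. -/
def base : CartArrow C ⥤ C where
  obj f := f.right
  map m := m.right

end CartArrow

/-- A notion of fibred structure on `C`: a discrete fibration, with `w`-small fibres, over the
pseudofunctor `X ↦ core of (C / X)`. On Grothendieck constructions this is a discrete
fibration over `CartArrow C`, that is, a presheaf of small sets on `CartArrow C`: every arrow `f` has a
set of structures, and structures are pulled back, functorially, along pullback squares. -/
abbrev FibredStructure (C : Type u) [Category.{v} C] := (CartArrow C)ᵒᵖ ⥤ Type w

namespace FibredStructure

variable {C : Type u} [Category.{v} C]

/-- The total category of the discrete fibration: arrows with a structure, and the pullback squares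
along which the structure pulls back to the given one. Over `C`, it is the Grothendieck construction
of the pseudofunctor `F`. -/
structure Total (F : FibredStructure.{w} C) where
  arrow : CartArrow C
  str : F.obj (op arrow)

variable (F : FibredStructure.{w} C)

instance : Category.{v} F.Total where
  Hom a b := { m : a.arrow ⟶ b.arrow // F.map m.op b.str = a.str }
  id a := ⟨𝟙 _, by simp⟩
  comp m n := ⟨m.1 ≫ n.1, by simp [n.2, m.2]⟩
  id_comp _ := Subtype.ext (Category.id_comp _)
  comp_id _ := Subtype.ext (Category.comp_id _)
  assoc _ _ _ := Subtype.ext (Category.assoc _ _ _)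

/-- The discrete fibration, as a functor that forgets the structure. -/
def toArrow : F.Total ⥤ CartArrow C where
  obj a := a.arrow
  map m := m.1

/-- The projection of the total category to `C`. -/
def base : F.Total ⥤ C := F.toArrow ⋙ CartArrow.base C

end FibredStructure

/-- A morphism `α : 𝒳 ⥤ 𝒴` of categories fibred in groupoids over `C` (with `q : 𝒴 ⥤ C` and `α ⋙ q` the
projections) is an acyclic fibration if it has the right lifting property with respect to the maps
`C(-, A) ⟶ C(-, B)` of representables induced by the cofibrations `A ⟶ B`. Spelled out with the Yoneda
lemma: given an object `x` of `𝒳` over `A`, an object `y` of `𝒴` over `B`, and an isomorphism of `α x`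
with the restriction of `y` to `A` (i.e. a morphism `m : α x ⟶ y` over `A ⟶ B`), there is an
extension of `x` to an object over `B` together with a compatible isomorphism of its image with `y`. -/
def IsAcyclicFibration {C : Type u} [Category.{v} C] [CategoryWithCofibrations C]
    {𝒳 : Type*} [Category 𝒳] {𝒴 : Type*} [Category 𝒴] (α : 𝒳 ⥤ 𝒴) (q : 𝒴 ⥤ C) : Prop :=
  ∀ ⦃x : 𝒳⦄ ⦃y : 𝒴⦄ (m : α.obj x ⟶ y), Cofibration (q.map m) →
    ∃ (x' : 𝒳) (n : x ⟶ x') (e : α.obj x' ≅ y), α.map n ≫ e.hom = m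

/-- The arrows that are fibrations; the full subcategory of `CartArrow C` they span is the
Grothendieck construction of the pseudofunctor `Fib`. -/
def fibrationArrows (C : Type u) [Category.{v} C] [CategoryWithFibrations C] :
    ObjectProperty (CartArrow C) := fun f => Fibration f.hom

namespace FibredStructure

variable {C : Type u} [Category.{v} C] (F : FibredStructure.{w} C)

/-- `F` is locally representable, relatively acyclic, and covers exactly the fibrations.
* Local representability: a morphism from `C(-, Z)` to `X ↦ core of (C / X)` is given by an arrow
  `f` with codomain `Z`. The pseudo-pullback of `F` along it is the presheaf on `C / Z`, or equivalently
  on `CartArrow C / f`, that takes a pullback of `f` to its set of structures.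
* Covering: the image of `F` consists exactly of the fibrations.
* Relative acyclicity: the induced morphism from `F` to `Fib` is an acyclic fibration. -/
structure IsLPaRANoFScaF [CategoryWithFibrations C] [CategoryWithCofibrations C] : Prop where
  locallyRepresentable : ∀ f : CartArrow C, ((Over.forget f).op ⋙ F).IsRepresentable
  covers : ∀ f : CartArrow C, Nonempty (F.obj (op f)) ↔ Fibration f.hom
  relativelyAcyclic : IsAcyclicFibration
    ((fibrationArrows C).lift F.toArrow fun a => (covers a.arrow).1 ⟨a.str⟩)
    ((fibrationArrows C).ι ⋙ CartArrow.base C)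

/-- A morphism of pseudofunctors `C(-, Z) ⟶ F`: a functor over `C` from `C / Z`, which is the
Grothendieck construction of `C(-, Z)`, to the total category of `F`. -/
structure RepresentableMap (Z : C) where
  functor : Over Z ⥤ F.Total
  overIso : functor ⋙ F.base ≅ Over.forget Z

variable {F}

/-- The value of a morphism `T : C(-, U) ⟶ F` at `𝟙 U` is (isomorphic over `U` to) `u`, where `U` is the
base of `u`. -/
def RepresentableMap.ClassifiedBy {u : F.Total} (T : F.RepresentableMap (F.base.obj u)) : Prop :=
  ∃ e : T.functor.obj (Over.mk (𝟙 (F.base.obj u))) ≅ u,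
    F.base.map e.hom = T.overIso.hom.app (Over.mk (𝟙 (F.base.obj u)))

/-- `u`, consisting of an arrow `Ũ ⟶ U` and a structure on it, is a universe for `F`: there is a
morphism `C(-, U) ⟶ F` that takes `𝟙 U` to `u` (by the Yoneda lemma, `u` and the morphism determine each
other) and the induced morphism onto its image is an acyclic fibration. -/
def Total.IsUniverse [CategoryWithCofibrations C] (u : F.Total) : Prop :=
  ∃ T : F.RepresentableMap (F.base.obj u), T.ClassifiedBy ∧
    IsAcyclicFibration T.functor.toEssImage (T.functor.essImage.ι ⋙ F.base)

/-- The type `X` is contained in the universe `u`: the map from `X` to the terminal object, with a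
suitable structure, is classified by `u`, i.e. it is a pullback of `u` along a global element. -/
def Total.Contains (u : F.Total) (X : C) : Prop :=
  ∃ (T : C) (hT : IsTerminal T) (s : F.obj (op ⟨hT.from X⟩)),
    Nonempty ((⟨⟨hT.from X⟩, s⟩ : F.Total) ⟶ u)

end FibredStructure

/-! ### The induced notion of fibred structure on the filter quotient -/

namespace SubterminalFilter

variable {C : Type u} [Category.{v} C] [HasFiniteProducts C] (Φ : SubterminalFilter C)

lemma homMk_comp_ofHom {X Y Z : C} (p : Φ.LevelHom X Y) (f : Y ⟶ Z) :
    homMk p ≫ homMk (Φ.ofHom f) = homMk ⟨p.level, p.mem, p.hom ≫ f⟩ := by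
  refine (Φ.homMk_eq_iff _ _).2 (LevelHom.rel_of_ev p.mem
    (prod.lift (𝟙 _) (terminal.from _)) (𝟙 _) ?_)
  erw [LevelHom.comp_ev', ofHom_ev]
  refine (Category.assoc _ _ _).trans (congrArg (· ≫ p.hom ≫ f) ?_)
  ext
  · simp [prod.lift_fst]
  · exact Φ.isSubterminal p.mem _ _

lemma isPullback_ofHom {A B X Y : C} {f : A ⟶ B} {g : A ⟶ X} {h : B ⟶ Y} {k : X ⟶ Y}
    (sq : IsPullback f g h k) :
    IsPullback (homMk (Φ.ofHom f)) (homMk (Φ.ofHom g)) (homMk (Φ.ofHom h))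
      (homMk (Φ.ofHom k)) := by
  have exist : ∀ {T : FilterQuotient Φ} (b : T ⟶ ⟨B⟩) (c : T ⟶ ⟨X⟩),
      b ≫ homMk (Φ.ofHom h) = c ≫ homMk (Φ.ofHom k) →
        ∃ l : T ⟶ ⟨A⟩, l ≫ homMk (Φ.ofHom f) = b ∧ l ≫ homMk (Φ.ofHom g) = c := by
    rintro ⟨T⟩ b c e
    obtain ⟨b, rfl⟩ := Φ.homMk_surjective b
    obtain ⟨c, rfl⟩ := Φ.homMk_surjective c
    rw [homMk_comp_ofHom, homMk_comp_ofHom, homMk_eq_iff] at e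
    obtain ⟨W, hW, ⟨i⟩, ⟨j⟩, e⟩ := e.ev_eq
    have e' : b.ev (prod.fst : T ⨯ W ⟶ T) (prod.snd ≫ i) ≫ h =
        c.ev (prod.fst : T ⨯ W ⟶ T) (prod.snd ≫ j) ≫ k := by
      have := e (prod.snd : T ⨯ W ⟶ W) prod.fst (prod.snd ≫ i) (prod.snd ≫ j)
      simpa [LevelHom.ev] using this
    refine ⟨homMk ⟨W, hW, sq.lift _ _ e'⟩, ?_, ?_⟩
    · rw [homMk_comp_ofHom]
      refine (Φ.homMk_eq_iff _ _).2 (LevelHom.rel_of_ev hW (𝟙 _) i ?_)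
      simp [LevelHom.ev]
    · rw [homMk_comp_ofHom]
      refine (Φ.homMk_eq_iff _ _).2 (LevelHom.rel_of_ev hW (𝟙 _) j ?_)
      simp [LevelHom.ev]
  have uniq : ∀ {T : FilterQuotient Φ} (l l' : T ⟶ ⟨A⟩),
      l ≫ homMk (Φ.ofHom f) = l' ≫ homMk (Φ.ofHom f) →
        l ≫ homMk (Φ.ofHom g) = l' ≫ homMk (Φ.ofHom g) → l = l' := by
    rintro ⟨T⟩ l l' e₁ e₂
    obtain ⟨l, rfl⟩ := Φ.homMk_surjective l
    obtain ⟨l', rfl⟩ := Φ.homMk_surjective l'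
    rw [homMk_comp_ofHom, homMk_comp_ofHom, homMk_eq_iff] at e₁ e₂
    obtain ⟨W, hW, ⟨i⟩, ⟨j⟩, e₁⟩ := e₁.ev_eq
    obtain ⟨W', hW', -, -, e₂⟩ := e₂.ev_eq
    refine (Φ.homMk_eq_iff _ _).2 (LevelHom.rel_of_ev (Φ.mem_prod hW hW') (prod.fst ≫ i)
      (prod.fst ≫ j) (sq.hom_ext ?_ ?_))
    · have := e₁ (prod.snd ≫ prod.fst : T ⨯ W ⨯ W' ⟶ W) prod.fst
        (prod.snd ≫ prod.fst ≫ i) (prod.snd ≫ prod.fst ≫ j)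
      simpa [LevelHom.ev] using this
    · have := e₂ (prod.snd ≫ prod.snd : T ⨯ W ⨯ W' ⟶ W') prod.fst
        (prod.snd ≫ prod.fst ≫ i) (prod.snd ≫ prod.fst ≫ j)
      simpa [LevelHom.ev] using this
  have w := congrArg Φ.proj.map sq.w
  rw [Functor.map_comp, Functor.map_comp] at w
  refine ⟨⟨w⟩, ⟨PullbackCone.IsLimit.mk _
    (fun s => (exist s.fst s.snd s.condition).choose)
    (fun s => (exist s.fst s.snd s.condition).choose_spec.1)
    (fun s => (exist s.fst s.snd s.condition).choose_spec.2) fun s m h₁ h₂ => ?_⟩⟩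
  have h := (exist s.fst s.snd s.condition).choose_spec
  exact uniq _ _ (h₁.trans h.1.symm) (h₂.trans h.2.symm)

lemma isPullback_proj_map {A B X Y : C} {f : A ⟶ B} {g : A ⟶ X} {h : B ⟶ Y} {k : X ⟶ Y}
    (sq : IsPullback f g h k) :
    IsPullback (Φ.proj.map f) (Φ.proj.map g) (Φ.proj.map h) (Φ.proj.map k) :=
  Φ.isPullback_ofHom sq

/-- `P_Φ` preserves pullback squares, so it acts on arrows and pullback squares. -/
noncomputable def cartProj : CartArrow C ⥤ CartArrow (FilterQuotient Φ) where
  obj f := ⟨Φ.proj.map f.hom⟩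
  map m := ⟨Φ.proj.map m.left, Φ.proj.map m.right, Φ.isPullback_proj_map m.isPullback⟩
  map_id _ := CartArrow.Hom.ext (Φ.proj.map_id _) (Φ.proj.map_id _)
  map_comp _ _ := CartArrow.Hom.ext (Φ.proj.map_comp _ _) (Φ.proj.map_comp _ _)

/-- A presentation of a structure on the arrow `f` of `C_Φ`: a pullback square in `C_Φ` from `f` to (the
image of) an arrow `g` of `C`, together with a structure on `g`. The main example: if `f` is the
class of a morphism `X × U ⟶ Y` with `U ∈ Φ`, then `f` is isomorphic to the image of
`f_U : X × U ⟶ Y × U`, so that a structure on `f_U` presents one on `f`. -/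
structure Presentation (F : FibredStructure.{w} C) (f : CartArrow (FilterQuotient Φ)) where
  arrow : CartArrow C
  map : f ⟶ Φ.cartProj.obj arrow
  str : F.obj (op arrow)

namespace Presentation

variable {Φ} {F : FibredStructure.{w} C}

/-- A presentation may be replaced by its restriction along a pullback square of `C`. -/
inductive Rel {f : CartArrow (FilterQuotient Φ)} : Φ.Presentation F f → Φ.Presentation F f → Prop
  | restrict {g g' : CartArrow C} (k : g ⟶ g') (m : f ⟶ Φ.cartProj.obj g) (s : F.obj (op g')) :
      Rel ⟨g, m, F.map k.op s⟩ ⟨g', m ≫ Φ.cartProj.map k, s⟩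

/-- Pulling a presentation back along a pullback square of `C_Φ`. -/
noncomputable def pull {f f' : CartArrow (FilterQuotient Φ)} (n : f' ⟶ f) (x : Φ.Presentation F f) :
    Φ.Presentation F f' := ⟨x.arrow, n ≫ x.map, x.str⟩

lemma Rel.pull {f f' : CartArrow (FilterQuotient Φ)} (n : f' ⟶ f) {x y : Φ.Presentation F f}
    (h : Rel x y) : Rel (x.pull n) (y.pull n) := by
  obtain ⟨k, m, s⟩ := h
  have := Rel.restrict (F := F) k (n ≫ m) s
  rwa [Category.assoc] at this

end Presentation

/-- The notion of fibred structure `F_Φ` on `C_Φ` induced by `F`: the discrete fibration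
that is the filtered colimit, over `U ∈ Φ`, of the restrictions of `F` to the slices `C / U`. It is
written here as the left Kan extension of the presheaf `F` along `P_Φ`. The functor
`- × U : C ⥤ C / U` is right adjoint to the inclusion, so extending `F` along it restricts `F` to `C / U`,
and `C_Φ` is the filtered colimit of the `C / U`. Explicitly, the structures on `f` form the filtered
colimit over `U` of the sets of structures on `f_U : X × U ⟶ Y × U`. -/
noncomputable def induced (F : FibredStructure.{w} C) : FibredStructure.{max u v w} (FilterQuotient Φ) where
  obj f := Quot (Presentation.Rel (Φ := Φ) (F := F) (f := f.unop))
  map n := TypeCat.ofHom (Quot.map (Presentation.pull n.unop) fun _ _ h => h.pull n.unop)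
  map_id _ := by
    ext ⟨x⟩
    simp [Quot.map, Presentation.pull]
  map_comp m n := by
    ext ⟨x⟩
    simp [Quot.map, Presentation.pull]

/-- The action of `P_Φ` on arrows with structure, from `F` to `F_Φ`. -/
noncomputable def projTotal {F : FibredStructure.{w} C} (a : F.Total) : (Φ.induced F).Total where
  arrow := Φ.cartProj.obj a.arrow
  str := Quot.mk _ ⟨a.arrow, 𝟙 _, a.str⟩

/-- The class `S_Φ` of morphisms of `C_Φ` induced by a class `S` of morphisms of `C`: the morphisms that
have a representative `X × U ⟶ Y` with `X × U ⟶ Y × U` in `S`. -/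
def descend (W : MorphismProperty C) : MorphismProperty (FilterQuotient Φ) :=
  fun X Y f => ∃ p : Φ.LevelHom X.as Y.as, (homMk p : X ⟶ Y) = f ∧
    W (prod.lift p.hom prod.snd : X.as ⨯ p.level ⟶ Y.as ⨯ p.level)

/-- A model filter: its members are fibrant, and cofibrations and weak equivalences are stable under
products with its members. -/
structure IsModelFilter [CategoryWithFibrations C] [CategoryWithCofibrations C]
    [CategoryWithWeakEquivalences C] : Prop where
  isFibrant : ∀ {U : C}, Φ.mem U → IsFibrant U
  cofibration : ∀ {X Y : C} (f : X ⟶ Y) {U : C}, Φ.mem U → Cofibration f →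
    Cofibration (prod.map f (𝟙 U))
  weakEquivalence : ∀ {X Y : C} (f : X ⟶ Y) {U : C}, Φ.mem U → WeakEquivalence f →
    WeakEquivalence (prod.map f (𝟙 U))

end SubterminalFilter

/-! ### Univalence -/

/-- The data of a path object of `E` over `B`, with constant paths `ι` and endpoints `p₀` and `p₁`. -/
structure FibrewisePath {C : Type u} [Category.{v} C] {E B : C} (π : E ⟶ B) where
  path : C
  ι : E ⟶ path
  p₀ : path ⟶ E
  p₁ : path ⟶ E
  ι_p₀ : ι ≫ p₀ = 𝟙 E
  ι_p₁ : ι ≫ p₁ = 𝟙 E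
  w : p₀ ≫ π = p₁ ≫ π

namespace FibrewisePath

variable {C : Type u} [Category.{v} C] {E B : C} {π : E ⟶ B}

/-- `E ⟶ path` is a weak equivalence and `path ⟶ E ×_B E` is a fibration. -/
structure IsPathObject [CategoryWithFibrations C] [CategoryWithWeakEquivalences C]
    (Q : FibrewisePath π) : Prop where
  weakEquivalence : WeakEquivalence Q.ι
  fibration : ∃ (K : C) (k₀ k₁ : K ⟶ E) (_ : IsPullback k₀ k₁ π π) (d : Q.path ⟶ K),
    d ≫ k₀ = Q.p₀ ∧ d ≫ k₁ = Q.p₁ ∧ Fibration d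

/-- The image of path object data under a functor. -/
def map {D : Type*} [Category D] (G : C ⥤ D) (Q : FibrewisePath π) :
    FibrewisePath (G.map π) where
  path := G.obj Q.path
  ι := G.map Q.ι
  p₀ := G.map Q.p₀
  p₁ := G.map Q.p₁
  ι_p₀ := by rw [← G.map_comp, Q.ι_p₀, G.map_id]
  ι_p₁ := by rw [← G.map_comp, Q.ι_p₁, G.map_id]
  w := by rw [← G.map_comp, Q.w, G.map_comp]

end FibrewisePath

/-- A family, over `base`, of equivalences between fibres of `π : E ⟶ B`: two morphisms
`x₁, x₂ : base ⟶ B`, pullbacks `A₁, A₂` of `E` along them, a morphism `f : A₁ ⟶ A₂` over `base`, a left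
homotopy inverse `g` and a right homotopy inverse `h` over `base`, with fibrewise homotopies `η` from
`g ∘ f` to the identity and `ε` from `f ∘ h` to the identity. -/
structure EquivalenceData {C : Type u} [Category.{v} C] {E B : C} {π : E ⟶ B}
    (Q : FibrewisePath π) where
  {base : C}
  {A₁ : C}
  {A₂ : C}
  x₁ : base ⟶ B
  x₂ : base ⟶ B
  a₁ : A₁ ⟶ E
  a₂ : A₂ ⟶ E
  q₁ : A₁ ⟶ base
  q₂ : A₂ ⟶ base
  isPullback₁ : IsPullback a₁ q₁ π x₁
  isPullback₂ : IsPullback a₂ q₂ π x₂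
  f : A₁ ⟶ A₂
  g : A₂ ⟶ A₁
  h : A₂ ⟶ A₁
  f_q₂ : f ≫ q₂ = q₁
  g_q₁ : g ≫ q₁ = q₂
  h_q₁ : h ≫ q₁ = q₂
  η : A₁ ⟶ Q.path
  η_p₀ : η ≫ Q.p₀ = f ≫ g ≫ a₁
  η_p₁ : η ≫ Q.p₁ = a₁
  ε : A₂ ⟶ Q.path
  ε_p₀ : ε ≫ Q.p₀ = h ≫ f ≫ a₂
  ε_p₁ : ε ≫ Q.p₁ = a₂

namespace EquivalenceData

variable {C : Type u} [Category.{v} C] {E B : C} {π : E ⟶ B} {Q : FibrewisePath π}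

/-- `φ : d.base ⟶ e.base` exhibits `d` as the base change of the family `e`. -/
structure Hom (d e : EquivalenceData Q) where
  φ : d.base ⟶ e.base
  φ₁ : d.A₁ ⟶ e.A₁
  φ₂ : d.A₂ ⟶ e.A₂
  φ_x₁ : φ ≫ e.x₁ = d.x₁
  φ_x₂ : φ ≫ e.x₂ = d.x₂
  φ₁_a₁ : φ₁ ≫ e.a₁ = d.a₁
  φ₂_a₂ : φ₂ ≫ e.a₂ = d.a₂
  φ₁_q₁ : φ₁ ≫ e.q₁ = d.q₁ ≫ φ
  φ₂_q₂ : φ₂ ≫ e.q₂ = d.q₂ ≫ φ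
  φ₁_f : φ₁ ≫ e.f = d.f ≫ φ₂
  φ₂_g : φ₂ ≫ e.g = d.g ≫ φ₁
  φ₂_h : φ₂ ≫ e.h = d.h ≫ φ₁
  φ₁_η : φ₁ ≫ e.η = d.η
  φ₂_ε : φ₂ ≫ e.ε = d.ε

variable (Q) in
/-- The family over `B` of the identity equivalences. -/
def refl : EquivalenceData Q where
  base := B
  A₁ := E
  A₂ := E
  x₁ := 𝟙 B
  x₂ := 𝟙 B
  a₁ := 𝟙 E
  a₂ := 𝟙 E
  q₁ := π
  q₂ := π
  isPullback₁ := IsPullback.of_horiz_isIso ⟨by simp⟩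
  isPullback₂ := IsPullback.of_horiz_isIso ⟨by simp⟩
  f := 𝟙 E
  g := 𝟙 E
  h := 𝟙 E
  f_q₂ := by simp
  g_q₁ := by simp
  h_q₁ := by simp
  η := Q.ι
  η_p₀ := by simp [Q.ι_p₀]
  η_p₁ := Q.ι_p₁
  ε := Q.ι
  ε_p₀ := by simp [Q.ι_p₀]
  ε_p₁ := Q.ι_p₁

/-- Every family of equivalences is a base change of `e` in a unique way, i.e. `e.base`, with the pair
`(e.x₁, e.x₂)`, is the universal object of equivalences `Eq(E) ⟶ B × B`. -/
def IsUniversal (e : EquivalenceData Q) : Prop :=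
  ∀ d : EquivalenceData Q, Nonempty (Unique (Hom d e))

end EquivalenceData

/-- `π : E ⟶ B` is univalent (with respect to the path object `Q`): the morphism
`idtoequiv : B ⟶ Eq(E)` that classifies the identity equivalences is a weak equivalence. -/
structure IsUnivalent {C : Type u} [Category.{v} C] [CategoryWithFibrations C]
    [CategoryWithWeakEquivalences C] {E B : C} {π : E ⟶ B} (Q : FibrewisePath π) : Prop where
  isPathObject : Q.IsPathObject
  idtoequiv : ∃ e : EquivalenceData Q, e.IsUniversal ∧
    ∃ k : EquivalenceData.Hom (EquivalenceData.refl Q) e, WeakEquivalence k.φ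

/-! ### Types built from finite limits and colimits -/

section Types

variable {C : Type u} [Category.{v} C]

/-- All pullback functors `C / Y ⥤ C / X` have right adjoints. -/
def IsLocallyCartesianClosed (C : Type u) [Category.{v} C] [HasPullbacks C] : Prop :=
  ∀ {X Y : C} (f : X ⟶ Y), (Over.pullback f).IsLeftAdjoint

/-- `zero : T ⟶ N` (with `T` terminal) and `succ : N ⟶ N` form a natural numbers object. -/
structure IsNaturalNumbersObject {T N : C} (zero : T ⟶ N) (succ : N ⟶ N) : Prop where
  isTerminal : Nonempty (IsTerminal T)
  existsUnique : ∀ {A : C} (a : T ⟶ A) (t : A ⟶ A),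
    ∃! r : N ⟶ A, zero ≫ r = a ∧ succ ≫ r = r ≫ t

variable [CategoryWithWeakEquivalences C]

/-- The map from `D` to the terminal object is a weak equivalence. -/
def IsWeaklyContractible (D : C) : Prop :=
  ∃ (T : C) (hT : IsTerminal T), WeakEquivalence (hT.from D)

variable [CategoryWithCofibrations C]

/-- `i : S ⟶ D` is a model of the boundary inclusion of the `n`-disk: a cofibration with weakly
contractible codomain, where `S` is initial if `n = 0`, and otherwise `S` is obtained by gluing two
`(n - 1)`-disks along their boundary. -/
inductive IsCellBoundary : ℕ → ∀ {S D : C}, (S ⟶ D) → Prop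
  | zero {S D : C} (i : S ⟶ D) (hS : IsInitial S) (hi : Cofibration i)
      (hD : IsWeaklyContractible D) : IsCellBoundary 0 i
  | succ {n : ℕ} {S D₁ D₂ S' D : C} (i₁ : S ⟶ D₁) (i₂ : S ⟶ D₂) (j₁ : D₁ ⟶ S') (j₂ : D₂ ⟶ S')
      (h₁ : IsCellBoundary n i₁) (h₂ : IsCellBoundary n i₂) (sq : IsPushout i₁ i₂ j₁ j₂)
      (i : S' ⟶ D) (hi : Cofibration i) (hD : IsWeaklyContractible D) :
      IsCellBoundary (n + 1) i

/-- `X` is weakly equivalent to the boundary of an `(n + 1)`-disk, i.e. `X` is an `n`-sphere. Fibrancy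
is not included; a type contained in a universe is automatically fibrant. -/
def IsSphere (n : ℕ) (X : C) : Prop :=
  ∃ (S D : C) (i : S ⟶ D) (f : S ⟶ X), IsCellBoundary (n + 1) i ∧ WeakEquivalence f

/-- The restriction of the diagram `Q` to the elements below `j`. -/
def latchingDiagram {J : Type} [PartialOrder J] (Q : J ⥤ C) (j : J) : {i : J // i < j} ⥤ C :=
  (Subtype.mono_coe fun i => i < j).functor ⋙ Q

/-- The cocone with vertex `Q j` on the restriction of `Q` to the elements below `j`. -/
def latchingCocone {J : Type} [PartialOrder J] (Q : J ⥤ C) (j : J) :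
    Cocone (latchingDiagram Q j) where
  pt := Q.obj j
  ι :=
    { app := fun i => Q.map (homOfLE i.2.le)
      naturality := fun _ _ _ =>
        ((Q.map_comp _ _).symm.trans (congrArg Q.map (Subsingleton.elim _ _))).trans
          (Category.comp_id _).symm }

/-- `X` is a cell complex of shape `J`: it is weakly equivalent to the homotopy colimit of the
constant diagram at the terminal object over the poset `J`, computed as the colimit of a diagram of
weakly contractible objects whose latching maps are cofibrations. Classically, this is the
geometric realization of the order complex of `J`. For instance, every finite simplicial complex
(such as a triangulated torus) is the cell complex of its poset of simplices. -/
def IsCellComplex (J : Type) [PartialOrder J] (X : C) : Prop :=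
  ∃ (Q : J ⥤ C) (c : Cocone Q) (_ : IsColimit c) (f : c.pt ⟶ X),
    (∀ j, IsWeaklyContractible (Q.obj j)) ∧
    (∀ j, ∃ (l : Cocone (latchingDiagram Q j)) (hl : IsColimit l),
      Cofibration (hl.desc (latchingCocone Q j))) ∧
    WeakEquivalence f

end Types

end FilterQuot

/-! The filter quotient inverts the projections `X ⨯ U ⟶ X` with `U ∈ Φ`, and it does so by a
calculus of right fractions. A finite amount of data in `C_Φ` therefore comes, up to isomorphism,
from data in `C`, and finitely many equations that hold in the image hold in `C` after multiplying
with one small enough member of `Φ`. Everything in the theorem is either finitary or reduces to one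
lifting or factorization problem at a time, so it can be solved in `C` at a single level and
projected back. Phrases such as "at all sufficiently small levels" are handled by the filter
`levels`, so that finitely many conditions are met together by `Filter.Eventually.and`.

The fraction property `IsRightFractions` is proved for four functors: `proj`, its action on arrows,
`cartProj` on pullback squares, and `projTotalFunctor` on arrows with structure. Two further facts
make it effective. A morphism that becomes invertible is invertible at small levels
(`eventually_isIso`), and hence a square that becomes a pullback is a pullback at small levels
(`eventually_isPullback`).

For the model structure, let `S` respect isomorphisms and be stable under products with members of
`Φ`. Then the image of `f` lies in `S_Φ` if and only if `f × V` lies in `S` for all small `V`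
(`IsStable.descend_iff`). Two-out-of-three, retracts, factorizations and lifts pass to `S_Φ`, and `S
↦ S_Φ` commutes with intersections, so both weak factorization systems descend. Fibrations are
stable because `f × U` is a base change of `f`; for the other two classes stability is part of the
definition of a model filter.

Local cartesian closure makes `- × U` a left adjoint. Colimit cocones and the recursion principle of
a natural numbers object thus survive restriction to a level, which gives preservation of finite
colimits and of natural numbers objects, and from the former that of spheres and finite cell
complexes.

A structure in `F_Φ` is a class of presentations, and two presentations agree if and only if they
have a common restriction. Local representability, relative acyclicity and the universe property are
first put in Yoneda form, as universal properties or extension problems for arrows with structure,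
and then transferred by fractions. A family of equivalences is again finitely many morphisms and
equations, so the universal one is preserved, and with it univalence. -/

namespace FilterQuot

attribute [local simp] prod.lift_fst prod.lift_snd prod.lift_fst_assoc prod.lift_snd_assoc

/-! ### Functors that admit a calculus of right fractions -/

/-- `P` exhibits its codomain as the localization of its domain at the morphisms that it inverts, with a
calculus of right fractions. -/
structure IsRightFractions {E E' : Type*} [Category E] [Category E'] (P : E ⥤ E') : Prop where
  surj : ∀ Y : E', ∃ X : E, Nonempty (P.obj X ≅ Y)
  lift : ∀ {X Y : E} (m : P.obj X ⟶ P.obj Y), ∃ (X' : E) (ρ : X' ⟶ X) (m' : X' ⟶ Y),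
    IsIso (P.map ρ) ∧ P.map ρ ≫ m = P.map m'
  eq : ∀ {X Y : E} (m m' : X ⟶ Y), P.map m = P.map m' →
    ∃ (X' : E) (ρ : X' ⟶ X), IsIso (P.map ρ) ∧ ρ ≫ m = ρ ≫ m'

namespace IsRightFractions

variable {E E' : Type*} [Category E] [Category E'] {P : E ⥤ E'} (hP : IsRightFractions P)
include hP

/-- Every morphism to an object in the image is the image of a morphism, up to an isomorphism. -/
lemma exists_iso_map {Y : E'} {X : E} (m : Y ⟶ P.obj X) :
    ∃ (X' : E) (e : P.obj X' ≅ Y) (m' : X' ⟶ X), e.hom ≫ m = P.map m' := by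
  obtain ⟨Z, ⟨e⟩⟩ := hP.surj Y
  obtain ⟨X', ρ, m', _, h⟩ := hP.lift (e.hom ≫ m)
  exact ⟨X', asIso (P.map ρ) ≪≫ e, m', by simpa using h⟩

/-- The second leg is lifted after the first, and the denominator this requires is absorbed into the
first lift. -/
lemma exists_iso_map₂ {Y : E'} {X₁ X₂ : E} (m₁ : Y ⟶ P.obj X₁) (m₂ : Y ⟶ P.obj X₂) :
    ∃ (X' : E) (e : P.obj X' ≅ Y) (m₁' : X' ⟶ X₁) (m₂' : X' ⟶ X₂),
      e.hom ≫ m₁ = P.map m₁' ∧ e.hom ≫ m₂ = P.map m₂' := by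
  obtain ⟨X, e, m₁', h₁⟩ := hP.exists_iso_map m₁
  obtain ⟨X', ρ, m₂', _, h₂⟩ := hP.lift (e.hom ≫ m₂)
  exact ⟨X', asIso (P.map ρ) ≪≫ e, ρ ≫ m₁', m₂', by simp [h₁], by simpa using h₂⟩

/-- The category of objects under a given one is cofiltered, in the form of completions of cospans. -/
lemma exists_square {Y : E'} {h h' g : E} (n : Y ⟶ P.obj h) (n' : Y ⟶ P.obj h') (k : h ⟶ g)
    (k' : h' ⟶ g) (e : n ≫ P.map k = n' ≫ P.map k') :
    ∃ (h'' : E) (n'' : Y ⟶ P.obj h'') (l : h'' ⟶ h) (l' : h'' ⟶ h'),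
      n'' ≫ P.map l = n ∧ n'' ≫ P.map l' = n' ∧ l ≫ k = l' ≫ k' := by
  obtain ⟨X, i, m, m', hm, hm'⟩ := hP.exists_iso_map₂ n n'
  -- After both legs are lifted, the square commutes only in the image; one more denominator makes
  -- it commute in `E`.
  obtain ⟨X', ρ, _, hρ⟩ := hP.eq (m ≫ k) (m' ≫ k') (by simp [← hm, ← hm', e])
  refine ⟨X', i.inv ≫ inv (P.map ρ), ρ ≫ m, ρ ≫ m', ?_, ?_, by simpa using hρ⟩
  · simp [← hm]
  · simp [← hm']

end IsRightFractions

/-! ### Restriction to a subterminal object -/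

section Restrict

variable {C : Type u} [Category.{v} C] [HasFiniteProducts C]

/-- The product with a fixed object. -/
noncomputable def restrict (U : C) : C ⥤ C where
  obj X := X ⨯ U
  map f := prod.map f (𝟙 U)

/-- If there is a morphism `V ⟶ U` to a subterminal object, then restricting to `U` first has no effect on
the restriction to `V`. -/
noncomputable def restrictRestrictIso {U V : C} (hU : IsSubterminal U) (a : V ⟶ U) :
    restrict U ⋙ restrict V ≅ restrict V :=
  NatIso.ofComponents (fun X =>
    { hom := prod.map prod.fst (𝟙 V)
      inv := prod.lift (prod.map (𝟙 X) a) prod.snd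
      hom_inv_id := by
        change prod.map prod.fst (𝟙 V) ≫ prod.lift (prod.map (𝟙 X) a) prod.snd =
          𝟙 ((X ⨯ U) ⨯ V)
        ext
        · simp
        · exact hU _ _
        · simp
      inv_hom_id := by
        change prod.lift (prod.map (𝟙 X) a) prod.snd ≫ prod.map prod.fst (𝟙 V) = 𝟙 (X ⨯ V)
        ext <;> simp }) (fun {X Y} f => by
      change prod.map (prod.map f (𝟙 U)) (𝟙 V) ≫ prod.map prod.fst (𝟙 V) =
        prod.map prod.fst (𝟙 V) ≫ prod.map f (𝟙 V)
      ext <;> simp)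

/-- Restriction to a level is base change along `Y ⨯ U ⟶ Y`. For this reason fibrations restrict,
structures on `f` restrict, and `f × U ⟶ f` is a morphism of `CartArrow C`. -/
lemma isPullback_prod_fst {X Y : C} (f : X ⟶ Y) (U : C) :
    IsPullback (prod.fst : X ⨯ U ⟶ X) (prod.map f (𝟙 U)) f prod.fst := by
  refine ⟨⟨by simp⟩, ⟨PullbackCone.IsLimit.mk _ (fun s => prod.lift s.fst (s.snd ≫ prod.snd))
    (fun s => prod.lift_fst _ _) (fun s => ?_) (fun s m h₁ h₂ => ?_)⟩⟩
  · ext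
    · simp [s.condition]
    · simp
  · ext
    · simp [h₁]
    · simp [← h₂]

lemma isPullback_prod_map {A B X Y : C} {f : A ⟶ B} {g : A ⟶ X} {h : B ⟶ Y} {k : X ⟶ Y}
    (sq : IsPullback f g h k) (U : C) :
    IsPullback (prod.map f (𝟙 U)) (prod.map g (𝟙 U)) (prod.map h (𝟙 U)) (prod.map k (𝟙 U)) := by
  refine IsPullback.of_right ?_ (by ext <;> simp [sq.w]) (isPullback_prod_fst h U)
  have := (isPullback_prod_fst g U).paste_horiz sq
  rwa [← prod.map_fst f (𝟙 U), ← prod.map_fst k (𝟙 U)] at this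

end Restrict

/-! ### Sufficiently small levels, and the fractions of the filter quotient -/

namespace SubterminalFilter

variable {C : Type u} [Category.{v} C] [HasFiniteProducts C] (Φ : SubterminalFilter C)

/-- The filter on the objects of `C` generated by the sets of members of `Φ` below a given one. -/
def levels : Filter C where
  sets := {s | ∃ U, Φ.mem U ∧ ∀ V, Φ.mem V → (V ⟶ U) → V ∈ s}
  univ_sets := ⟨_, Φ.mem_terminal, fun _ _ _ => Set.mem_univ _⟩
  sets_of_superset := by
    rintro s t ⟨U, hU, h⟩ hst
    exact ⟨U, hU, fun V hV a => hst (h V hV a)⟩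
  inter_sets := by
    rintro s t ⟨U, hU, h⟩ ⟨U', hU', h'⟩
    exact ⟨U ⨯ U', Φ.mem_prod hU hU', fun V hV a => ⟨h V hV (a ≫ prod.fst), h' V hV (a ≫ prod.snd)⟩⟩

instance : Φ.levels.NeBot := by
  refine ⟨fun h => ?_⟩
  obtain ⟨U, hU, h⟩ := Filter.empty_mem_iff_bot.2 h
  exact h U hU (𝟙 U)

/-- The filter is proper, so a conjunction of this with other eventual statements yields an actual
member of `Φ` at which all of them hold. -/
lemma eventually_mem : ∀ᶠ U in Φ.levels, Φ.mem U :=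
  ⟨_, Φ.mem_terminal, fun _ hV _ => hV⟩

lemma eventually_nonempty_hom {U : C} (hU : Φ.mem U) : ∀ᶠ V in Φ.levels, Nonempty (V ⟶ U) :=
  ⟨U, hU, fun _ _ a => ⟨a⟩⟩

lemma proj_map_eq_iff {X Y : C} {f g : X ⟶ Y} :
    Φ.proj.map f = Φ.proj.map g ↔
      ∃ U, Φ.mem U ∧ (prod.fst : X ⨯ U ⟶ X) ≫ f = prod.fst ≫ g := by
  refine (Φ.homMk_eq_iff _ _).trans ⟨fun h => ?_, fun ⟨U, hU, h⟩ => ?_⟩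
  · obtain ⟨W, hW, ⟨a⟩, ⟨b⟩, h⟩ := h.ev_eq
    refine ⟨W, hW, ?_⟩
    have := h (prod.snd : X ⨯ W ⟶ W) prod.fst (prod.snd ≫ a) (prod.snd ≫ b)
    rwa [ofHom_ev, ofHom_ev] at this
  · refine LevelHom.rel_of_ev hU (terminal.from _) (terminal.from _) ?_
    rw [ofHom_ev, ofHom_ev, h]

lemma eventually_fst_comp_eq {X Y : C} {f g : X ⟶ Y} (h : Φ.proj.map f = Φ.proj.map g) :
    ∀ᶠ U in Φ.levels, (prod.fst : X ⨯ U ⟶ X) ≫ f = prod.fst ≫ g := by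
  obtain ⟨U, hU, h⟩ := Φ.proj_map_eq_iff.1 h
  refine ⟨U, hU, fun V hV a => ?_⟩
  have := congrArg (prod.map (𝟙 X) a ≫ ·) h
  simpa using this

/-- The identity of `X ⨯ U`, read as a representative at level `U`, is a section `X ⟶ X ⨯ U` of the
projection in the quotient. The projection is also a monomorphism there, so the section is its
inverse. -/
lemma isIso_proj_map_fst {U : C} (hU : Φ.mem U) (X : C) :
    IsIso (Φ.proj.map (prod.fst : X ⨯ U ⟶ X)) := by
  let i : Φ.proj.obj X ⟶ Φ.proj.obj (X ⨯ U) := homMk ⟨U, hU, 𝟙 _⟩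
  have h : i ≫ Φ.proj.map (prod.fst : X ⨯ U ⟶ X) = 𝟙 _ := by
    refine (Φ.homMk_comp_ofHom _ _).trans ?_
    rw [← Φ.proj.map_id]
    refine (Φ.homMk_eq_iff _ _).2 (LevelHom.rel_of_ev hU (𝟙 _) (terminal.from _) ?_)
    rw [ofHom_ev]
    simp [LevelHom.ev]
  refine ⟨i, ?_, h⟩
  have hm : Mono (Φ.proj.map (prod.fst : X ⨯ U ⟶ X)) := by
    -- In `C` the projection is monic because `U` is subterminal. Monicity is a pullback condition,
    -- and `P_Φ` preserves pullback squares.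
    have : IsPullback (𝟙 (X ⨯ U)) (𝟙 (X ⨯ U)) (prod.fst : X ⨯ U ⟶ X) prod.fst := by
      refine IsPullback.of_isLimit' ⟨rfl⟩ (PullbackCone.IsLimit.mk _ (fun s => s.fst)
        (fun s => by simp) (fun s => ?_) (fun s m h₁ _ => by simpa using h₁))
      ext
      · simpa using s.condition
      · exact Φ.isSubterminal hU _ _
    have := Φ.isPullback_proj_map this
    rw [Φ.proj.map_id] at this
    exact ⟨fun a b hab => by
      obtain ⟨l, h₁, h₂⟩ := this.exists_lift a b hab
      rw [← h₁, ← h₂]⟩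
  rw [← cancel_mono (Φ.proj.map (prod.fst : X ⨯ U ⟶ X)), Category.assoc, h, Category.comp_id,
    Category.id_comp]

lemma eventually_lift {X Y : C} (m : Φ.proj.obj X ⟶ Φ.proj.obj Y) :
    ∀ᶠ U in Φ.levels, ∃ f : X ⨯ U ⟶ Y,
      Φ.proj.map (prod.fst : X ⨯ U ⟶ X) ≫ m = Φ.proj.map f := by
  obtain ⟨p, rfl⟩ := Φ.homMk_surjective m
  refine ⟨p.level, p.mem, fun V hV a => ⟨prod.map (𝟙 X) a ≫ p.hom, ?_⟩⟩
  refine (Φ.homMk_comp _ _).trans ((Φ.homMk_eq_iff _ _).2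
    (LevelHom.rel_of_ev hV (prod.lift (terminal.from _) a) (terminal.from _) ?_))
  rw [ofHom_ev]
  erw [LevelHom.comp_ev']
  rw [ofHom_ev]
  simp only [LevelHom.ev, ← Category.assoc]
  congr 1
  ext
  · simp
  · exact Φ.isSubterminal p.mem _ _

/-- The representative of a morphism of the filter quotient, as a fraction. -/
lemma fst_comp_homMk {X Y : C} (p : Φ.LevelHom X Y) :
    Φ.proj.map (prod.fst : X ⨯ p.level ⟶ X) ≫ homMk p = Φ.proj.map p.hom := by
  refine (Φ.homMk_comp _ _).trans ((Φ.homMk_eq_iff _ _).2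
    (LevelHom.rel_of_ev p.mem (prod.lift (terminal.from _) (𝟙 _)) (terminal.from _) ?_))
  rw [ofHom_ev]
  erw [LevelHom.comp_ev']
  rw [ofHom_ev]
  simp only [LevelHom.ev]
  congr 1
  ext
  · simp
  · exact Φ.isSubterminal p.mem _ _

lemma eventually_restrict_of_restrict (S : MorphismProperty C) [S.RespectsIso]
    (hS : ∀ {X Y : C} (f : X ⟶ Y) {U : C}, Φ.mem U → S f → S (prod.map f (𝟙 U)))
    {X Y : C} {f : X ⟶ Y} {U : C} (hU : Φ.mem U) (h : S (prod.map f (𝟙 U))) :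
    ∀ᶠ V in Φ.levels, S (prod.map f (𝟙 V)) := by
  refine ⟨U, hU, fun V hV a => ?_⟩
  exact (S.arrow_mk_iso_iff (((Functor.mapArrowFunctor _ _).mapIso
    (restrictRestrictIso (Φ.isSubterminal hU) a)).app (Arrow.mk f))).1 (hS _ hV h)

/-- Lifting arguments typically restrict twice, first to lift morphisms and then to make diagrams
commute. This brings a conclusion about `(f × U) × V` back to `f`. -/
lemma eventually_of_restrict_restrict (S : MorphismProperty C) [S.RespectsIso]
    (hS : ∀ {X Y : C} (f : X ⟶ Y) {U : C}, Φ.mem U → S f → S (prod.map f (𝟙 U)))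
    {X Y : C} {f : X ⟶ Y} {U V : C} (hU : Φ.mem U) (hV : Φ.mem V)
    (h : S (prod.map (prod.map f (𝟙 U)) (𝟙 V))) : ∀ᶠ W in Φ.levels, S (prod.map f (𝟙 W)) := by
  refine ((Φ.eventually_restrict_of_restrict S hS hV h).and
    (Φ.eventually_nonempty_hom hU)).mono fun W ⟨hW, ⟨a⟩⟩ => ?_
  exact (S.arrow_mk_iso_iff (((Functor.mapArrowFunctor _ _).mapIso
    (restrictRestrictIso (Φ.isSubterminal hU) a)).app (Arrow.mk f))).1 hW

/-- A morphism that becomes an isomorphism in the filter quotient is an isomorphism at all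
sufficiently small levels. -/
lemma eventually_isIso {X Y : C} (f : X ⟶ Y) (h : IsIso (Φ.proj.map f)) :
    ∀ᶠ V in Φ.levels, IsIso (prod.map f (𝟙 V)) := by
  obtain ⟨U, hU, d, hd⟩ := (Φ.eventually_mem.and (Φ.eventually_lift (inv (Φ.proj.map f)))).exists
  have := Φ.isIso_proj_map_fst hU
  -- The lift `d` of the inverse is completed to a morphism over `U`, the candidate inverse of `f ×
  -- U`. Both composites are identities in the quotient, hence at a second level `V`.
  let d' : Y ⨯ U ⟶ X ⨯ U := prod.lift d prod.snd
  have key : Φ.proj.map d = Φ.proj.map d' ≫ Φ.proj.map prod.fst := by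
    rw [← Functor.map_comp]; simp [d']
  have h₁ : Φ.proj.map (d' ≫ prod.map f (𝟙 U)) = Φ.proj.map (𝟙 _) := by
    rw [← cancel_mono (Φ.proj.map prod.fst), ← Functor.map_comp, Category.assoc, prod.map_fst,
      Functor.map_comp, Functor.map_comp, ← Category.assoc, ← key, ← hd]
    simp
  have h₂ : Φ.proj.map (prod.map f (𝟙 U) ≫ d') = Φ.proj.map (𝟙 _) := by
    rw [← cancel_mono (Φ.proj.map prod.fst), Functor.map_comp, Category.assoc, ← key, ← hd,
      ← Category.assoc, ← Functor.map_comp, prod.map_fst]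
    simp
  obtain ⟨V, hV, e₁, e₂⟩ := (Φ.eventually_mem.and
    ((Φ.eventually_fst_comp_eq h₁).and (Φ.eventually_fst_comp_eq h₂))).exists
  have : IsIso (prod.map (prod.map f (𝟙 U)) (𝟙 V)) := by
    refine ⟨prod.map d' (𝟙 V), ?_, ?_⟩
    · ext1
      · rw [Category.assoc, prod.map_fst, prod.map_fst_assoc, e₂]; simp
      · simp
    · ext1
      · rw [Category.assoc, prod.map_fst, prod.map_fst_assoc, e₁]; simp
      · simp
  exact Φ.eventually_of_restrict_restrict (MorphismProperty.isomorphisms C)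
    (fun _ _ _ hf => by
      rw [MorphismProperty.isomorphisms.iff] at hf ⊢
      infer_instance) hU hV this

lemma proj_isRightFractions : IsRightFractions Φ.proj where
  surj Y := ⟨Y.as, ⟨Iso.refl _⟩⟩
  lift {X Y} m := by
    obtain ⟨U, hU, f, hf⟩ := (Φ.eventually_mem.and (Φ.eventually_lift m)).exists
    exact ⟨_, _, f, Φ.isIso_proj_map_fst hU X, hf⟩
  eq {X Y} m m' h := by
    obtain ⟨U, hU, hf⟩ := Φ.proj_map_eq_iff.1 h
    exact ⟨_, _, Φ.isIso_proj_map_fst hU X, hf⟩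

/-- The restriction of an arrow to a member of `Φ` is isomorphic to it in the filter quotient. -/
noncomputable def restrictArrowHom {X Y : C} (f : X ⟶ Y) (U : C) :
    Arrow.mk (prod.map f (𝟙 U)) ⟶ Arrow.mk f :=
  Arrow.homMk prod.fst prod.fst (prod.map_fst f (𝟙 U)).symm

lemma isIso_map_restrictArrowHom {X Y : C} (f : X ⟶ Y) {U : C} (hU : Φ.mem U) :
    IsIso (Φ.proj.mapArrow.map (restrictArrowHom f U)) := by
  have h₁ : IsIso (Φ.proj.mapArrow.map (restrictArrowHom f U)).left := Φ.isIso_proj_map_fst hU X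
  have h₂ : IsIso (Φ.proj.mapArrow.map (restrictArrowHom f U)).right := Φ.isIso_proj_map_fst hU Y
  exact Arrow.isIso_of_isIso_left_of_isIso_right _

/-- A level `U` lifts the two horizontal sides, and a further level `V` makes the lifted square
commute. The new arrow is `(f × U) × V`. -/
lemma exists_lift_square {X Y Z W : C} {f : X ⟶ Y} {g : Z ⟶ W}
    (a : Φ.proj.obj X ⟶ Φ.proj.obj Z) (b : Φ.proj.obj Y ⟶ Φ.proj.obj W)
    (w : a ≫ Φ.proj.map g = Φ.proj.map f ≫ b) :
    ∃ (X' Y' : C) (f' : X' ⟶ Y') (ρ₁ : X' ⟶ X) (ρ₂ : Y' ⟶ Y) (a' : X' ⟶ Z) (b' : Y' ⟶ W),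
      f' ≫ ρ₂ = ρ₁ ≫ f ∧ a' ≫ g = f' ≫ b' ∧ IsIso (Φ.proj.map ρ₁) ∧ IsIso (Φ.proj.map ρ₂) ∧
        Φ.proj.map ρ₁ ≫ a = Φ.proj.map a' ∧ Φ.proj.map ρ₂ ≫ b = Φ.proj.map b' := by
  obtain ⟨U, hU, ⟨l, hl⟩, ⟨r, hr⟩⟩ := (Φ.eventually_mem.and
    ((Φ.eventually_lift a).and (Φ.eventually_lift b))).exists
  have h : Φ.proj.map (l ≫ g) = Φ.proj.map (prod.map f (𝟙 U) ≫ r) := by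
    rw [Functor.map_comp, Functor.map_comp, ← hl, ← hr, ← Φ.proj.map_comp_assoc, prod.map_fst,
      Functor.map_comp, Category.assoc, Category.assoc, w]
  obtain ⟨V, hV, h⟩ := (Φ.eventually_mem.and (Φ.eventually_fst_comp_eq h)).exists
  have := Φ.isIso_proj_map_fst hU
  have := Φ.isIso_proj_map_fst hV
  refine ⟨_, _, prod.map (prod.map f (𝟙 U)) (𝟙 V), prod.fst ≫ prod.fst, prod.fst ≫ prod.fst,
    prod.fst ≫ l, prod.fst ≫ r, by simp, by simp [h], ?_, ?_, ?_, ?_⟩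
  · rw [Functor.map_comp]; infer_instance
  · rw [Functor.map_comp]; infer_instance
  · rw [Functor.map_comp, Functor.map_comp, Category.assoc, hl]
  · rw [Functor.map_comp, Functor.map_comp, Category.assoc, hr]

lemma mapArrow_isRightFractions : IsRightFractions Φ.proj.mapArrow where
  surj := by
    rintro ⟨⟨X⟩, ⟨Y⟩, m⟩
    obtain ⟨X', ρ, m', hρ, h⟩ := Φ.proj_isRightFractions.lift (X := X) (Y := Y) m
    let e : Φ.proj.obj X' ≅ Φ.proj.obj X := asIso (Φ.proj.map ρ)
    exact ⟨Arrow.mk m', ⟨Arrow.isoMk e (Iso.refl _)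
      (h.trans (Category.comp_id _).symm)⟩⟩
  lift {f g} m := by
    obtain ⟨X', Y', f', ρ₁, ρ₂, a, b, e₁, e₂, i₁, i₂, h₁, h₂⟩ :=
      Φ.exists_lift_square (f := f.hom) (g := g.hom) m.left m.right m.w
    have : IsIso (Φ.proj.mapArrow.map (Arrow.homMk ρ₁ ρ₂ e₁.symm : Arrow.mk f' ⟶ f)).left := i₁
    have : IsIso (Φ.proj.mapArrow.map (Arrow.homMk ρ₁ ρ₂ e₁.symm : Arrow.mk f' ⟶ f)).right := i₂
    exact ⟨Arrow.mk f', Arrow.homMk ρ₁ ρ₂ e₁.symm, Arrow.homMk a b e₂,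
      Arrow.isIso_of_isIso_left_of_isIso_right _, Arrow.hom_ext _ _ h₁ h₂⟩
  eq {f g} m m' h := by
    have h₁ : Φ.proj.map m.left = Φ.proj.map m'.left := congrArg (·.left) h
    have h₂ : Φ.proj.map m.right = Φ.proj.map m'.right := congrArg (·.right) h
    obtain ⟨U, hU, e₁, e₂⟩ := (Φ.eventually_mem.and
      ((Φ.eventually_fst_comp_eq h₁).and (Φ.eventually_fst_comp_eq h₂))).exists
    refine ⟨_, restrictArrowHom f.hom U, Φ.isIso_map_restrictArrowHom f.hom hU,
      Arrow.hom_ext _ _ e₁ e₂⟩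

end SubterminalFilter

/-! ### Arrows with pullback squares and notions of fibred structure in the filter quotient -/

namespace CartArrow

variable {C : Type u} [Category.{v} C]

@[simp]
lemma comp_left {f g h : CartArrow C} (m : f ⟶ g) (n : g ⟶ h) : (m ≫ n).left = m.left ≫ n.left := rfl

@[simp]
lemma comp_right {f g h : CartArrow C} (m : f ⟶ g) (n : g ⟶ h) :
    (m ≫ n).right = m.right ≫ n.right := rfl

lemma hom_ext {f g : CartArrow C} {m n : f ⟶ g} (h₁ : m.left = n.left) (h₂ : m.right = n.right) :
    m = n := Hom.ext h₁ h₂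

lemma isIso_of_isIso {f g : CartArrow C} (m : f ⟶ g) (h₁ : IsIso m.left) (h₂ : IsIso m.right) :
    IsIso m :=
  ⟨⟨inv m.left, inv m.right, IsPullback.of_horiz_isIso ⟨by
    simp [m.isPullback.w]⟩⟩,
    hom_ext (IsIso.hom_inv_id _) (IsIso.hom_inv_id _),
    hom_ext (IsIso.inv_hom_id _) (IsIso.inv_hom_id _)⟩

lemma isIso_right {f g : CartArrow C} (m : f ⟶ g) [IsIso m] : IsIso m.right :=
  inferInstanceAs (IsIso ((base C).map m))

/-- A pullback square is determined by its bottom side and its composite with a pullback square. -/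
lemma hom_ext_of_comp {f g h : CartArrow C} {m n : f ⟶ g} (k : g ⟶ h) (e : m ≫ k = n ≫ k)
    (h₂ : m.right = n.right) : m = n := by
  refine hom_ext (k.isPullback.hom_ext (congrArg Hom.left e) ?_) h₂
  rw [m.isPullback.w, n.isPullback.w, h₂]

/-- Pullback squares to a given arrow factor through each other as soon as their bottom sides do. -/
lemma exists_lift {f g h : CartArrow C} (m : f ⟶ h) (k : g ⟶ h) (b : f.right ⟶ g.right)
    (e : b ≫ k.right = m.right) : ∃ n : f ⟶ g, n.right = b ∧ n ≫ k = m := by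
  let l := k.isPullback.lift m.left (f.hom ≫ b) (by rw [Category.assoc, e, m.isPullback.w])
  have h₁ : l ≫ k.left = m.left := k.isPullback.lift_fst _ _ _
  have h₂ : l ≫ g.hom = f.hom ≫ b := k.isPullback.lift_snd _ _ _
  refine ⟨⟨l, b, IsPullback.of_right ?_ h₂ k.isPullback⟩, rfl, hom_ext h₁ e⟩
  rw [h₁, e]
  exact m.isPullback

variable [HasFiniteProducts C]

/-- The restriction of an arrow to an object. -/
noncomputable def restrict (f : CartArrow C) (U : C) : CartArrow C := ⟨prod.map f.hom (𝟙 U)⟩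

noncomputable def restrictFst (f : CartArrow C) (U : C) : f.restrict U ⟶ f :=
  ⟨prod.fst, prod.fst, isPullback_prod_fst f.hom U⟩

noncomputable def restrictMap {f g : CartArrow C} (m : f ⟶ g) (U : C) : f.restrict U ⟶ g.restrict U :=
  ⟨prod.map m.left (𝟙 U), prod.map m.right (𝟙 U), isPullback_prod_map m.isPullback U⟩

lemma restrictMap_fst {f g : CartArrow C} (m : f ⟶ g) (U : C) :
    restrictMap m U ≫ g.restrictFst U = f.restrictFst U ≫ m :=
  hom_ext (prod.map_fst _ _) (prod.map_fst _ _)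

end CartArrow

namespace SubterminalFilter

variable {C : Type u} [Category.{v} C] [HasFiniteProducts C] (Φ : SubterminalFilter C)

lemma isIso_cartProj_map {f g : CartArrow C} (m : f ⟶ g) (h₁ : IsIso (Φ.proj.map m.left))
    (h₂ : IsIso (Φ.proj.map m.right)) : IsIso (Φ.cartProj.map m) :=
  CartArrow.isIso_of_isIso _ h₁ h₂

lemma isIso_cartProj_map_restrictFst (f : CartArrow C) {U : C} (hU : Φ.mem U) :
    IsIso (Φ.cartProj.map (f.restrictFst U)) :=
  Φ.isIso_cartProj_map _ (Φ.isIso_proj_map_fst hU _) (Φ.isIso_proj_map_fst hU _)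

/-- A commutative square that becomes a pullback in the filter quotient is a pullback at small levels. -/
lemma eventually_isPullback [HasPullbacks C] {A B X Y : C} {f : A ⟶ B} {g : A ⟶ X} {h : B ⟶ Y}
    {k : X ⟶ Y} (w : f ≫ h = g ≫ k)
    (sq : IsPullback (Φ.proj.map f) (Φ.proj.map g) (Φ.proj.map h) (Φ.proj.map k)) :
    ∀ᶠ V in Φ.levels, IsPullback (prod.fst ≫ f) (prod.map g (𝟙 V)) h (prod.fst ≫ k) := by
  have pb := IsPullback.of_hasPullback h k
  -- The comparison with the actual pullback becomes invertible in the quotient, so it is invertible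
  -- at small levels.
  let c := pb.lift f g w
  have hc₁ : c ≫ pullback.fst h k = f := pb.lift_fst _ _ _
  have hc₂ : c ≫ pullback.snd h k = g := pb.lift_snd _ _ _
  have hc : IsIso (Φ.proj.map c) := by
    have := Φ.isPullback_proj_map pb
    have e : Φ.proj.map c = (sq.isoIsPullback _ _ this).hom := by
      refine this.hom_ext ?_ ?_
      · rw [← Functor.map_comp, hc₁, IsPullback.isoIsPullback_hom_fst]
      · rw [← Functor.map_comp, hc₂, IsPullback.isoIsPullback_hom_snd]
    rw [e]
    infer_instance
  refine (Φ.eventually_isIso c hc).mono fun V hV => ?_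
  have h₁ : IsPullback (prod.map c (𝟙 V)) (prod.map g (𝟙 V))
      (prod.map (pullback.snd h k) (𝟙 V)) (𝟙 _) :=
    IsPullback.of_horiz_isIso ⟨by ext <;> simp [hc₂]⟩
  have h₂ := h₁.paste_horiz ((isPullback_prod_fst (pullback.snd h k) V).paste_horiz pb)
  rwa [prod.map_fst_assoc, hc₁, Category.id_comp] at h₂

/-- Beyond lifting commutative squares, the lifts must be pullbacks. They are so in the quotient,
hence also in `C` at small levels. -/
lemma cartProj_isRightFractions [HasPullbacks C] : IsRightFractions Φ.cartProj where
  surj := by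
    rintro ⟨m⟩
    rename_i X Y
    obtain ⟨X', ρ, m', hρ, h⟩ := Φ.proj_isRightFractions.lift (X := X.as) (Y := Y.as) m
    let r : Φ.proj.obj X' ⟶ X := Φ.proj.map ρ
    have : IsIso r := hρ
    let b : Φ.proj.obj Y.as ⟶ Y := 𝟙 Y
    have : IsIso b := inferInstanceAs (IsIso (𝟙 Y))
    have sq : IsPullback r (Φ.proj.map m') m b :=
      IsPullback.of_horiz_isIso ⟨h.trans (Category.comp_id _).symm⟩
    let n : Φ.cartProj.obj ⟨m'⟩ ⟶ ⟨m⟩ := ⟨r, b, sq⟩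
    have : IsIso n := CartArrow.isIso_of_isIso n hρ this
    exact ⟨⟨m'⟩, ⟨asIso n⟩⟩
  lift {f g} m := by
    obtain ⟨X', Y', f', ρ₁, ρ₂, a, b, e₁, e₂, i₁, i₂, h₁, h₂⟩ :=
      Φ.exists_lift_square (f := f.hom) (g := g.hom) m.left m.right m.isPullback.w
    -- The image of the denominator is a pullback because its horizontal sides are invertible; that
    -- of the numerator is its pasting with `m`.
    have sq₁ : IsPullback (Φ.proj.map ρ₁) (Φ.proj.map f') (Φ.proj.map f.hom) (Φ.proj.map ρ₂) :=
      IsPullback.of_horiz_isIso ⟨by rw [← Functor.map_comp, ← e₁, Functor.map_comp]⟩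
    have sq₂ : IsPullback (Φ.proj.map a) (Φ.proj.map f') (Φ.proj.map g.hom) (Φ.proj.map b) := by
      rw [← h₁, ← h₂]
      exact sq₁.paste_horiz m.isPullback
    obtain ⟨V, hV, s₁, s₂⟩ := (Φ.eventually_mem.and ((Φ.eventually_isPullback e₁.symm sq₁).and
      (Φ.eventually_isPullback e₂ sq₂))).exists
    have := Φ.isIso_proj_map_fst hV
    refine ⟨⟨prod.map f' (𝟙 V)⟩, ⟨_, _, s₁⟩, ⟨_, _, s₂⟩, Φ.isIso_cartProj_map _ ?_ ?_,
      CartArrow.hom_ext ?_ ?_⟩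
    · change IsIso (Φ.proj.map (prod.fst ≫ ρ₁))
      rw [Functor.map_comp]; infer_instance
    · change IsIso (Φ.proj.map (prod.fst ≫ ρ₂))
      rw [Functor.map_comp]; infer_instance
    · change Φ.proj.map (prod.fst ≫ ρ₁) ≫ m.left = Φ.proj.map (prod.fst ≫ a)
      rw [Functor.map_comp, Functor.map_comp, ← h₁]
      exact Category.assoc _ _ _
    · change Φ.proj.map (prod.fst ≫ ρ₂) ≫ m.right = Φ.proj.map (prod.fst ≫ b)
      rw [Functor.map_comp, Functor.map_comp, ← h₂]
      exact Category.assoc _ _ _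
  eq {f g} m m' h := by
    have h₁ : Φ.proj.map m.left = Φ.proj.map m'.left := congrArg CartArrow.Hom.left h
    have h₂ : Φ.proj.map m.right = Φ.proj.map m'.right := congrArg CartArrow.Hom.right h
    obtain ⟨U, hU, e₁, e₂⟩ := (Φ.eventually_mem.and
      ((Φ.eventually_fst_comp_eq h₁).and (Φ.eventually_fst_comp_eq h₂))).exists
    exact ⟨_, f.restrictFst U, Φ.isIso_cartProj_map_restrictFst f hU, CartArrow.hom_ext e₁ e₂⟩

variable (F : FibredStructure.{w} C)

/-- The structure on the image of an arrow induced by a structure on the arrow. -/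
noncomputable def inducedMk {f : CartArrow C} (s : F.obj (op f)) :
    (Φ.induced F).obj (op (Φ.cartProj.obj f)) := Quot.mk _ ⟨f, 𝟙 _, s⟩

variable {F}

lemma induced_map_mk {α β : CartArrow (FilterQuotient Φ)} (n : β ⟶ α) (x : Φ.Presentation F α) :
    (Φ.induced F).map n.op (Quot.mk _ x) = Quot.mk _ (x.pull n) := rfl

lemma mk_eq_map_inducedMk {α : CartArrow (FilterQuotient Φ)} (x : Φ.Presentation F α) :
    (Quot.mk _ x : (Φ.induced F).obj (op α)) = (Φ.induced F).map x.map.op (Φ.inducedMk F x.str) := by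
  rw [inducedMk, induced_map_mk]
  simp [Presentation.pull]

/-- This is the generating relation of `Presentation.Rel`, read as naturality of the map from `F` to
`F_Φ`. -/
lemma map_inducedMk {f g : CartArrow C} (k : f ⟶ g) (s : F.obj (op g)) :
    (Φ.induced F).map (Φ.cartProj.map k).op (Φ.inducedMk F s) = Φ.inducedMk F (F.map k.op s) := by
  refine ((Quot.sound (Presentation.Rel.restrict k (𝟙 _) s)).trans ?_).symm
  rw [inducedMk, induced_map_mk]
  simp [Presentation.pull]

lemma exists_eq_map_inducedMk {α : CartArrow (FilterQuotient Φ)} (x : (Φ.induced F).obj (op α)) :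
    ∃ (g : CartArrow C) (m : α ⟶ Φ.cartProj.obj g) (s : F.obj (op g)),
      x = (Φ.induced F).map m.op (Φ.inducedMk F s) := by
  obtain ⟨x⟩ := x
  exact ⟨_, _, _, Φ.mk_eq_map_inducedMk x⟩

/-- Two presentations that have a common restriction. -/
def Presentation.CommonRestriction {α : CartArrow (FilterQuotient Φ)} (x y : Φ.Presentation F α) :
    Prop :=
  ∃ (h : CartArrow C) (n : α ⟶ Φ.cartProj.obj h) (k : h ⟶ x.arrow) (k' : h ⟶ y.arrow),
    n ≫ Φ.cartProj.map k = x.map ∧ n ≫ Φ.cartProj.map k' = y.map ∧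
      F.map k.op x.str = F.map k'.op y.str

/-- Transitivity is the content: two common restrictions both map to the arrow of the middle
presentation, and the fractions of `cartProj` complete this cospan under `α`. -/
lemma Presentation.commonRestriction_equivalence [HasPullbacks C] (α : CartArrow (FilterQuotient Φ)) :
    Equivalence (Presentation.CommonRestriction (F := F) Φ (α := α)) where
  refl x := ⟨x.arrow, x.map, 𝟙 _, 𝟙 _, by simp, by simp, rfl⟩
  symm := by
    rintro x y ⟨h, n, k, k', e₁, e₂, e⟩
    exact ⟨h, n, k', k, e₂, e₁, e.symm⟩
  trans := by
    rintro x y z ⟨h, n, k, k', e₁, e₂, e⟩ ⟨h', n', l, l', e₁', e₂', e'⟩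
    obtain ⟨h'', n'', p, p', hp, hp', hh⟩ :=
      Φ.cartProj_isRightFractions.exists_square n n' k' l (e₂.trans e₁'.symm)
    refine ⟨h'', n'', p ≫ k, p' ≫ l', ?_, ?_, ?_⟩
    · rw [Functor.map_comp, reassoc_of% hp, e₁]
    · rw [Functor.map_comp, reassoc_of% hp', e₂']
    · have := congrArg (fun q => F.map q.op y.str) hh
      simp only [op_comp, Functor.map_comp_apply] at this ⊢
      rw [e, this, e']

/-- Equal structures in `F_Φ` have to be compared inside `C`. The equality yields a common
restriction, whose map from the image of `f` need not come from `C`; lifting that map costs one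
denominator. -/
lemma exists_of_inducedMk_eq [HasPullbacks C] {f : CartArrow C} {s t : F.obj (op f)}
    (h : Φ.inducedMk F s = Φ.inducedMk F t) :
    ∃ (f' : CartArrow C) (ρ : f' ⟶ f), IsIso (Φ.cartProj.map ρ) ∧ F.map ρ.op s = F.map ρ.op t := by
  have : Presentation.CommonRestriction Φ (⟨f, 𝟙 _, s⟩ : Φ.Presentation F (Φ.cartProj.obj f))
      ⟨f, 𝟙 _, t⟩ := by
    refine (Presentation.commonRestriction_equivalence Φ _).eqvGen_iff.1
      ((Quot.eqvGen_exact h).mono ?_)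
    rintro _ _ ⟨k, m, s⟩
    exact ⟨_, m, 𝟙 _, k, by simp, rfl, by simp⟩
  obtain ⟨h, n, k, k', e₁, e₂, e⟩ := this
  obtain ⟨g', ρ, n', _, hn⟩ := Φ.cartProj_isRightFractions.lift n
  dsimp only at k k' e₁ e₂ e
  -- In the quotient `k` and `k'` are retractions of `n`, so `n' ≫ k` and `n' ≫ k'` have the same
  -- image as `ρ`. Two refinements make both equalities hold in `C`.
  obtain ⟨g₁, ρ₁, _, h₁⟩ := Φ.cartProj_isRightFractions.eq (n' ≫ k) ρ
    (by rw [Functor.map_comp, ← hn, Category.assoc, e₁, Category.comp_id])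
  obtain ⟨g₂, ρ₂, _, h₂⟩ := Φ.cartProj_isRightFractions.eq (ρ₁ ≫ n' ≫ k') (ρ₁ ≫ ρ)
    (by rw [Functor.map_comp, Functor.map_comp, ← hn, Category.assoc, e₂, Category.comp_id,
      Functor.map_comp])
  refine ⟨g₂, ρ₂ ≫ ρ₁ ≫ ρ, ?_, ?_⟩
  · rw [Functor.map_comp, Functor.map_comp]; infer_instance
  · conv_rhs => rw [← h₂]
    rw [← h₁]
    simp only [op_comp, Functor.map_comp_apply]
    rw [e]

end SubterminalFilter

/-! ### Finite limits and colimits in the filter quotient -/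

/-- In a locally cartesian closed category, products with a fixed object have a right adjoint. -/
lemma restrict_isLeftAdjoint {C : Type u} [Category.{v} C] [HasFiniteLimits C]
    (hC : IsLocallyCartesianClosed C) (U : C) : (restrict U).IsLeftAdjoint := by
  -- The functor `- × U` factors as `C ≌ C / 1`, pullback to `C / U`, and the forgetful functor. The
  -- middle one is a left adjoint by hypothesis, and the last one always is.
  have : (Over.forget (⊤_ C)).IsEquivalence :=
    inferInstanceAs (Over.equivalenceOfIsTerminal terminalIsTerminal).functor.IsEquivalence
  have : (Over.star (⊤_ C)).IsEquivalence :=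
    (Over.forgetAdjStar (⊤_ C)).isEquivalence_right_of_isEquivalence_left
  have := hC (terminal.from U)
  have : (Over.star U).IsLeftAdjoint :=
    Functor.isLeftAdjoint_of_iso (Over.starPullbackIsoStar (terminal.from U))
  have e : Over.star U ⋙ Over.forget U ≅ restrict U :=
    NatIso.ofComponents (fun X => prod.braiding U X) (fun {X Y} f => by
      change prod.map (𝟙 U) f ≫ _ = _ ≫ prod.map f (𝟙 U)
      ext <;> simp)
  exact Functor.isLeftAdjoint_of_iso e

namespace SubterminalFilter

section

variable {C : Type u} [Category.{v} C] [HasFiniteProducts C] (Φ : SubterminalFilter C)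

lemma proj_hom_eq_of_isTerminal {T X : C} (hT : IsTerminal T) (m : Φ.proj.obj X ⟶ Φ.proj.obj T) :
    m = Φ.proj.map (hT.from X) := by
  obtain ⟨U, hU, f, hf⟩ := (Φ.eventually_mem.and (Φ.eventually_lift m)).exists
  have := Φ.isIso_proj_map_fst hU X
  rw [← cancel_epi (Φ.proj.map (prod.fst : X ⨯ U ⟶ X)), ← Functor.map_comp,
    hT.hom_ext (prod.fst ≫ hT.from X) f, hf]

/-- The projection preserves terminal objects. -/
noncomputable def isTerminalProj {T : C} (hT : IsTerminal T) : IsTerminal (Φ.proj.obj T) :=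
  IsTerminal.ofUniqueHom (fun X => Φ.proj.map (hT.from X.as)) fun X m =>
    Φ.proj_hom_eq_of_isTerminal (X := X.as) hT m

scoped instance : HasTerminal (FilterQuotient Φ) := (Φ.isTerminalProj terminalIsTerminal).hasTerminal

scoped instance [HasPullbacks C] : HasPullbacks (FilterQuotient Φ) := by
  have : ∀ {X Y Z : FilterQuotient Φ} (f : X ⟶ Z) (g : Y ⟶ Z), HasPullback f g := by
    intro X Y Z f g
    obtain ⟨X', e, f', hf⟩ := Φ.proj_isRightFractions.exists_iso_map (X := Z.as) f
    obtain ⟨Y', e', g', hg⟩ := Φ.proj_isRightFractions.exists_iso_map (X := Z.as) g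
    exact ((Φ.isPullback_proj_map (IsPullback.of_hasPullback f' g')).of_iso (Iso.refl _) e e'
      (Iso.refl _) (by simp; rfl) (by simp; rfl) (by simp [hf]) (by simp [hg])).hasPullback
  exact hasPullbacks_of_hasLimit_cospan _

scoped instance [HasFiniteLimits C] : HasFiniteLimits (FilterQuotient Φ) :=
  hasFiniteLimits_of_hasTerminal_and_pullbacks

instance [HasFiniteLimits C] : PreservesFiniteLimits Φ.proj := by
  have h₁ : PreservesLimit (Functor.empty.{0} C) Φ.proj := preservesLimit_of_preserves_limit_cone
    terminalIsTerminal ((isLimitMapConeEmptyConeEquiv Φ.proj (⊤_ C)).symm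
      (Φ.isTerminalProj terminalIsTerminal))
  have h₂ : PreservesLimitsOfShape (Discrete.{0} PEmpty) Φ.proj :=
    preservesLimitsOfShape_pempty_of_preservesTerminal Φ.proj
  have h₃ : PreservesLimitsOfShape WalkingCospan Φ.proj := ⟨fun {K} => by
    have : PreservesLimit (cospan (K.map WalkingCospan.Hom.inl) (K.map WalkingCospan.Hom.inr))
        Φ.proj := by
      refine preservesLimit_of_preserves_limit_cone (IsPullback.of_hasPullback
        (K.map WalkingCospan.Hom.inl) (K.map WalkingCospan.Hom.inr)).isLimit ?_
      refine (isLimitMapConePullbackConeEquiv Φ.proj ?_).symm ?_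
      · exact pullback.condition
      · exact (Φ.isPullback_proj_map (IsPullback.of_hasPullback _ _)).isLimit
    exact preservesLimit_of_iso_diagram Φ.proj (diagramIsoCospan K).symm⟩
  exact preservesFiniteLimits_of_preservesTerminal_and_pullbacks Φ.proj

/-- A cocone on a finite diagram in the image lifts at some level. -/
lemma exists_lift_cocone {J : Type} [SmallCategory J] [FinCategory J] (K : J ⥤ C) {Y : C}
    (θ : ∀ j, Φ.proj.obj (K.obj j) ⟶ Φ.proj.obj Y)
    (hθ : ∀ {i j} (k : i ⟶ j), Φ.proj.map (K.map k) ≫ θ j = θ i) :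
    ∃ (U V : C) (_ : Φ.mem U) (_ : Φ.mem V) (ψ : ∀ j, (K.obj j ⨯ U) ⨯ V ⟶ Y),
      (∀ {i j} (k : i ⟶ j), prod.map (prod.map (K.map k) (𝟙 U)) (𝟙 V) ≫ ψ j = ψ i) ∧
        ∀ j, Φ.proj.map prod.fst ≫ Φ.proj.map prod.fst ≫ θ j = Φ.proj.map (ψ j) := by
  obtain ⟨U, hU, hψ⟩ := (Φ.eventually_mem.and
    (Filter.eventually_all.2 fun j => Φ.eventually_lift (θ j))).exists
  choose ψ hψ using hψ
  have h : ∀ i j (k : i ⟶ j), Φ.proj.map (prod.map (K.map k) (𝟙 U) ≫ ψ j) = Φ.proj.map (ψ i) := by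
    intro i j k
    rw [Functor.map_comp, ← hψ, ← hψ, ← Functor.map_comp_assoc, prod.map_fst, Functor.map_comp,
      Category.assoc, hθ]
  obtain ⟨V, hV, hV'⟩ := (Φ.eventually_mem.and (Filter.eventually_all.2 fun i =>
    Filter.eventually_all.2 fun j => Filter.eventually_all.2 fun k : i ⟶ j =>
      Φ.eventually_fst_comp_eq (h i j k))).exists
  refine ⟨U, V, hU, hV, fun j => prod.fst ≫ ψ j, fun {i j} k => ?_, fun j => ?_⟩
  · change prod.map _ _ ≫ prod.fst ≫ ψ j = prod.fst ≫ ψ i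
    rw [← hV' i j k, prod.map_fst_assoc]
  · rw [Functor.map_comp, hψ]

end

/-! ### Finite colimits -/

section

variable {C : Type u} [Category.{v} C] [HasFiniteLimits C] (Φ : SubterminalFilter C)
  (hC : IsLocallyCartesianClosed C)
include hC

/-- Restriction to two successive levels is a left adjoint, so it keeps a colimit cocone colimiting.
Since the shape is finite, a cocone in the quotient, or an equality tested on all legs, lives at two
such levels and is settled there. -/
lemma preservesFiniteColimits_proj : PreservesFiniteColimits Φ.proj := by
  refine ⟨fun J _ _ => ⟨fun {K} => ⟨fun {c} hc => ?_⟩⟩⟩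
  obtain ⟨ι, hι⟩ : ∃ ι : ∀ j, K.obj j ⟶ c.pt, ∀ j, ι j = c.ι.app j := ⟨_, fun _ => rfl⟩
  have hR := restrict_isLeftAdjoint hC
  have hepi : ∀ (U V : C) {Y : C} (g g' : (c.pt ⨯ U) ⨯ V ⟶ Y),
      (∀ j, prod.map (prod.map (ι j) (𝟙 U)) (𝟙 V) ≫ g =
        prod.map (prod.map (ι j) (𝟙 U)) (𝟙 V) ≫ g') → g = g' := by
    intro U V Y g g' h
    refine (isColimitOfPreserves (restrict U ⋙ restrict V) hc).hom_ext fun j => ?_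
    have := h j
    rw [hι] at this
    exact this
  have hdesc : ∀ (U V : C) {Y : C} (ψ : ∀ j, (K.obj j ⨯ U) ⨯ V ⟶ Y)
      (_ : ∀ {i j} (k : i ⟶ j), prod.map (prod.map (K.map k) (𝟙 U)) (𝟙 V) ≫ ψ j = ψ i),
      ∃ d : (c.pt ⨯ U) ⨯ V ⟶ Y, ∀ j, prod.map (prod.map (ι j) (𝟙 U)) (𝟙 V) ≫ d = ψ j := by
    intro U V Y ψ h
    let t : Cocone (K ⋙ restrict U ⋙ restrict V) :=
      { pt := Y
        ι := { app := ψ, naturality := fun i j k => (h k).trans (Category.comp_id _).symm } }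
    refine ⟨(isColimitOfPreserves (restrict U ⋙ restrict V) hc).desc t, fun j => ?_⟩
    rw [hι]
    exact (isColimitOfPreserves (restrict U ⋙ restrict V) hc).fac t j
  have uniq : ∀ {Y : C} (m m' : Φ.proj.obj c.pt ⟶ Φ.proj.obj Y),
      (∀ j, Φ.proj.map (ι j) ≫ m = Φ.proj.map (ι j) ≫ m') → m = m' := by
    intro Y m m' h
    obtain ⟨U, hU, ⟨f, hf⟩, ⟨f', hf'⟩⟩ := (Φ.eventually_mem.and
      ((Φ.eventually_lift m).and (Φ.eventually_lift m'))).exists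
    have := Φ.isIso_proj_map_fst hU c.pt
    rw [← cancel_epi (Φ.proj.map (prod.fst : c.pt ⨯ U ⟶ c.pt)), hf, hf']
    have h₁ : ∀ j, Φ.proj.map (prod.map (ι j) (𝟙 U) ≫ f) =
        Φ.proj.map (prod.map (ι j) (𝟙 U) ≫ f') := by
      intro j
      rw [Functor.map_comp, Functor.map_comp, ← hf, ← hf', ← Functor.map_comp_assoc,
        ← Functor.map_comp_assoc, prod.map_fst, Functor.map_comp, Category.assoc,
        Category.assoc, h j]
    obtain ⟨V, hV, h₂⟩ := (Φ.eventually_mem.and (Filter.eventually_all.2 fun j =>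
      Φ.eventually_fst_comp_eq (h₁ j))).exists
    have := Φ.isIso_proj_map_fst hV (c.pt ⨯ U)
    rw [← cancel_epi (Φ.proj.map (prod.fst : (c.pt ⨯ U) ⨯ V ⟶ c.pt ⨯ U)), ← Functor.map_comp,
      ← Functor.map_comp]
    refine congrArg _ (hepi U V _ _ fun j => ?_)
    rw [prod.map_fst_assoc, prod.map_fst_assoc, h₂ j]
  have exist : ∀ {Y : C} (θ : ∀ j, Φ.proj.obj (K.obj j) ⟶ Φ.proj.obj Y)
      (_ : ∀ {i j} (k : i ⟶ j), Φ.proj.map (K.map k) ≫ θ j = θ i),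
      ∃ m : Φ.proj.obj c.pt ⟶ Φ.proj.obj Y, ∀ j, Φ.proj.map (ι j) ≫ m = θ j := by
    intro Y θ hθ
    obtain ⟨U, V, hU, hV, ψ, h₁, h₂⟩ := Φ.exists_lift_cocone K θ hθ
    have := Φ.isIso_proj_map_fst hU
    have := Φ.isIso_proj_map_fst hV
    obtain ⟨d, hd⟩ := hdesc U V ψ h₁
    refine ⟨inv (Φ.proj.map (prod.fst : c.pt ⨯ U ⟶ _)) ≫
      inv (Φ.proj.map (prod.fst : (c.pt ⨯ U) ⨯ V ⟶ _)) ≫ Φ.proj.map d, fun j => ?_⟩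
    rw [← cancel_epi (Φ.proj.map (prod.fst : K.obj j ⨯ U ⟶ _)),
      ← cancel_epi (Φ.proj.map (prod.fst : (K.obj j ⨯ U) ⨯ V ⟶ _)),
      h₂,
      ← Functor.map_comp_assoc _ prod.fst (ι j), ← prod.map_fst (ι j) (𝟙 U),
      Functor.map_comp, Category.assoc, IsIso.hom_inv_id_assoc, ← Functor.map_comp_assoc,
      ← prod.map_fst _ (𝟙 V), Functor.map_comp, Category.assoc, IsIso.hom_inv_id_assoc,
      ← Functor.map_comp, hd]
  have exist' : ∀ s : Cocone (K ⋙ Φ.proj), ∃ m : Φ.proj.obj c.pt ⟶ s.pt,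
      ∀ j, Φ.proj.map (c.ι.app j) ≫ m = s.ι.app j := by
    intro s
    obtain ⟨m, hm⟩ := exist (Y := s.pt.as) (fun j => s.ι.app j) (fun k => s.w k)
    refine ⟨m, fun j => ?_⟩
    rw [← hι]
    exact hm j
  exact ⟨{ desc := fun s => (exist' s).choose
           fac := fun s => (exist' s).choose_spec
           uniq := fun s m hm => uniq (Y := s.pt.as) _ _ fun j => by
            rw [hι]
            exact (hm j).trans ((exist' s).choose_spec j).symm }⟩

/-- Up to isomorphism every span of the quotient is the image of a span of `C`, whose pushout is
preserved. -/
lemma hasFiniteColimits [HasFiniteColimits C] : HasFiniteColimits (FilterQuotient Φ) := by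
  have := Φ.preservesFiniteColimits_proj hC
  have : HasInitial (FilterQuotient Φ) :=
    (IsInitial.isInitialObj Φ.proj _ initialIsInitial).hasInitial
  have : ∀ {X Y Z : FilterQuotient Φ} (f : Z ⟶ X) (g : Z ⟶ Y), HasPushout f g := by
    intro X Y Z f g
    obtain ⟨U, hU, ⟨f', hf⟩, ⟨g', hg⟩⟩ := (Φ.eventually_mem.and
      ((Φ.eventually_lift (X := Z.as) (Y := X.as) f).and
        (Φ.eventually_lift (X := Z.as) (Y := Y.as) g))).exists
    have := Φ.isIso_proj_map_fst hU Z.as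
    let e : Φ.proj.obj (Z.as ⨯ U) ≅ Φ.proj.obj Z.as := asIso (Φ.proj.map prod.fst)
    exact (((IsPushout.of_hasPushout f' g').map Φ.proj).of_iso e (Iso.refl _) (Iso.refl _)
      (Iso.refl _) ((Category.comp_id _).trans hf.symm) ((Category.comp_id _).trans hg.symm)
      (by simp; rfl) (by simp; rfl)).hasPushout
  have : HasPushouts (FilterQuotient Φ) := hasPushouts_of_hasColimit_span _
  exact hasFiniteColimits_of_hasInitial_and_pushouts

end

end SubterminalFilter

/-! ### Classes of morphisms of the filter quotient and the model structure -/

namespace SubterminalFilter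

section

variable {C : Type u} [Category.{v} C] [HasFiniteProducts C] (Φ : SubterminalFilter C)

/-- A class of morphisms that respects isomorphisms and is stable under products with members of `Φ`. -/
structure IsStable (S : MorphismProperty C) : Prop where
  respectsIso : S.RespectsIso
  restrict : ∀ {X Y : C} (f : X ⟶ Y) {U : C}, Φ.mem U → S f → S (prod.map f (𝟙 U))

variable {Φ} {S : MorphismProperty C}

lemma IsStable.eventually_iff (hS : Φ.IsStable S) {f g : Arrow C} (σ : f ⟶ g)
    (hσ : IsIso (Φ.proj.mapArrow.map σ)) :
    ∀ᶠ V in Φ.levels, S (prod.map f.hom (𝟙 V)) ↔ S (prod.map g.hom (𝟙 V)) := by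
  have h₁ : IsIso (Φ.proj.map σ.left) :=
    inferInstanceAs (IsIso (Φ.proj.mapArrow.map σ).left)
  have h₂ : IsIso (Φ.proj.map σ.right) :=
    inferInstanceAs (IsIso (Φ.proj.mapArrow.map σ).right)
  have := hS.respectsIso
  refine ((Φ.eventually_isIso _ h₁).and (Φ.eventually_isIso _ h₂)).mono fun V ⟨i₁, i₂⟩ => ?_
  refine S.arrow_mk_iso_iff (Arrow.isoMk (asIso (prod.map σ.left (𝟙 V)))
    (asIso (prod.map σ.right (𝟙 V))) ?_)
  change prod.map σ.left (𝟙 V) ≫ prod.map g.hom (𝟙 V) = prod.map f.hom (𝟙 V) ≫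
    prod.map σ.right (𝟙 V)
  ext
  · simp
  · simp

/-- An isomorphism of images is a roof in `C` both of whose legs become invertible, and each leg
preserves membership in `S` at small levels. -/
lemma IsStable.eventually_of_iso (hS : Φ.IsStable S) {f g : Arrow C}
    (e : Φ.proj.mapArrow.obj f ≅ Φ.proj.mapArrow.obj g) (hf : S f.hom) :
    ∀ᶠ V in Φ.levels, S (prod.map g.hom (𝟙 V)) := by
  obtain ⟨g', ρ, σ, hρ, hσ⟩ := Φ.mapArrow_isRightFractions.lift e.inv
  have hσ' : IsIso (Φ.proj.mapArrow.map σ) := by rw [← hσ]; infer_instance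
  exact ((Φ.eventually_mem.and ((hS.eventually_iff ρ hρ).and (hS.eventually_iff σ hσ')))).mono
    fun V ⟨hV, h₁, h₂⟩ => h₁.1 (h₂.2 (hS.restrict _ hV hf))

/-- The definition of `descend` asks for a representative of `m` itself. For any representative `p`,
the arrow `(p, snd)` over the level of `p` has image isomorphic to `m`, hence to that of `f`. So its
restriction to a small `V` is in `S`, and that restriction is isomorphic to the arrow given by `p`
at level `V`. -/
lemma IsStable.descend_of_iso (hS : Φ.IsStable S) {f : Arrow C} {m : Arrow (FilterQuotient Φ)}
    (e : Φ.proj.mapArrow.obj f ≅ m) (hf : S f.hom) : Φ.descend S m.hom := by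
  obtain ⟨p, hp⟩ := Φ.homMk_surjective (X := m.left.as) (Y := m.right.as) m.hom
  let g := prod.lift p.hom prod.snd
  have i₁ := Φ.isIso_proj_map_fst p.mem m.left.as
  have i₂ := Φ.isIso_proj_map_fst p.mem m.right.as
  let e₁ : Φ.proj.obj (m.left.as ⨯ p.level) ≅ m.left := @asIso _ _ _ _ _ i₁
  let e₂ : Φ.proj.obj (m.right.as ⨯ p.level) ≅ m.right := @asIso _ _ _ _ _ i₂
  have w : e₁.hom ≫ m.hom = Φ.proj.map g ≫ e₂.hom := by
    rw [← hp]
    refine (Φ.fst_comp_homMk p).trans ?_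
    refine Eq.trans ?_ (Φ.proj.map_comp g prod.fst)
    rw [prod.lift_fst]
  let e' : Φ.proj.mapArrow.obj (Arrow.mk g) ≅ m := Arrow.isoMk e₁ e₂ w
  obtain ⟨V, hV, ⟨a⟩, hg⟩ := (Φ.eventually_mem.and ((Φ.eventually_nonempty_hom p.mem).and
    (hS.eventually_of_iso (e ≪≫ e'.symm) hf))).exists
  have := hS.respectsIso
  refine ⟨⟨V, hV, prod.map (𝟙 _) a ≫ p.hom⟩, ?_, ?_⟩
  · refine Eq.trans ((Φ.homMk_eq_iff _ _).2 ⟨V, hV, 𝟙 _, a, ?_⟩) hp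
    rw [prod.map_id_id, Category.id_comp]
  · refine (S.arrow_mk_iso_iff (Arrow.isoMk
      ((restrictRestrictIso (Φ.isSubterminal p.mem) a).app m.left.as)
      ((restrictRestrictIso (Φ.isSubterminal p.mem) a).app m.right.as) ?_)).1 hg
    change prod.map prod.fst (𝟙 V) ≫ prod.lift (prod.map (𝟙 _) a ≫ p.hom) prod.snd =
      prod.map (prod.lift p.hom prod.snd) (𝟙 V) ≫ prod.map prod.fst (𝟙 V)
    have : prod.map prod.fst a = (prod.fst : (m.left.as ⨯ p.level) ⨯ V ⟶ _) := by
      ext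
      · simp
      · exact Φ.isSubterminal p.mem _ _
    ext
    · simp [reassoc_of% this]
    · simp

lemma IsStable.descend_proj_map (hS : Φ.IsStable S) {X Y : C} {f : X ⟶ Y} (hf : S f) :
    Φ.descend S (Φ.proj.map f) :=
  hS.descend_of_iso (f := Arrow.mk f) (m := Arrow.mk (Φ.proj.map f)) (Iso.refl _) hf

lemma exists_iso_of_descend {m : Arrow (FilterQuotient Φ)} (h : Φ.descend S m.hom) :
    ∃ f : Arrow C, S f.hom ∧ Nonempty (Φ.proj.mapArrow.obj f ≅ m) := by
  obtain ⟨p, hp, h⟩ := h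
  have i₁ := Φ.isIso_proj_map_fst p.mem m.left.as
  have i₂ := Φ.isIso_proj_map_fst p.mem m.right.as
  let e₁ : Φ.proj.obj (m.left.as ⨯ p.level) ≅ m.left := @asIso _ _ _ _ _ i₁
  let e₂ : Φ.proj.obj (m.right.as ⨯ p.level) ≅ m.right := @asIso _ _ _ _ _ i₂
  have h₀ : prod.lift p.hom prod.snd ≫ prod.fst = p.hom := prod.lift_fst _ _
  refine ⟨Arrow.mk _, h, ⟨Arrow.isoMk e₁ e₂ ?_⟩⟩
  rw [← hp]
  exact (Φ.fst_comp_homMk p).trans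
    ((congrArg Φ.proj.map h₀.symm).trans (Φ.proj.map_comp _ prod.fst))

lemma IsStable.eventually_of_descend (hS : Φ.IsStable S) {f : Arrow C}
    (h : Φ.descend S (Φ.proj.map f.hom)) : ∀ᶠ V in Φ.levels, S (prod.map f.hom (𝟙 V)) := by
  obtain ⟨g, hg, ⟨e⟩⟩ := exists_iso_of_descend (m := Arrow.mk (Φ.proj.map f.hom)) h
  exact hS.eventually_of_iso e hg

lemma IsStable.descend_iff_of_iso (hS : Φ.IsStable S) {m n : Arrow (FilterQuotient Φ)} (e : m ≅ n) :
    Φ.descend S m.hom ↔ Φ.descend S n.hom := by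
  refine ⟨fun h => ?_, fun h => ?_⟩
  · obtain ⟨f, hf, ⟨i⟩⟩ := exists_iso_of_descend h
    exact hS.descend_of_iso (i ≪≫ e) hf
  · obtain ⟨f, hf, ⟨i⟩⟩ := exists_iso_of_descend h
    exact hS.descend_of_iso (i ≪≫ e.symm) hf

lemma IsStable.respectsIso_descend (hS : Φ.IsStable S) : (Φ.descend S).RespectsIso :=
  MorphismProperty.RespectsIso.of_respects_arrow_iso _ fun _ _ e => (hS.descend_iff_of_iso e).1

/-- Membership in `S_Φ` can be tested on any presenting arrow and at all small levels, not just on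
one favourable representative. This turns closure properties of `S_Φ` into pointwise statements
about `S`. -/
lemma IsStable.descend_iff (hS : Φ.IsStable S) {f : Arrow C} {m : Arrow (FilterQuotient Φ)}
    (e : Φ.proj.mapArrow.obj f ≅ m) :
    Φ.descend S m.hom ↔ ∀ᶠ V in Φ.levels, S (prod.map f.hom (𝟙 V)) := by
  refine ⟨fun h => hS.eventually_of_descend ((hS.descend_iff_of_iso e).2 h), fun h => ?_⟩
  obtain ⟨V, hV, h⟩ := (Φ.eventually_mem.and h).exists
  have := Φ.isIso_map_restrictArrowHom f.hom hV
  exact hS.descend_of_iso (f := Arrow.mk (prod.map f.hom (𝟙 V)))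
    (asIso (Φ.proj.mapArrow.map (restrictArrowHom f.hom V)) ≪≫ e) h

lemma IsStable.inf {T : MorphismProperty C} (hS : Φ.IsStable S) (hT : Φ.IsStable T) :
    Φ.IsStable (S ⊓ T) where
  respectsIso := by
    have := hS.respectsIso
    have := hT.respectsIso
    infer_instance
  restrict f _ hU h := ⟨hS.restrict f hU h.1, hT.restrict f hU h.2⟩

lemma IsStable.descend_inf {T : MorphismProperty C} (hS : Φ.IsStable S) (hT : Φ.IsStable T) :
    Φ.descend (S ⊓ T) = Φ.descend S ⊓ Φ.descend T := by
  ext X Y m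
  obtain ⟨f, ⟨e⟩⟩ := Φ.mapArrow_isRightFractions.surj (Arrow.mk m)
  exact ((hS.inf hT).descend_iff e).trans ((Filter.eventually_and).trans
    (and_congr (hS.descend_iff e).symm (hT.descend_iff e).symm))

/-- The section and the retraction lift to `σ` and `τ`, but `σ ≫ τ` is only a morphism that becomes
invertible. At small levels it is invertible, and correcting `τ` by its inverse gives a genuine
retract in `C`. -/
lemma IsStable.isStableUnderRetracts_descend (hS : Φ.IsStable S) [S.IsStableUnderRetracts] :
    (Φ.descend S).IsStableUnderRetracts where
  of_retract {X Y Z W m n} h hn := by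
    obtain ⟨g, hg, ⟨e⟩⟩ := exists_iso_of_descend (m := Arrow.mk n) hn
    obtain ⟨f, ⟨e'⟩⟩ := Φ.mapArrow_isRightFractions.surj (Arrow.mk m)
    obtain ⟨g₁, i, τ, hτ⟩ := Φ.mapArrow_isRightFractions.exists_iso_map (h.r ≫ e'.inv)
    obtain ⟨f₁, ρ, σ, hρ, hσ⟩ := Φ.mapArrow_isRightFractions.lift (e'.hom ≫ h.i ≫ i.inv)
    have hστ : Φ.proj.mapArrow.map (σ ≫ τ) = Φ.proj.mapArrow.map ρ := by
      rw [Functor.map_comp, ← hσ, ← hτ, Category.assoc, Category.assoc, Category.assoc,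
        Iso.inv_hom_id_assoc, reassoc_of% h.retract, Iso.hom_inv_id, Category.comp_id]
    have hiso : IsIso (Φ.proj.mapArrow.map (σ ≫ τ)) := by rw [hστ]; exact hρ
    have h₁ : IsIso (Φ.proj.map (σ.left ≫ τ.left)) :=
      inferInstanceAs (IsIso (Φ.proj.mapArrow.map (σ ≫ τ)).left)
    have h₂ : IsIso (Φ.proj.map (σ.right ≫ τ.right)) :=
      inferInstanceAs (IsIso (Φ.proj.mapArrow.map (σ ≫ τ)).right)
    refine (hS.descend_iff e').2 (((hS.eventually_of_iso (e ≪≫ i.symm) hg).and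
      ((hS.eventually_iff _ hiso).and
      ((Φ.eventually_isIso _ h₁).and (Φ.eventually_isIso _ h₂)))).mono
      fun V ⟨hgV, hfV, i₁, i₂⟩ => hfV.1 ?_)
    have w₁ : prod.map σ.left (𝟙 V) ≫ prod.map g₁.hom (𝟙 V) =
        prod.map f₁.hom (𝟙 V) ≫ prod.map σ.right (𝟙 V) := by ext <;> simp
    have w₂ : prod.map τ.left (𝟙 V) ≫ prod.map f.hom (𝟙 V) =
        prod.map g₁.hom (𝟙 V) ≫ prod.map τ.right (𝟙 V) := by ext <;> simp
    have c₁ : prod.map σ.left (𝟙 V) ≫ prod.map τ.left (𝟙 V) =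
        prod.map (σ.left ≫ τ.left) (𝟙 V) := by simp
    have c₂ : prod.map σ.right (𝟙 V) ≫ prod.map τ.right (𝟙 V) =
        prod.map (σ.right ≫ τ.right) (𝟙 V) := by simp
    have w₃ : prod.map f₁.hom (𝟙 V) ≫ prod.map (σ.right ≫ τ.right) (𝟙 V) =
        prod.map (σ.left ≫ τ.left) (𝟙 V) ≫ prod.map f.hom (𝟙 V) := by
      rw [← c₁, ← c₂, Category.assoc, w₂, ← Category.assoc, ← w₁, Category.assoc]
    refine MorphismProperty.of_retract (P := S) (f := prod.map f₁.hom (𝟙 V))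
      (g := prod.map g₁.hom (𝟙 V))
      { i := Arrow.homMk (prod.map σ.left (𝟙 V)) (prod.map σ.right (𝟙 V)) w₁
        r := Arrow.homMk (prod.map τ.left (𝟙 V) ≫ inv (prod.map (σ.left ≫ τ.left) (𝟙 V)))
          (prod.map τ.right (𝟙 V) ≫ inv (prod.map (σ.right ≫ τ.right) (𝟙 V))) ?_
        retract := Arrow.hom_ext _ _ ?_ ?_ } hgV
    · change (prod.map τ.left (𝟙 V) ≫ inv _) ≫ prod.map f₁.hom (𝟙 V) =
        prod.map g₁.hom (𝟙 V) ≫ prod.map τ.right (𝟙 V) ≫ inv _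
      rw [← Category.assoc (prod.map g₁.hom (𝟙 V)), ← w₂, Category.assoc, Category.assoc]
      congr 1
      rw [IsIso.inv_comp_eq, ← Category.assoc, IsIso.eq_comp_inv, w₃]
    · change prod.map σ.left (𝟙 V) ≫ prod.map τ.left (𝟙 V) ≫ inv _ = 𝟙 _
      rw [reassoc_of% c₁, IsIso.hom_inv_id]
    · change prod.map σ.right (𝟙 V) ≫ prod.map τ.right (𝟙 V) ≫ inv _ = 𝟙 _
      rw [reassoc_of% c₂, IsIso.hom_inv_id]

/-- A composable pair lifts to a composable pair of `C` (`key`), and a level small enough for the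
two known members suffices for the third. -/
lemma IsStable.hasTwoOutOfThreeProperty_descend (hS : Φ.IsStable S) [S.HasTwoOutOfThreeProperty] :
    (Φ.descend S).HasTwoOutOfThreeProperty := by
  have key : ∀ {X Y Z : FilterQuotient Φ} (f : X ⟶ Y) (g : Y ⟶ Z),
      ∃ (X' Y' Z' : C) (f' : X' ⟶ Y') (g' : Y' ⟶ Z'),
        Nonempty (Φ.proj.mapArrow.obj (Arrow.mk f') ≅ Arrow.mk f) ∧
        Nonempty (Φ.proj.mapArrow.obj (Arrow.mk g') ≅ Arrow.mk g) ∧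
        Nonempty (Φ.proj.mapArrow.obj (Arrow.mk (f' ≫ g')) ≅ Arrow.mk (f ≫ g)) := by
    intro X Y Z f g
    obtain ⟨Y', e, g', hg⟩ := Φ.proj_isRightFractions.exists_iso_map (X := Z.as) g
    obtain ⟨X', i, f', hf⟩ := Φ.proj_isRightFractions.exists_iso_map (f ≫ e.inv)
    let j : Φ.proj.obj Z.as ≅ Z := Iso.refl _
    have hg' : e.hom ≫ g = Φ.proj.map g' ≫ j.hom := hg.trans (Category.comp_id _).symm
    have hf' : i.hom ≫ f = Φ.proj.map f' ≫ e.hom := by rw [← hf]; simp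
    refine ⟨X', Y', Z.as, f', g', ⟨Arrow.isoMk i e hf'⟩, ⟨Arrow.isoMk e j hg'⟩,
      ⟨Arrow.isoMk i j ?_⟩⟩
    change i.hom ≫ f ≫ g = Φ.proj.map (f' ≫ g') ≫ j.hom
    rw [reassoc_of% hf', hg', Functor.map_comp, Category.assoc]
  have hmap : ∀ {X Y Z : C} (f : X ⟶ Y) (g : Y ⟶ Z) (V : C),
      prod.map (f ≫ g) (𝟙 V) = prod.map f (𝟙 V) ≫ prod.map g (𝟙 V) := by
    intros; simp
  refine { comp_mem := fun f g hf hg => ?_, of_postcomp := fun f g hg hfg => ?_,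
           of_precomp := fun f g hf hfg => ?_ }
  all_goals
    obtain ⟨X', Y', Z', f', g', ⟨e₁⟩, ⟨e₂⟩, ⟨e₃⟩⟩ := key f g
  · refine (hS.descend_iff e₃).2 ((((hS.descend_iff e₁).1 hf).and
      ((hS.descend_iff e₂).1 hg)).mono fun V ⟨h₁, h₂⟩ => ?_)
    change S (prod.map (f' ≫ g') (𝟙 V))
    rw [hmap]
    exact S.comp_mem _ _ h₁ h₂
  · refine (hS.descend_iff e₁).2 ((((hS.descend_iff e₂).1 hg).and
      ((hS.descend_iff e₃).1 hfg)).mono fun V ⟨h₁, h₂⟩ => ?_)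
    change S (prod.map (f' ≫ g') (𝟙 V)) at h₂
    rw [hmap] at h₂
    exact S.of_postcomp _ _ h₁ h₂
  · refine (hS.descend_iff e₂).2 ((((hS.descend_iff e₁).1 hf).and
      ((hS.descend_iff e₃).1 hfg)).mono fun V ⟨h₁, h₂⟩ => ?_)
    change S (prod.map (f' ≫ g') (𝟙 V)) at h₂
    rw [hmap] at h₂
    exact S.of_precomp _ _ h₁ h₂

lemma IsStable.hasFactorization_descend {T : MorphismProperty C} (hS : Φ.IsStable S)
    (hT : Φ.IsStable T) [S.HasFactorization T] :
    (Φ.descend S).HasFactorization (Φ.descend T) where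
  nonempty_mapFactorizationData {X Y} m := by
    obtain ⟨f, ⟨e⟩⟩ := Φ.mapArrow_isRightFractions.surj (Arrow.mk m)
    have d := S.factorizationData T f.hom
    let e₁ : Φ.proj.obj f.left ≅ X := Arrow.leftFunc.mapIso e
    let e₂ : Φ.proj.obj f.right ≅ Y := Arrow.rightFunc.mapIso e
    have w : e₁.hom ≫ m = Φ.proj.map f.hom ≫ e₂.hom := Arrow.w e.hom
    have := hS.respectsIso_descend
    have := hT.respectsIso_descend
    exact ⟨{
      Z := Φ.proj.obj d.Z
      i := e₁.inv ≫ Φ.proj.map d.i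
      p := Φ.proj.map d.p ≫ e₂.hom
      fac := by
        rw [Category.assoc, ← Functor.map_comp_assoc, d.fac, ← w, Iso.inv_hom_id_assoc]
      hi := (MorphismProperty.cancel_left_of_respectsIso _ _ _).2 (hS.descend_proj_map d.hi)
      hp := (MorphismProperty.cancel_right_of_respectsIso _ _ _).2 (hT.descend_proj_map d.hp) }⟩

/-- A lifting problem in the quotient comes from one in `C`, whose left side is in `S` after
restriction because it becomes isomorphic to `i₀`. The right side `p₀` need not be restricted. -/
lemma IsStable.hasLiftingProperty_descend {T : MorphismProperty C} (hS : Φ.IsStable S)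
    (h : ∀ {A B X Y : C} (i : A ⟶ B) (p : X ⟶ Y), S i → T p → HasLiftingProperty i p)
    {A B X Y : FilterQuotient Φ} (i : A ⟶ B) (p : X ⟶ Y) (hi : Φ.descend S i)
    (hp : Φ.descend T p) : HasLiftingProperty i p := by
  obtain ⟨i₀, hi₀, ⟨e⟩⟩ := exists_iso_of_descend (m := Arrow.mk i) hi
  obtain ⟨p₀, hp₀, ⟨e'⟩⟩ := exists_iso_of_descend (m := Arrow.mk p) hp
  have : HasLiftingProperty (Φ.proj.map i₀.hom) (Φ.proj.map p₀.hom) := by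
    refine ⟨fun {a b} sq => ?_⟩
    obtain ⟨A', B', i', ρ₁, ρ₂, a', b', e₁, e₂, j₁, j₂, h₁, h₂⟩ :=
      Φ.exists_lift_square a b sq.w
    have hρ : IsIso (Φ.proj.mapArrow.map (Arrow.homMk ρ₁ ρ₂ e₁.symm : Arrow.mk i' ⟶ i₀)) := by
      have : IsIso (Φ.proj.mapArrow.map (Arrow.homMk ρ₁ ρ₂ e₁.symm : Arrow.mk i' ⟶ i₀)).left := j₁
      have : IsIso (Φ.proj.mapArrow.map (Arrow.homMk ρ₁ ρ₂ e₁.symm : Arrow.mk i' ⟶ i₀)).right :=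
        j₂
      exact Arrow.isIso_of_isIso_left_of_isIso_right _
    obtain ⟨V, hV, hi'⟩ := (Φ.eventually_mem.and (hS.eventually_iff _ hρ)).exists
    have hlp : HasLiftingProperty (prod.map i' (𝟙 V)) p₀.hom := h _ p₀.hom (hi'.2 (hS.restrict _ hV hi₀)) hp₀
    have sq' : CommSq (prod.fst ≫ a') (prod.map i' (𝟙 V)) p₀.hom (prod.fst ≫ b') :=
      ⟨by rw [Category.assoc, e₂, prod.map_fst_assoc]⟩
    have k₁ := Φ.isIso_proj_map_fst hV A'
    have k₂ := Φ.isIso_proj_map_fst hV B'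
    have l₁ : prod.map i' (𝟙 V) ≫ sq'.lift = prod.fst ≫ a' := sq'.fac_left
    have l₂ : sq'.lift ≫ p₀.hom = prod.fst ≫ b' := sq'.fac_right
    refine ⟨⟨⟨inv (Φ.proj.map ρ₂) ≫ inv (Φ.proj.map (prod.fst : B' ⨯ V ⟶ B')) ≫
      Φ.proj.map sq'.lift, ?_, ?_⟩⟩⟩
    · have e₁' : Φ.proj.map ρ₁ ≫ Φ.proj.map i₀.hom = Φ.proj.map i' ≫ Φ.proj.map ρ₂ := by
        rw [← Functor.map_comp, ← Functor.map_comp, e₁]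
      have e₃ : Φ.proj.map (prod.fst : A' ⨯ V ⟶ A') ≫ Φ.proj.map i' =
          Φ.proj.map (prod.map i' (𝟙 V)) ≫ Φ.proj.map prod.fst := by
        rw [← Functor.map_comp, ← Functor.map_comp, prod.map_fst]
      rw [← cancel_epi (Φ.proj.map ρ₁), ← cancel_epi (Φ.proj.map (prod.fst : A' ⨯ V ⟶ A')),
        reassoc_of% e₁', IsIso.hom_inv_id_assoc, reassoc_of% e₃, IsIso.hom_inv_id_assoc,
        ← Functor.map_comp, l₁, h₁, Functor.map_comp]
    · rw [Category.assoc, Category.assoc, ← Functor.map_comp, l₂, Functor.map_comp,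
        IsIso.inv_hom_id_assoc, ← h₂, IsIso.inv_hom_id_assoc]
  have := HasLiftingProperty.of_arrow_iso_left (i' := i) e (Φ.proj.map p₀.hom)
  exact HasLiftingProperty.of_arrow_iso_right i (p' := p) e'

end

/-! ### The model structure -/

section

variable {C : Type u} [Category.{v} C] [ModelCategory C] {Φ : SubterminalFilter C}

noncomputable scoped instance : CategoryWithFibrations (FilterQuotient Φ) := ⟨Φ.descend (fibrations C)⟩

noncomputable scoped instance : CategoryWithCofibrations (FilterQuotient Φ) := ⟨Φ.descend (cofibrations C)⟩

noncomputable scoped instance : CategoryWithWeakEquivalences (FilterQuotient Φ) :=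
  ⟨Φ.descend (weakEquivalences C)⟩

variable (Φ) in
lemma isStable_fibrations : Φ.IsStable (fibrations C) where
  respectsIso := inferInstance
  restrict f U _ hf := MorphismProperty.of_isPullback (isPullback_prod_fst f U) hf

variable (hΦ : Φ.IsModelFilter)
include hΦ

lemma IsModelFilter.isStable_cofibrations : Φ.IsStable (cofibrations C) where
  respectsIso := inferInstance
  restrict f _ hU hf := (hΦ.cofibration f hU ⟨hf⟩).mem

lemma IsModelFilter.isStable_weakEquivalences : Φ.IsStable (weakEquivalences C) where
  respectsIso := inferInstance
  restrict f _ hU hf := (hΦ.weakEquivalence f hU ⟨hf⟩).mem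

/-- The model structure on the filter quotient. -/
@[reducible]
noncomputable def IsModelFilter.modelCategory (hC : IsLocallyCartesianClosed C) :
    ModelCategory (FilterQuotient Φ) := by
  have hF := Φ.isStable_fibrations
  have hCof := hΦ.isStable_cofibrations
  have hW := hΦ.isStable_weakEquivalences
  have hTC : Φ.IsStable (trivialCofibrations C) := hCof.inf hW
  have hTF : Φ.IsStable (trivialFibrations C) := hF.inf hW
  -- Once the trivial classes are seen to be descended too, each weak factorization system follows
  -- from the transfer of retracts, factorizations and lifts.
  have eTC : trivialCofibrations (FilterQuotient Φ) = Φ.descend (trivialCofibrations C) :=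
    (hCof.descend_inf hW).symm
  have eTF : trivialFibrations (FilterQuotient Φ) = Φ.descend (trivialFibrations C) :=
    (hF.descend_inf hW).symm
  have := Φ.hasFiniteColimits hC
  have : (weakEquivalences (FilterQuotient Φ)).HasTwoOutOfThreeProperty :=
    hW.hasTwoOutOfThreeProperty_descend
  have : MorphismProperty.IsWeakFactorizationSystem (cofibrations (FilterQuotient Φ))
      (trivialFibrations (FilterQuotient Φ)) := by
    rw [eTF]
    have : (Φ.descend (trivialFibrations C)).IsStableUnderRetracts :=
      hTF.isStableUnderRetracts_descend
    have : (cofibrations (FilterQuotient Φ)).IsStableUnderRetracts :=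
      hCof.isStableUnderRetracts_descend
    have : (cofibrations (FilterQuotient Φ)).HasFactorization (Φ.descend (trivialFibrations C)) :=
      hCof.hasFactorization_descend hTF
    exact MorphismProperty.IsWeakFactorizationSystem.mk' _ _
      (hCof.hasLiftingProperty_descend fun i p hi hp =>
        MorphismProperty.hasLiftingProperty_of_wfs i p hi hp)
  have : MorphismProperty.IsWeakFactorizationSystem (trivialCofibrations (FilterQuotient Φ))
      (fibrations (FilterQuotient Φ)) := by
    rw [eTC]
    have : (Φ.descend (trivialCofibrations C)).IsStableUnderRetracts :=
      hTC.isStableUnderRetracts_descend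
    have : (fibrations (FilterQuotient Φ)).IsStableUnderRetracts :=
      hF.isStableUnderRetracts_descend
    have : (Φ.descend (trivialCofibrations C)).HasFactorization (fibrations (FilterQuotient Φ)) :=
      hTC.hasFactorization_descend hF
    exact MorphismProperty.IsWeakFactorizationSystem.mk' _ _
      (hTC.hasLiftingProperty_descend fun i p hi hp =>
        MorphismProperty.hasLiftingProperty_of_wfs i p hi hp)
  exact ModelCategory.mk' _

end

end SubterminalFilter

/-! ### Reformulations of the properties of notions of fibred structure -/

namespace FibredStructure

variable {C : Type u} [Category.{v} C] {F : FibredStructure.{w} C}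

namespace Total

@[simp]
lemma comp_val {a b c : F.Total} (m : a ⟶ b) (n : b ⟶ c) : (m ≫ n).1 = m.1 ≫ n.1 := rfl

@[simp]
lemma id_val (a : F.Total) : (𝟙 a : a ⟶ a).1 = 𝟙 a.arrow := rfl

lemma hom_ext {a b : F.Total} {m n : a ⟶ b} (h : m.1 = n.1) : m = n := Subtype.ext h

/-- The restriction of a structure along a pullback square. -/
def pull (b : F.Total) {f : CartArrow C} (k : f ⟶ b.arrow) : F.Total := ⟨f, F.map k.op b.str⟩

def pullHom (b : F.Total) {f : CartArrow C} (k : f ⟶ b.arrow) : b.pull k ⟶ b := ⟨k, rfl⟩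

/-- An isomorphism of arrows that preserves the structures. -/
def isoMk {a b : F.Total} (e : a.arrow ≅ b.arrow) (h : F.map e.hom.op b.str = a.str) : a ≅ b where
  hom := ⟨e.hom, h⟩
  inv := ⟨e.inv, by rw [← h, ← Functor.map_comp_apply, ← op_comp]; simp⟩
  hom_inv_id := hom_ext e.hom_inv_id
  inv_hom_id := hom_ext e.inv_hom_id

lemma hom_ext_of_comp {a b c : F.Total} {m n : a ⟶ b} (k : b ⟶ c) (e : m ≫ k = n ≫ k)
    (h : m.1.right = n.1.right) : m = n :=
  hom_ext (CartArrow.hom_ext_of_comp k.1 (congrArg Subtype.val e) h)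

lemma exists_lift {a b c : F.Total} (m : a ⟶ c) (k : b ⟶ c) (x : a.arrow.right ⟶ b.arrow.right)
    (e : x ≫ k.1.right = m.1.right) : ∃ n : a ⟶ b, n.1.right = x ∧ n ≫ k = m := by
  obtain ⟨n, h₁, h₂⟩ := CartArrow.exists_lift m.1 k.1 x e
  refine ⟨⟨n, ?_⟩, h₁, hom_ext h₂⟩
  rw [← k.2, ← Functor.map_comp_apply, ← op_comp, h₂, m.2]

lemma exists_iso {a b c : F.Total} (m : a ⟶ c) (k : b ⟶ c) (x : a.arrow.right ≅ b.arrow.right)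
    (e : x.hom ≫ k.1.right = m.1.right) :
    ∃ n : a ≅ b, n.hom.1.right = x.hom ∧ n.inv.1.right = x.inv ∧ n.hom ≫ k = m ∧
      n.inv ≫ m = k := by
  obtain ⟨n, h₁, h₂⟩ := exists_lift m k x.hom e
  obtain ⟨n', h₁', h₂'⟩ := exists_lift k m x.inv (by rw [← e, Iso.inv_hom_id_assoc])
  refine ⟨⟨n, n', hom_ext_of_comp m ?_ ?_, hom_ext_of_comp k ?_ ?_⟩, h₁, h₁', h₂, h₂'⟩
  · rw [Category.assoc, h₂', h₂, Category.id_comp]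
  · simp [h₁, h₁']; rfl
  · rw [Category.assoc, h₂, h₂', Category.id_comp]
  · simp [h₁, h₁']; rfl

end Total

/-- By the Yoneda lemma a representing object over `f` is a universal structured arrow over `f`.
This form involves only morphisms and equations, so fractions apply to it. -/
lemma isRepresentable_iff (f : CartArrow C) :
    ((Over.forget f).op ⋙ F).IsRepresentable ↔
      ∃ (a : F.Total) (φ : a.arrow ⟶ f), ∀ (b : F.Total) (ψ : b.arrow ⟶ f),
        ∃! k : b ⟶ a, k.1 ≫ φ = ψ := by
  refine ⟨fun ⟨Y, ⟨R⟩⟩ => ?_, fun ⟨a, φ, h⟩ => ?_⟩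
  · refine ⟨⟨Y.left, R.homEquiv (𝟙 Y)⟩, Y.hom, fun b ψ => ?_⟩
    have hR : ∀ k : Over.mk ψ ⟶ Y, R.homEquiv k = F.map k.left.op (R.homEquiv (𝟙 Y)) := by
      intro k
      conv_lhs => rw [← Category.comp_id k, R.homEquiv_comp]
      rfl
    obtain ⟨k, hk⟩ := (R.homEquiv (X := Over.mk ψ)).surjective b.str
    refine ⟨⟨k.left, ?_⟩, Over.w k, fun k' hk' => ?_⟩
    · rw [← hk, hR]
    · have : R.homEquiv (Over.homMk k'.1 hk' : Over.mk ψ ⟶ Y) = R.homEquiv k := by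
        rw [hk, hR]
        exact k'.2
      exact Total.hom_ext (congrArg (·.left) (R.homEquiv.injective this))
  · let e : ∀ Z : Over f, (Z ⟶ Over.mk φ) → ((Over.forget f).op ⋙ F).obj (op Z) :=
      fun Z k => F.map k.left.op a.str
    have he : ∀ Z, Function.Bijective (e Z) := by
      intro Z
      refine ⟨fun k k' hkk => ?_, fun s => ?_⟩
      · obtain ⟨k₀, -, hk₀⟩ := h ⟨Z.left, F.map k.left.op a.str⟩ Z.hom
        have h₁ := hk₀ ⟨k.left, rfl⟩ (Over.w k)
        have h₂ := hk₀ ⟨k'.left, hkk.symm⟩ (Over.w k')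
        exact Over.OverMorphism.ext (congrArg Subtype.val (h₁.trans h₂.symm))
      · obtain ⟨k₀, hk₀, -⟩ := h ⟨Z.left, s⟩ Z.hom
        exact ⟨Over.homMk k₀.1 hk₀, k₀.2⟩
    exact ⟨Over.mk φ, ⟨⟨Equiv.ofBijective _ (he _), fun {X X'} k g => by
      change F.map (k ≫ g).left.op a.str = F.map k.left.op (F.map g.left.op a.str)
      rw [← Functor.map_comp_apply, ← op_comp]
      rfl⟩⟩⟩

/-- Since `F` is a discrete fibration, the extended structure can be transported along the
isomorphism in the lifting property. It then lives on `y` itself. -/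
lemma isAcyclicFibration_fibrations_iff [CategoryWithFibrations C] [CategoryWithCofibrations C]
    (h : ∀ a : F.Total, fibrationArrows C (F.toArrow.obj a)) :
    IsAcyclicFibration ((fibrationArrows C).lift F.toArrow h)
        ((fibrationArrows C).ι ⋙ CartArrow.base C) ↔
      ∀ (a : F.Total) (y : CartArrow C) (m : a.arrow ⟶ y), Fibration y.hom → Cofibration m.right →
        ∃ t : F.obj (op y), F.map m.op t = a.str := by
  refine ⟨fun H a y m hy hm => ?_, fun H a y m hm => ?_⟩
  · let m' : ((fibrationArrows C).lift F.toArrow h).obj a ⟶ ⟨y, hy⟩ := ObjectProperty.homMk m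
    obtain ⟨x', n, φ, ψ, h₁, h₂⟩ : ∃ (x' : F.Total) (n : a ⟶ x') (φ : x'.arrow ⟶ y)
        (ψ : y ⟶ x'.arrow), n.1 ≫ φ = m ∧ φ ≫ ψ = 𝟙 _ := by
      obtain ⟨x', n, e, he⟩ := H m' hm
      exact ⟨x', n, e.hom.hom, e.inv.hom, congrArg (·.hom) he, congrArg (·.hom) e.hom_inv_id⟩
    refine ⟨F.map ψ.op x'.str, ?_⟩
    rw [← Functor.map_comp_apply, ← op_comp, ← h₁, Category.assoc, h₂, Category.comp_id, n.2]
  · obtain ⟨t, ht⟩ := H a y.obj m.hom y.property hm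
    refine ⟨⟨y.obj, t⟩, ⟨m.hom, ht⟩, (fibrationArrows C).isoMk (Iso.refl y.obj), ?_⟩
    exact ObjectProperty.hom_ext _ (Category.comp_id m.hom)

namespace RepresentableMap

/-- The morphism from a value of `T` to its universal value. -/
def toUniversal {u : F.Total} (T : F.RepresentableMap (F.base.obj u))
    (e : T.functor.obj (Over.mk (𝟙 (F.base.obj u))) ⟶ u) (z : Over (F.base.obj u)) :
    T.functor.obj z ⟶ u :=
  T.functor.map (Over.homMk z.hom : z ⟶ Over.mk (𝟙 _)) ≫ e

variable {u : F.Total} (T : F.RepresentableMap (F.base.obj u))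
  (e : T.functor.obj (Over.mk (𝟙 (F.base.obj u))) ⟶ u)

lemma map_toUniversal {z z' : Over (F.base.obj u)} (k : z ⟶ z') :
    T.functor.map k ≫ T.toUniversal e z' = T.toUniversal e z := by
  rw [toUniversal, toUniversal, ← Functor.map_comp_assoc]
  congr 2
  ext
  exact Over.w k

lemma toUniversal_right (he : F.base.map e = T.overIso.hom.app (Over.mk (𝟙 (F.base.obj u))))
    (z : Over (F.base.obj u)) :
    (T.toUniversal e z).1.right = T.overIso.hom.app z ≫ z.hom := by
  change F.base.map (T.toUniversal e z) = _
  rw [toUniversal, Functor.map_comp, he]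
  exact T.overIso.hom.naturality (Over.homMk z.hom : z ⟶ Over.mk (𝟙 _))

end RepresentableMap

section

variable [HasPullbacks C] (u : F.Total)

/-- The value at `z` of the morphism of pseudofunctors that corresponds to `u`. -/
noncomputable def representableObj (z : Over (F.base.obj u)) : F.Total :=
  u.pull (f := ⟨pullback.snd u.arrow.hom z.hom⟩)
    ⟨pullback.fst u.arrow.hom z.hom, z.hom, IsPullback.of_hasPullback _ _⟩

noncomputable def representableπ (z : Over (F.base.obj u)) : representableObj u z ⟶ u :=
  u.pullHom _

lemma exists_representableObj_hom {z z' : Over (F.base.obj u)} (k : z ⟶ z') :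
    ∃ n : representableObj u z ⟶ representableObj u z', n.1.right = k.left ∧
      n ≫ representableπ u z' = representableπ u z :=
  Total.exists_lift (representableπ u z) (representableπ u z') k.left (Over.w k)

/-- The morphism of pseudofunctors that corresponds to `u` by the Yoneda lemma. -/
noncomputable def representableMap : F.RepresentableMap (F.base.obj u) where
  functor :=
    { obj := representableObj u
      map := fun k => (exists_representableObj_hom u k).choose
      map_id := fun z => Total.hom_ext_of_comp (representableπ u z)
        ((exists_representableObj_hom u (𝟙 z)).choose_spec.2.trans (Category.id_comp _).symm)
        (exists_representableObj_hom u (𝟙 z)).choose_spec.1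
      map_comp := fun {z z' z''} k l => Total.hom_ext_of_comp (representableπ u z'') (by
          rw [(exists_representableObj_hom u (k ≫ l)).choose_spec.2, Category.assoc,
            (exists_representableObj_hom u l).choose_spec.2,
            (exists_representableObj_hom u k).choose_spec.2])
        (by
          rw [(exists_representableObj_hom u (k ≫ l)).choose_spec.1]
          exact (congrArg₂ (· ≫ ·) (exists_representableObj_hom u k).choose_spec.1
            (exists_representableObj_hom u l).choose_spec.1).symm) }
  overIso := NatIso.ofComponents (fun z => Iso.refl z.left) (fun {z z'} k => by
    refine (Category.comp_id _).trans (Eq.trans ?_ (Category.id_comp _).symm)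
    exact (exists_representableObj_hom u k).choose_spec.1)

lemma representableMap_classifiedBy : (representableMap u).ClassifiedBy := by
  obtain ⟨n, h₁, -, -, -⟩ := Total.exists_iso
    (representableπ u (Over.mk (𝟙 (F.base.obj u)))) (𝟙 u) (Iso.refl (F.base.obj u))
    (Category.comp_id _)
  exact ⟨n, h₁⟩

/-- The Yoneda form of the definition of a universe. -/
lemma Total.isUniverse_iff [CategoryWithCofibrations C] [(cofibrations C).RespectsIso] :
    u.IsUniverse ↔ ∀ ⦃a y : F.Total⦄ (p : a ⟶ u) (_ : y ⟶ u) (m : a ⟶ y),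
      Cofibration m.1.right → ∃ n : y ⟶ u, m ≫ n = p := by
  refine ⟨fun ⟨T, ⟨e, he⟩, H⟩ a y p q m hm => ?_, fun H => ?_⟩
  -- A structured arrow with a morphism to `u` is determined by the bottom side of that morphism, so
  -- it is a value of `T`. In particular `y` lies in the image of `T` because of `q`.
  · have lift : ∀ {b : F.Total} (r : b ⟶ u), ∃ j : T.functor.obj (Over.mk r.1.right) ≅ b,
        j.hom.1.right = T.overIso.hom.app (Over.mk r.1.right) ∧
        j.hom ≫ r = T.toUniversal e.hom _ ∧ j.inv ≫ T.toUniversal e.hom _ = r := by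
      intro b r
      obtain ⟨j, h₁, -, h₂, h₃⟩ := Total.exists_iso (T.toUniversal e.hom (Over.mk r.1.right)) r
        (T.overIso.app (Over.mk r.1.right)) (T.toUniversal_right e.hom he _).symm
      exact ⟨j, h₁, h₂, h₃⟩
    obtain ⟨j, hj, hj₁, hj₂⟩ := lift p
    obtain ⟨i, -, -, -⟩ := lift q
    let m' : T.functor.toEssImage.obj (Over.mk p.1.right) ⟶ ⟨y, ⟨_, ⟨i⟩⟩⟩ :=
      ObjectProperty.homMk (j.hom ≫ m)
    have hm' : Cofibration ((T.functor.essImage.ι ⋙ F.base).map m') := by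
      rw [cofibration_iff] at hm ⊢
      change cofibrations C (j.hom.1.right ≫ m.1.right)
      rw [hj]
      exact (MorphismProperty.cancel_left_of_respectsIso _
        (T.overIso.hom.app (Over.mk p.1.right)) m.1.right).2 hm
    obtain ⟨x', n, φ, ψ, h₁, h₂⟩ : ∃ (x' : Over (F.base.obj u)) (n : Over.mk p.1.right ⟶ x')
        (φ : T.functor.obj x' ⟶ y) (ψ : y ⟶ T.functor.obj x'),
        T.functor.map n ≫ φ = j.hom ≫ m ∧ φ ≫ ψ = 𝟙 _ := by
      obtain ⟨x', n, k, hk⟩ := H m' hm'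
      exact ⟨x', n, k.hom.hom, k.inv.hom, congrArg (·.hom) hk, congrArg (·.hom) k.hom_inv_id⟩
    refine ⟨ψ ≫ T.toUniversal e.hom x', ?_⟩
    rw [← cancel_epi j.hom, hj₁]
    refine Eq.trans ?_ (T.map_toUniversal e.hom n)
    rw [← Category.assoc, ← h₁]
    exact (Category.assoc _ _ _).trans
      (congrArg (_ ≫ ·) ((reassoc_of% h₂) (T.toUniversal e.hom x')))
  -- Conversely, an object of the image has a morphism to `u`, and the bottom side of the extension
  -- `n` is the required object over the base of `u`.
  · refine ⟨representableMap u, representableMap_classifiedBy u, fun x y m hm => ?_⟩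
    obtain ⟨z, ⟨i⟩⟩ := y.property
    obtain ⟨n, hn⟩ := H (representableπ u x) (i.inv ≫ representableπ u z) m.hom hm
    obtain ⟨j, h₁, -, h₂, h₃⟩ := Total.exists_iso (representableπ u (Over.mk n.1.right)) n
      (Iso.refl y.obj.arrow.right) (Category.id_comp _)
    have hw : m.hom.1.right ≫ n.1.right = x.hom :=
      congrArg (fun k : representableObj u x ⟶ u => k.1.right) hn
    let l : x ⟶ Over.mk n.1.right := Over.homMk m.hom.1.right hw
    refine ⟨Over.mk n.1.right, l, ObjectProperty.isoMk _ j, ObjectProperty.hom_ext _ ?_⟩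
    have hl := (exists_representableObj_hom u l).choose_spec
    refine Total.hom_ext_of_comp n ?_ ?_
    · change ((representableMap u).functor.map l ≫ j.hom) ≫ n = m.hom ≫ n
      exact (Category.assoc _ _ _).trans ((congrArg (_ ≫ ·) h₂).trans (hl.2.trans hn.symm))
    · change ((representableMap u).functor.map l).1.right ≫ j.hom.1.right = m.hom.1.right
      rw [h₁]
      exact (Category.comp_id _).trans hl.1

end

end FibredStructure

/-! ### The induced notion of fibred structure -/

namespace FibredStructure.Total

lemma isIso_of_isIso {C : Type u} [Category.{v} C] {F : FibredStructure.{w} C} {a b : F.Total}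
    (m : a ⟶ b) (h : IsIso m.1) : IsIso m :=
  inferInstanceAs (IsIso (isoMk (asIso m.1) m.2).hom)

lemma isIso_val {C : Type u} [Category.{v} C] {F : FibredStructure.{w} C} {a b : F.Total}
    (m : a ⟶ b) [IsIso m] : IsIso m.1 :=
  inferInstanceAs (IsIso (F.toArrow.map m))

end FibredStructure.Total

namespace SubterminalFilter

open FibredStructure

section

variable {C : Type u} [Category.{v} C] [HasFiniteProducts C] (Φ : SubterminalFilter C)
  (F : FibredStructure.{w} C)

/-- The action of the projection on arrows with structure, as a functor. -/
noncomputable def projTotalFunctor : F.Total ⥤ (Φ.induced F).Total where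
  obj a := Φ.projTotal a
  map {a b} m := ⟨Φ.cartProj.map m.1, by
    refine (Φ.map_inducedMk m.1 b.str).trans ?_
    rw [m.2]
    rfl⟩
  map_id a := Total.hom_ext (Φ.cartProj.map_id _)
  map_comp m n := Total.hom_ext (Φ.cartProj.map_comp _ _)

variable {F}

lemma isIso_projTotalFunctor_map {a b : F.Total} (m : a ⟶ b) (h : IsIso (Φ.cartProj.map m.1)) :
    IsIso ((Φ.projTotalFunctor F).map m) :=
  Total.isIso_of_isIso _ h

/-- Up to isomorphism, levels are subobjects of the terminal object; indexing by these is what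
bounds the size of the fibres of `F_Φ`. -/
lemma exists_subobject {p : C → Prop} (h : ∀ᶠ U in Φ.levels, p U) :
    ∃ S : Subobject (⊤_ C), Φ.mem (S : C) ∧ p (S : C) := by
  obtain ⟨U, hU, h⟩ := h
  have := (Φ.isSubterminal hU).mono_terminal_from
  let e := Subobject.underlyingIso (terminal.from U)
  have hS : Φ.mem (Subobject.mk (terminal.from U) : C) :=
    Φ.mem_of_hom hU (fun Z f g => by
      rw [← cancel_mono e.hom]
      exact Φ.isSubterminal hU _ _) e.inv
  exact ⟨_, hS, h _ hS e.hom⟩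

lemma eventually_isIso_restrictMap {f g : CartArrow C} (ρ : f ⟶ g)
    (h : IsIso (Φ.cartProj.map ρ)) : ∀ᶠ V in Φ.levels, IsIso (CartArrow.restrictMap ρ V) := by
  have e := IsIso.hom_inv_id (Φ.cartProj.map ρ)
  have e' := IsIso.inv_hom_id (Φ.cartProj.map ρ)
  have h₁ : IsIso (Φ.proj.map ρ.left) :=
    ⟨(inv (Φ.cartProj.map ρ)).left, congrArg CartArrow.Hom.left e, congrArg CartArrow.Hom.left e'⟩
  have h₂ : IsIso (Φ.proj.map ρ.right) :=
    ⟨(inv (Φ.cartProj.map ρ)).right, congrArg CartArrow.Hom.right e,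
      congrArg CartArrow.Hom.right e'⟩
  exact ((Φ.eventually_isIso _ h₁).and (Φ.eventually_isIso _ h₂)).mono fun V ⟨i₁, i₂⟩ =>
    CartArrow.isIso_of_isIso _ i₁ i₂

variable [HasPullbacks C]

/-- Arrows with structure whose arrow maps to an image lift along the projection. -/
lemma exists_iso_projTotal (b : (Φ.induced F).Total) {f : CartArrow C}
    (ψ : b.arrow ⟶ Φ.cartProj.obj f) :
    ∃ (b₀ : F.Total) (j : (Φ.projTotalFunctor F).obj b₀ ≅ b) (ψ₀ : b₀.arrow ⟶ f),
      j.hom.1 ≫ ψ = Φ.cartProj.map ψ₀ := by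
  obtain ⟨g, m, s, hs⟩ := Φ.exists_eq_map_inducedMk b.str
  obtain ⟨h, i, m', ψ', h₁, h₂⟩ := Φ.cartProj_isRightFractions.exists_iso_map₂ m ψ
  refine ⟨⟨h, F.map m'.op s⟩, Total.isoMk i ?_, ψ', h₂⟩
  change (Φ.induced F).map i.hom.op b.str = Φ.inducedMk F (F.map m'.op s)
  rw [hs, ← map_inducedMk, ← h₁, op_comp, Functor.map_comp_apply]

/-- A lift of the underlying pullback square matches the structures only after passing to `F_Φ`;
`exists_of_inducedMk_eq` supplies the further denominator on which they agree in `F`. -/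
lemma projTotal_isRightFractions : IsRightFractions (Φ.projTotalFunctor F) where
  surj b := by
    obtain ⟨f, ⟨e⟩⟩ := Φ.cartProj_isRightFractions.surj b.arrow
    obtain ⟨b₀, j, -⟩ := Φ.exists_iso_projTotal b e.inv
    exact ⟨b₀, ⟨j⟩⟩
  lift {a b} m := by
    obtain ⟨f, ρ, n, hρ, hn⟩ := Φ.cartProj_isRightFractions.lift (X := a.arrow) (Y := b.arrow) m.1
    have h : Φ.inducedMk F (F.map ρ.op a.str) = Φ.inducedMk F (F.map n.op b.str) := by
      have key : ∀ m₁ : Φ.cartProj.obj a.arrow ⟶ Φ.cartProj.obj b.arrow,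
          (Φ.induced F).map m₁.op (Φ.inducedMk F b.str) = Φ.inducedMk F a.str →
          Φ.cartProj.map ρ ≫ m₁ = Φ.cartProj.map n →
          Φ.inducedMk F (F.map ρ.op a.str) = Φ.inducedMk F (F.map n.op b.str) := by
        intro m₁ h₁ h₂
        rw [← map_inducedMk, ← map_inducedMk, ← h₂, op_comp, Functor.map_comp_apply, h₁]
      exact key m.1 m.2 hn
    obtain ⟨f', ρ', hρ', h⟩ := Φ.exists_of_inducedMk_eq h
    refine ⟨a.pull (ρ' ≫ ρ), a.pullHom _, ⟨ρ' ≫ n, ?_⟩, Φ.isIso_projTotalFunctor_map _ ?_,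
      Total.hom_ext ?_⟩
    · change F.map (ρ' ≫ n).op b.str = F.map (ρ' ≫ ρ).op a.str
      rw [op_comp, op_comp, Functor.map_comp_apply, Functor.map_comp_apply, h]
    · change IsIso (Φ.cartProj.map (ρ' ≫ ρ))
      rw [Functor.map_comp]
      infer_instance
    · change Φ.cartProj.map (ρ' ≫ ρ) ≫ m.1 = Φ.cartProj.map (ρ' ≫ n)
      rw [Functor.map_comp, Functor.map_comp, ← hn]
      exact Category.assoc _ _ _
  eq {a b} m m' h := by
    obtain ⟨f, ρ, hρ, e⟩ := Φ.cartProj_isRightFractions.eq m.1 m'.1 (congrArg Subtype.val h)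
    exact ⟨a.pull ρ, a.pullHom ρ, Φ.isIso_projTotalFunctor_map _ hρ, Total.hom_ext e⟩

/-- The image of the universal structured arrow over `f` stays universal: a competitor, and any two
factorizations of it, are presented in `C`, where universality applies. -/
lemma isRepresentable_induced (hF : ∀ f : CartArrow C, ((Over.forget f).op ⋙ F).IsRepresentable)
    (α : CartArrow (FilterQuotient Φ)) :
    ((Over.forget α).op ⋙ Φ.induced F).IsRepresentable := by
  obtain ⟨f, ⟨e⟩⟩ := Φ.cartProj_isRightFractions.surj α
  obtain ⟨a, φ, ha⟩ := (isRepresentable_iff f).1 (hF f)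
  refine (isRepresentable_iff α).2 ⟨(Φ.projTotalFunctor F).obj a, Φ.cartProj.map φ ≫ e.hom,
    fun b ψ => ?_⟩
  obtain ⟨b₀, j, ψ₀, hψ⟩ := Φ.exists_iso_projTotal b (ψ ≫ e.inv)
  obtain ⟨k₀, hk₀, -⟩ := ha b₀ ψ₀
  have hj : IsIso j.hom.1 := Total.isIso_val _
  refine ⟨j.inv ≫ (Φ.projTotalFunctor F).map k₀, ?_, fun k hk => ?_⟩
  · have key : ∀ (x : b.arrow ⟶ Φ.cartProj.obj b₀.arrow) (y : Φ.cartProj.obj b₀.arrow ⟶ b.arrow),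
        x ≫ y = 𝟙 _ → y ≫ ψ ≫ e.inv = Φ.cartProj.map ψ₀ →
          (x ≫ Φ.cartProj.map k₀.1) ≫ Φ.cartProj.map φ ≫ e.hom = ψ := by
      intro x y h₁ h₂
      rw [Category.assoc, ← Functor.map_comp_assoc, hk₀, ← h₂, Category.assoc, Category.assoc,
        e.inv_hom_id, Category.comp_id, reassoc_of% h₁]
    exact key j.inv.1 j.hom.1 (congrArg Subtype.val j.inv_hom_id) hψ
  · obtain ⟨b₁, ρ, k₁, hρ, hk₁⟩ := Φ.projTotal_isRightFractions.lift (j.hom ≫ k)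
    have h₁ : Φ.cartProj.map (k₁.1 ≫ φ) = Φ.cartProj.map (ρ.1 ≫ ψ₀) := by
      have key : ∀ (y : Φ.cartProj.obj b₀.arrow ⟶ b.arrow) (z : b.arrow ⟶ Φ.cartProj.obj a.arrow),
          Φ.cartProj.map k₁.1 = Φ.cartProj.map ρ.1 ≫ y ≫ z → y ≫ ψ ≫ e.inv = Φ.cartProj.map ψ₀ →
          z ≫ Φ.cartProj.map φ ≫ e.hom = ψ →
          Φ.cartProj.map (k₁.1 ≫ φ) = Φ.cartProj.map (ρ.1 ≫ ψ₀) := by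
        intro y z h₁ h₂ h₃
        rw [Functor.map_comp, Functor.map_comp, h₁, ← h₂, ← h₃]
        simp
      exact key j.hom.1 k.1 (congrArg Subtype.val hk₁.symm) hψ hk
    -- The lift `k₁` of `k` agrees with `ρ ≫ k₀` over `f` only in the quotient. On the refinement
    -- `σ` they agree over `f` in `C`, and uniqueness there identifies them.
    obtain ⟨g, σ, hσ, hσ'⟩ := Φ.cartProj_isRightFractions.eq _ _ h₁
    let σ' : b₁.pull σ ⟶ b₁ := b₁.pullHom σ
    obtain ⟨k₂, -, hk₂⟩ := ha (b₁.pull σ) (σ ≫ k₁.1 ≫ φ)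
    have h₃ : σ' ≫ k₁ = σ' ≫ ρ ≫ k₀ := by
      refine (hk₂ (σ' ≫ k₁) (Category.assoc _ _ _)).trans (hk₂ (σ' ≫ ρ ≫ k₀) ?_).symm
      change (σ ≫ ρ.1 ≫ k₀.1) ≫ φ = σ ≫ k₁.1 ≫ φ
      rw [Category.assoc, Category.assoc, hk₀, hσ']
    have := Φ.isIso_projTotalFunctor_map σ' hσ
    have h₄ := congrArg (Φ.projTotalFunctor F).map h₃
    rw [Functor.map_comp, Functor.map_comp, Functor.map_comp, cancel_epi, ← hk₁, cancel_epi] at h₄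
    rw [← h₄, Iso.inv_hom_id_assoc]

lemma eventually_lift_cartProj {f g : CartArrow C} (n : Φ.cartProj.obj f ⟶ Φ.cartProj.obj g) :
    ∀ᶠ V in Φ.levels, ∃ n' : f.restrict V ⟶ g,
      Φ.cartProj.map (f.restrictFst V) ≫ n = Φ.cartProj.map n' := by
  obtain ⟨f', ρ, n', hρ, hn⟩ := Φ.cartProj_isRightFractions.lift n
  refine (Φ.eventually_isIso_restrictMap ρ hρ).mono fun V hV => ?_
  refine ⟨inv (CartArrow.restrictMap ρ V) ≫ f'.restrictFst V ≫ n', ?_⟩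
  rw [Functor.map_comp, Functor.map_comp, ← hn, ← Functor.map_comp_assoc _ (f'.restrictFst V),
    ← CartArrow.restrictMap_fst, ← Functor.map_comp_assoc, IsIso.inv_hom_id_assoc]

/-- If the subobjects of the terminal object form a small set, the induced notion of fibred structure has
small fibres. -/
lemma small_induced (h : Small.{w} (Subobject (⊤_ C))) (α : (CartArrow (FilterQuotient Φ))ᵒᵖ) :
    Small.{w} ((Φ.induced F).obj α) := by
  obtain ⟨f, ⟨e⟩⟩ := Φ.cartProj_isRightFractions.surj α.unop
  -- Every structure on the image of `f` is presented on some restriction `f × S`, so this small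
  -- type surjects onto the fibre.
  let T := Σ S : {S : Subobject (⊤_ C) // Φ.mem (S : C)}, F.obj (op (f.restrict (S.1 : C)))
  let t : T → (Φ.induced F).obj α := fun x =>
    have := Φ.isIso_cartProj_map_restrictFst f x.1.2
    (Φ.induced F).map (e.inv ≫ inv (Φ.cartProj.map (f.restrictFst (x.1.1 : C)))).op
      (Φ.inducedMk F x.2)
  refine small_of_surjective (f := t) fun x => ?_
  obtain ⟨g, m, s, hs⟩ := Φ.exists_eq_map_inducedMk (α := α.unop) x
  obtain ⟨S, hS, n, hn⟩ := Φ.exists_subobject (Φ.eventually_lift_cartProj (e.hom ≫ m))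
  have := Φ.isIso_cartProj_map_restrictFst f hS
  refine ⟨⟨⟨S, hS⟩, F.map n.op s⟩, ?_⟩
  change (Φ.induced F).map (e.inv ≫ inv (Φ.cartProj.map (f.restrictFst (S : C)))).op
      (Φ.inducedMk F (F.map n.op s)) = x
  rw [← map_inducedMk, ← Functor.map_comp_apply, ← op_comp, ← hn, hs]
  simp

end

/-! ### Fibrations, relative acyclicity and universes -/

section

variable {C : Type u} [Category.{v} C] [ModelCategory C] {Φ : SubterminalFilter C}
  {F : FibredStructure.{w} C}

/-- An isomorphism of arrows in the filter quotient, in terms of commutative squares. -/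
noncomputable def arrowIsoOfCartArrowIso {f : CartArrow C} {α : CartArrow (FilterQuotient Φ)}
    (e : Φ.cartProj.obj f ≅ α) : Φ.proj.mapArrow.obj (Arrow.mk f.hom) ≅ Arrow.mk α.hom where
  hom := Arrow.homMk e.hom.left e.hom.right e.hom.isPullback.w
  inv := Arrow.homMk e.inv.left e.inv.right e.inv.isPullback.w
  hom_inv_id := Arrow.hom_ext _ _ (congrArg CartArrow.Hom.left e.hom_inv_id)
    (congrArg CartArrow.Hom.right e.hom_inv_id)
  inv_hom_id := Arrow.hom_ext _ _ (congrArg CartArrow.Hom.left e.inv_hom_id)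
    (congrArg CartArrow.Hom.right e.inv_hom_id)

lemma exists_iso_of_fibration {α : CartArrow (FilterQuotient Φ)} (h : Fibration α.hom) :
    ∃ f : CartArrow C, Fibration f.hom ∧ Nonempty (Φ.cartProj.obj f ≅ α) := by
  obtain ⟨f, hf, ⟨e⟩⟩ := exists_iso_of_descend (m := Arrow.mk α.hom) h.mem
  let a : Φ.proj.obj f.left ≅ α.left := Arrow.leftFunc.mapIso e
  let b : Φ.proj.obj f.right ≅ α.right := Arrow.rightFunc.mapIso e
  have sq : IsPullback a.hom (Φ.proj.map f.hom) α.hom b.hom :=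
    IsPullback.of_horiz_isIso ⟨Arrow.w e.hom⟩
  let n : Φ.cartProj.obj ⟨f.hom⟩ ⟶ α := ⟨a.hom, b.hom, sq⟩
  have : IsIso n := CartArrow.isIso_of_isIso n (inferInstanceAs (IsIso a.hom))
    (inferInstanceAs (IsIso b.hom))
  exact ⟨⟨f.hom⟩, ⟨hf⟩, ⟨asIso n⟩⟩

/-- A presentation exhibits `α`, up to isomorphism, as the image of a base change in `C` of an arrow
with structure, which is a fibration. Conversely a fibration of the quotient is presented by a
fibration of `C`. -/
lemma covers_induced (hF : ∀ f : CartArrow C, Nonempty (F.obj (op f)) ↔ Fibration f.hom)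
    (α : CartArrow (FilterQuotient Φ)) :
    Nonempty ((Φ.induced F).obj (op α)) ↔ Fibration α.hom := by
  refine ⟨fun ⟨x⟩ => ?_, fun h => ?_⟩
  · obtain ⟨g, m, s, -⟩ := Φ.exists_eq_map_inducedMk x
    obtain ⟨f, e, m', -⟩ := Φ.cartProj_isRightFractions.exists_iso_map m
    have hg : fibrations C g.hom := ((hF g).1 ⟨s⟩).mem
    have hf : fibrations C f.hom := MorphismProperty.of_isPullback m'.isPullback hg
    exact ⟨Φ.isStable_fibrations.descend_of_iso (arrowIsoOfCartArrowIso e) hf⟩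
  · obtain ⟨f, hf, ⟨e⟩⟩ := exists_iso_of_fibration h
    obtain ⟨s⟩ := (hF f).2 hf
    exact ⟨(Φ.induced F).map e.inv.op (Φ.inducedMk F s)⟩

variable (hΦ : Φ.IsModelFilter)
include hΦ

/-- If the base of a pullback square of `C` becomes a cofibration after composing with isomorphisms, it is
a cofibration at small levels. -/
lemma IsModelFilter.eventually_cofibration {f g : CartArrow C} (μ : f ⟶ g)
    {α β : CartArrow (FilterQuotient Φ)} (i : Φ.cartProj.obj f ⟶ α) (m : α ⟶ β)
    (j : β ⟶ Φ.cartProj.obj g) (hi : IsIso i) (hj : IsIso j) (h : i ≫ m ≫ j = Φ.cartProj.map μ)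
    (hm : Cofibration m.right) :
    ∀ᶠ V in Φ.levels, Cofibration (CartArrow.restrictMap μ V).right := by
  have := CartArrow.isIso_right i
  have := CartArrow.isIso_right j
  have hr := hΦ.isStable_cofibrations.respectsIso_descend
  have h₁ : Φ.descend (cofibrations C) (Φ.proj.map μ.right) := by
    have : Φ.proj.map μ.right = i.right ≫ m.right ≫ j.right :=
      congrArg CartArrow.Hom.right h.symm
    rw [this]
    exact (MorphismProperty.cancel_left_of_respectsIso _ _ _).2
      ((MorphismProperty.cancel_right_of_respectsIso _ _ _).2 hm.mem)
  exact (hΦ.isStable_cofibrations.eventually_of_descend (f := Arrow.mk μ.right) h₁).mono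
    fun V hV => ⟨hV⟩

lemma IsModelFilter.isLPaRANoFScaF_induced (hF : F.IsLPaRANoFScaF) :
    (Φ.induced F).IsLPaRANoFScaF where
  locallyRepresentable := Φ.isRepresentable_induced hF.locallyRepresentable
  covers := covers_induced hF.covers
  relativelyAcyclic := by
    have hF' := (isAcyclicFibration_fibrations_iff _).1 hF.relativelyAcyclic
    refine (isAcyclicFibration_fibrations_iff _).2 fun a y m hy hm => ?_
    obtain ⟨g, hg, ⟨j⟩⟩ := exists_iso_of_fibration hy
    obtain ⟨b, i, μ, hμ⟩ := Φ.exists_iso_projTotal a (m ≫ j.inv)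
    have key : ∀ (k : Φ.cartProj.obj b.arrow ⟶ a.arrow) (_ : IsIso k),
        k ≫ m ≫ j.inv = Φ.cartProj.map μ →
        (Φ.induced F).map k.op a.str = Φ.inducedMk F b.str →
        ∃ t : (Φ.induced F).obj (op y), (Φ.induced F).map m.op t = a.str := by
      intro k hk h₁ h₂
      -- At this level the base of `μ` is a cofibration of `C`, so the structure on `b` extends to
      -- `g × V`. As `g × V` has the same image as `g` up to isomorphism, it presents a structure on
      -- `y`.
      obtain ⟨V, hV, hc⟩ := (Φ.eventually_mem.and
        (hΦ.eventually_cofibration μ k m j.inv hk inferInstance h₁ hm)).exists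
      have hgV : Fibration (g.restrict V).hom :=
        ⟨Φ.isStable_fibrations.restrict _ hV hg.mem⟩
      obtain ⟨t, ht⟩ := hF' (b.pull (b.arrow.restrictFst V)) (g.restrict V)
        (CartArrow.restrictMap μ V) hgV hc
      have i₁ := Φ.isIso_cartProj_map_restrictFst b.arrow hV
      have i₂ := Φ.isIso_cartProj_map_restrictFst g hV
      refine ⟨(Φ.induced F).map (j.inv ≫ inv (Φ.cartProj.map (g.restrictFst V))).op
        (Φ.inducedMk F t), ?_⟩
      -- The required equality of structures can be tested after pulling back to the restriction of
      -- `b`, where it is the image of `ht`.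
      have hinj : ∀ {α β : CartArrow (FilterQuotient Φ)} (n : α ⟶ β) [IsIso n]
          (x x' : (Φ.induced F).obj (op β)),
          (Φ.induced F).map n.op x = (Φ.induced F).map n.op x' → x = x' := by
        intro α β n _ x x' hx
        have := congrArg ((Φ.induced F).map (inv n).op) hx
        simpa only [← Functor.map_comp_apply, ← op_comp, IsIso.inv_hom_id, op_id,
          Functor.map_id_apply] using this
      refine hinj (Φ.cartProj.map (b.arrow.restrictFst V) ≫ k) _ _ ?_
      have h₃ : ((Φ.cartProj.map (b.arrow.restrictFst V) ≫ k) ≫ m) ≫ j.inv ≫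
          inv (Φ.cartProj.map (g.restrictFst V)) =
          Φ.cartProj.map (CartArrow.restrictMap μ V) := by
        rw [← Category.assoc, IsIso.comp_inv_eq, Category.assoc, Category.assoc, h₁,
          ← Functor.map_comp, ← Functor.map_comp, CartArrow.restrictMap_fst]
      rw [← Functor.map_comp_apply, ← Functor.map_comp_apply, ← op_comp, ← op_comp, h₃,
        map_inducedMk, op_comp, Functor.map_comp_apply, h₂, map_inducedMk]
      exact congrArg (Φ.inducedMk F) ht
    exact key i.hom.1 (Total.isIso_val _) hμ i.hom.2

/-- In the form `Total.isUniverse_iff`, the task is to extend `p` along `m`. All three morphisms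
`p`, `q`, `m` lift to `C`, at a small level the base of `m` is a cofibration, and the extension
found there is projected back. -/
lemma IsModelFilter.isUniverse_projTotal {u : F.Total} (hu : u.IsUniverse) :
    (Φ.projTotal u).IsUniverse := by
  have hr : (cofibrations (FilterQuotient Φ)).RespectsIso :=
    hΦ.isStable_cofibrations.respectsIso_descend
  have hu' := (Total.isUniverse_iff u).1 hu
  refine (Total.isUniverse_iff _).2 fun a y (p : a ⟶ (Φ.projTotalFunctor F).obj u)
    (q : y ⟶ (Φ.projTotalFunctor F).obj u) m hm => ?_
  change ∃ n : y ⟶ (Φ.projTotalFunctor F).obj u, m ≫ n = p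
  obtain ⟨y₀, e, q₀, hq⟩ := Φ.projTotal_isRightFractions.exists_iso_map (X := u) q
  obtain ⟨a₀, i, m₀, p₀, h₁, h₂⟩ := Φ.projTotal_isRightFractions.exists_iso_map₂ (X₂ := u)
    (m ≫ e.inv) p
  have hi : IsIso i.hom.1 := Total.isIso_val _
  have he : IsIso e.inv.1 := Total.isIso_val _
  obtain ⟨V, hV, hc⟩ := (Φ.eventually_mem.and (hΦ.eventually_cofibration m₀.1 i.hom.1 m.1
    e.inv.1 hi he (congrArg Subtype.val h₁) hm)).exists
  let a₁ := a₀.pull (a₀.arrow.restrictFst V)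
  let y₁ := y₀.pull (y₀.arrow.restrictFst V)
  let ρ : a₁ ⟶ a₀ := a₀.pullHom _
  let σ : y₁ ⟶ y₀ := y₀.pullHom _
  let m₁ : a₁ ⟶ y₁ := ⟨CartArrow.restrictMap m₀.1 V, by
    change F.map (CartArrow.restrictMap m₀.1 V).op (F.map (y₀.arrow.restrictFst V).op y₀.str) =
      F.map (a₀.arrow.restrictFst V).op a₀.str
    rw [← Functor.map_comp_apply, ← op_comp, CartArrow.restrictMap_fst, op_comp,
      Functor.map_comp_apply, m₀.2]⟩
  have hw : m₁ ≫ σ = ρ ≫ m₀ := Total.hom_ext (CartArrow.restrictMap_fst _ _)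
  obtain ⟨n, hn⟩ := hu' (ρ ≫ p₀) (σ ≫ q₀) m₁ hc
  have hρ := Φ.isIso_projTotalFunctor_map ρ (Φ.isIso_cartProj_map_restrictFst _ hV)
  have hσ := Φ.isIso_projTotalFunctor_map σ (Φ.isIso_cartProj_map_restrictFst _ hV)
  refine ⟨e.inv ≫ inv ((Φ.projTotalFunctor F).map σ) ≫ (Φ.projTotalFunctor F).map n, ?_⟩
  have h₃ : i.hom ≫ m ≫ e.inv ≫ inv ((Φ.projTotalFunctor F).map σ) ≫
      (Φ.projTotalFunctor F).map n = i.hom ≫ p := by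
    rw [← Category.assoc m, ← Category.assoc i.hom, h₁, h₂,
      ← cancel_epi ((Φ.projTotalFunctor F).map ρ), ← Functor.map_comp_assoc, ← hw,
      Functor.map_comp, Category.assoc, IsIso.hom_inv_id_assoc, ← Functor.map_comp,
      ← Functor.map_comp, hn]
  exact (cancel_epi i.hom).1 h₃

end

end SubterminalFilter

/-! ### Univalence -/

namespace EquivalenceData

variable {C : Type u} [Category.{v} C] {E B : C} {π : E ⟶ B} {Q : FibrewisePath π}
  {d e k : EquivalenceData Q}

attribute [local simp] Hom.φ_x₁ Hom.φ_x₂ Hom.φ₁_a₁ Hom.φ₂_a₂ Hom.φ₁_q₁ Hom.φ₂_q₂ Hom.φ₁_f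
  Hom.φ₂_g Hom.φ₂_h Hom.φ₁_η Hom.φ₂_ε

/-- The composition of base changes. -/
def Hom.comp (m : Hom d e) (n : Hom e k) : Hom d k where
  φ := m.φ ≫ n.φ
  φ₁ := m.φ₁ ≫ n.φ₁
  φ₂ := m.φ₂ ≫ n.φ₂
  φ_x₁ := by simp
  φ_x₂ := by simp
  φ₁_a₁ := by simp
  φ₂_a₂ := by simp
  φ₁_q₁ := by rw [Category.assoc, n.φ₁_q₁, reassoc_of% m.φ₁_q₁]
  φ₂_q₂ := by rw [Category.assoc, n.φ₂_q₂, reassoc_of% m.φ₂_q₂]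
  φ₁_f := by rw [Category.assoc, n.φ₁_f, reassoc_of% m.φ₁_f]
  φ₂_g := by rw [Category.assoc, n.φ₂_g, reassoc_of% m.φ₂_g]
  φ₂_h := by rw [Category.assoc, n.φ₂_h, reassoc_of% m.φ₂_h]
  φ₁_η := by simp
  φ₂_ε := by simp

/-- The components on `A₁` and `A₂` are morphisms into pullbacks, determined by the base. Uniqueness
of base changes thus concerns `φ` alone. -/
lemma Hom.ext_of_base {m n : Hom d e} (h : m.φ = n.φ) : m = n := by
  have h₁ : m.φ₁ = n.φ₁ := e.isPullback₁.hom_ext (by simp) (by simp [h])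
  have h₂ : m.φ₂ = n.φ₂ := e.isPullback₂.hom_ext (by simp) (by simp [h])
  cases m
  cases n
  cases h
  cases h₁
  cases h₂
  rfl

/-- A comparison of pullbacks of the same morphism is an isomorphism if it lies over one. -/
lemma isIso_of_isPullback {X X' A A' : C} {x : X ⟶ B} {x' : X' ⟶ B} {a : A ⟶ E} {a' : A' ⟶ E}
    {q : A ⟶ X} {q' : A' ⟶ X'} (sq : IsPullback a q π x) (sq' : IsPullback a' q' π x')
    {φ : X ⟶ X'} {ψ : A ⟶ A'} (hx : φ ≫ x' = x) (ha : ψ ≫ a' = a) (hq : ψ ≫ q' = q ≫ φ)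
    (hφ : IsIso φ) : IsIso ψ := by
  subst hx ha
  exact (IsPullback.of_right sq hq sq').isIso_fst_of_isIso

/-- The inverse of a base change along an isomorphism. -/
noncomputable def Hom.inverse (m : Hom d e) (hm : IsIso m.φ) : Hom e d :=
  have h₁ : IsIso m.φ₁ := isIso_of_isPullback d.isPullback₁ e.isPullback₁ m.φ_x₁ m.φ₁_a₁ m.φ₁_q₁ hm
  have h₂ : IsIso m.φ₂ := isIso_of_isPullback d.isPullback₂ e.isPullback₂ m.φ_x₂ m.φ₂_a₂ m.φ₂_q₂ hm
  { φ := inv m.φ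
    φ₁ := inv m.φ₁
    φ₂ := inv m.φ₂
    φ_x₁ := by simp
    φ_x₂ := by simp
    φ₁_a₁ := by simp
    φ₂_a₂ := by simp
    φ₁_q₁ := by rw [IsIso.inv_comp_eq, ← Category.assoc, IsIso.eq_comp_inv, m.φ₁_q₁]
    φ₂_q₂ := by rw [IsIso.inv_comp_eq, ← Category.assoc, IsIso.eq_comp_inv, m.φ₂_q₂]
    φ₁_f := by rw [IsIso.inv_comp_eq, ← Category.assoc, IsIso.eq_comp_inv, m.φ₁_f]
    φ₂_g := by rw [IsIso.inv_comp_eq, ← Category.assoc, IsIso.eq_comp_inv, m.φ₂_g]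
    φ₂_h := by rw [IsIso.inv_comp_eq, ← Category.assoc, IsIso.eq_comp_inv, m.φ₂_h]
    φ₁_η := by simp
    φ₂_ε := by simp }

/-- The base change along the projection from a product. -/
noncomputable def restrict [HasFiniteProducts C] (d : EquivalenceData Q) (U : C) :
    EquivalenceData Q where
  base := d.base ⨯ U
  A₁ := d.A₁ ⨯ U
  A₂ := d.A₂ ⨯ U
  x₁ := prod.fst ≫ d.x₁
  x₂ := prod.fst ≫ d.x₂
  a₁ := prod.fst ≫ d.a₁
  a₂ := prod.fst ≫ d.a₂
  q₁ := prod.map d.q₁ (𝟙 U)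
  q₂ := prod.map d.q₂ (𝟙 U)
  isPullback₁ := (isPullback_prod_fst d.q₁ U).paste_horiz d.isPullback₁
  isPullback₂ := (isPullback_prod_fst d.q₂ U).paste_horiz d.isPullback₂
  f := prod.map d.f (𝟙 U)
  g := prod.map d.g (𝟙 U)
  h := prod.map d.h (𝟙 U)
  f_q₂ := by simp [d.f_q₂]
  g_q₁ := by simp [d.g_q₁]
  h_q₁ := by simp [d.h_q₁]
  η := prod.fst ≫ d.η
  η_p₀ := by simp [d.η_p₀]
  η_p₁ := by simp [d.η_p₁]
  ε := prod.fst ≫ d.ε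
  ε_p₀ := by simp [d.ε_p₀]
  ε_p₁ := by simp [d.ε_p₁]

end EquivalenceData

namespace SubterminalFilter

open EquivalenceData

variable {C : Type u} [Category.{v} C] [HasFiniteProducts C] (Φ : SubterminalFilter C)
  {E B : C} {π : E ⟶ B} {Q : FibrewisePath π}

lemma proj_map_comp_eq {X Y Y' Z : C} {f : X ⟶ Y} {g : Y ⟶ Z} {f' : X ⟶ Y'} {g' : Y' ⟶ Z}
    (h : f ≫ g = f' ≫ g') :
    Φ.proj.map f ≫ Φ.proj.map g = Φ.proj.map f' ≫ Φ.proj.map g' := by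
  rw [← Functor.map_comp, h, Functor.map_comp]

lemma proj_map_comp_eq_map {X Y Z : C} {f : X ⟶ Y} {g : Y ⟶ Z} {k : X ⟶ Z} (h : f ≫ g = k) :
    Φ.proj.map f ≫ Φ.proj.map g = Φ.proj.map k := by
  rw [← Functor.map_comp, h]

lemma proj_map_comp_eq_comp₂ {X Y Z Y' Z' : C} {f : X ⟶ Y} {g : Y ⟶ Z} {k : X ⟶ Y'} {l : Y' ⟶ Z'}
    {m : Z' ⟶ Z} (h : f ≫ g = k ≫ l ≫ m) :
    Φ.proj.map f ≫ Φ.proj.map g = Φ.proj.map k ≫ Φ.proj.map l ≫ Φ.proj.map m := by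
  rw [← Functor.map_comp, h, Functor.map_comp, Functor.map_comp]

/-- The image of a family of equivalences under the projection. -/
noncomputable def projEquivalenceData (d : EquivalenceData Q) :
    EquivalenceData (Q.map Φ.proj) where
  base := Φ.proj.obj d.base
  A₁ := Φ.proj.obj d.A₁
  A₂ := Φ.proj.obj d.A₂
  x₁ := Φ.proj.map d.x₁
  x₂ := Φ.proj.map d.x₂
  a₁ := Φ.proj.map d.a₁
  a₂ := Φ.proj.map d.a₂
  q₁ := Φ.proj.map d.q₁
  q₂ := Φ.proj.map d.q₂
  isPullback₁ := Φ.isPullback_proj_map d.isPullback₁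
  isPullback₂ := Φ.isPullback_proj_map d.isPullback₂
  f := Φ.proj.map d.f
  g := Φ.proj.map d.g
  h := Φ.proj.map d.h
  f_q₂ := Φ.proj_map_comp_eq_map d.f_q₂
  g_q₁ := Φ.proj_map_comp_eq_map d.g_q₁
  h_q₁ := Φ.proj_map_comp_eq_map d.h_q₁
  η := Φ.proj.map d.η
  η_p₀ := Φ.proj_map_comp_eq_comp₂ d.η_p₀
  η_p₁ := Φ.proj_map_comp_eq_map d.η_p₁
  ε := Φ.proj.map d.ε
  ε_p₀ := Φ.proj_map_comp_eq_comp₂ d.ε_p₀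
  ε_p₁ := Φ.proj_map_comp_eq_map d.ε_p₁

/-- The image of a base change under the projection. -/
noncomputable def projEquivalenceDataHom {d e : EquivalenceData Q} (m : Hom d e) :
    Hom (Φ.projEquivalenceData d) (Φ.projEquivalenceData e) where
  φ := Φ.proj.map m.φ
  φ₁ := Φ.proj.map m.φ₁
  φ₂ := Φ.proj.map m.φ₂
  φ_x₁ := Φ.proj_map_comp_eq_map m.φ_x₁
  φ_x₂ := Φ.proj_map_comp_eq_map m.φ_x₂
  φ₁_a₁ := Φ.proj_map_comp_eq_map m.φ₁_a₁
  φ₂_a₂ := Φ.proj_map_comp_eq_map m.φ₂_a₂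
  φ₁_q₁ := Φ.proj_map_comp_eq m.φ₁_q₁
  φ₂_q₂ := Φ.proj_map_comp_eq m.φ₂_q₂
  φ₁_f := Φ.proj_map_comp_eq m.φ₁_f
  φ₂_g := Φ.proj_map_comp_eq m.φ₂_g
  φ₂_h := Φ.proj_map_comp_eq m.φ₂_h
  φ₁_η := Φ.proj_map_comp_eq_map m.φ₁_η
  φ₂_ε := Φ.proj_map_comp_eq_map m.φ₂_ε

/-- The projection preserves the classifying morphism of the identity equivalences. -/
noncomputable def projEquivalenceDataReflHom {e : EquivalenceData Q} (m : Hom (refl Q) e) :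
    Hom (refl (Q.map Φ.proj)) (Φ.projEquivalenceData e) where
  φ := Φ.proj.map m.φ
  φ₁ := Φ.proj.map m.φ₁
  φ₂ := Φ.proj.map m.φ₂
  φ_x₁ := (Φ.proj_map_comp_eq_map m.φ_x₁).trans (Φ.proj.map_id _)
  φ_x₂ := (Φ.proj_map_comp_eq_map m.φ_x₂).trans (Φ.proj.map_id _)
  φ₁_a₁ := (Φ.proj_map_comp_eq_map m.φ₁_a₁).trans (Φ.proj.map_id _)
  φ₂_a₂ := (Φ.proj_map_comp_eq_map m.φ₂_a₂).trans (Φ.proj.map_id _)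
  φ₁_q₁ := Φ.proj_map_comp_eq m.φ₁_q₁
  φ₂_q₂ := Φ.proj_map_comp_eq m.φ₂_q₂
  φ₁_f := (Φ.proj_map_comp_eq_map (m.φ₁_f.trans (Category.id_comp _))).trans
    (Category.id_comp _).symm
  φ₂_g := (Φ.proj_map_comp_eq_map (m.φ₂_g.trans (Category.id_comp _))).trans
    (Category.id_comp _).symm
  φ₂_h := (Φ.proj_map_comp_eq_map (m.φ₂_h.trans (Category.id_comp _))).trans
    (Category.id_comp _).symm
  φ₁_η := Φ.proj_map_comp_eq_map m.φ₁_η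
  φ₂_ε := Φ.proj_map_comp_eq_map m.φ₂_ε

lemma map_fst_comp_eq {S T U : C} {k : S ⟶ T} {S' : FilterQuotient Φ} {α : Φ.proj.obj S ⟶ S'}
    {k' : S' ⟶ Φ.proj.obj T} (hk : Φ.proj.map k = α ≫ k') :
    Φ.proj.map ((prod.fst : S ⨯ U ⟶ S) ≫ k) = (Φ.proj.map prod.fst ≫ α) ≫ k' := by
  rw [Functor.map_comp, hk, Category.assoc]

lemma map_prod_map_comp_eq {S T U : C} {k : S ⟶ T} {S' T' : FilterQuotient Φ}
    {α : Φ.proj.obj S ⟶ S'} {β : Φ.proj.obj T ⟶ T'} {k' : S' ⟶ T'}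
    (hk : Φ.proj.map k ≫ β = α ≫ k') :
    Φ.proj.map (prod.map k (𝟙 U)) ≫ Φ.proj.map prod.fst ≫ β =
      (Φ.proj.map prod.fst ≫ α) ≫ k' := by
  rw [← Functor.map_comp_assoc, prod.map_fst, Functor.map_comp, Category.assoc, Category.assoc,
    hk]

/-- Data in `C` that present a family of equivalences in the filter quotient satisfy the required
equations at a small level. -/
lemma exists_hom_of_lift (d : EquivalenceData (Q.map Φ.proj)) {X A₁ A₂ : C} (x₁ x₂ : X ⟶ B)
    (a₁ : A₁ ⟶ E) (a₂ : A₂ ⟶ E) (q₁ : A₁ ⟶ X) (q₂ : A₂ ⟶ X) (sq₁ : IsPullback a₁ q₁ π x₁)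
    (sq₂ : IsPullback a₂ q₂ π x₂) (f : A₁ ⟶ A₂) (g h : A₂ ⟶ A₁) (η : A₁ ⟶ Q.path) (ε : A₂ ⟶ Q.path)
    (ψ : Φ.proj.obj X ⟶ d.base) (ψ₁ : Φ.proj.obj A₁ ⟶ d.A₁) (ψ₂ : Φ.proj.obj A₂ ⟶ d.A₂)
    [IsIso ψ] [IsIso ψ₁] [IsIso ψ₂] (hx₁ : Φ.proj.map x₁ = ψ ≫ d.x₁)
    (hx₂ : Φ.proj.map x₂ = ψ ≫ d.x₂) (ha₁ : Φ.proj.map a₁ = ψ₁ ≫ d.a₁)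
    (ha₂ : Φ.proj.map a₂ = ψ₂ ≫ d.a₂) (hq₁ : Φ.proj.map q₁ ≫ ψ = ψ₁ ≫ d.q₁)
    (hq₂ : Φ.proj.map q₂ ≫ ψ = ψ₂ ≫ d.q₂) (hf : Φ.proj.map f ≫ ψ₂ = ψ₁ ≫ d.f)
    (hg : Φ.proj.map g ≫ ψ₁ = ψ₂ ≫ d.g) (hh : Φ.proj.map h ≫ ψ₁ = ψ₂ ≫ d.h)
    (hη : Φ.proj.map η = ψ₁ ≫ d.η) (hε : Φ.proj.map ε = ψ₂ ≫ d.ε) :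
    ∃ (d₀ : EquivalenceData Q) (m : Hom (Φ.projEquivalenceData d₀) d), IsIso m.φ := by
  -- Each defining equation holds in the image because it holds for `d` and the data are conjugate
  -- to `d` by `ψ`, `ψ₁`, `ψ₂`. All seven then hold in `C` at a common level.
  have f_q₂ : Φ.proj.map (f ≫ q₂) = Φ.proj.map q₁ := by
    rw [← cancel_mono ψ, Functor.map_comp, Category.assoc, hq₂, reassoc_of% hf, d.f_q₂, hq₁]
  have g_q₁ : Φ.proj.map (g ≫ q₁) = Φ.proj.map q₂ := by
    rw [← cancel_mono ψ, Functor.map_comp, Category.assoc, hq₁, reassoc_of% hg, d.g_q₁, hq₂]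
  have h_q₁ : Φ.proj.map (h ≫ q₁) = Φ.proj.map q₂ := by
    rw [← cancel_mono ψ, Functor.map_comp, Category.assoc, hq₁, reassoc_of% hh, d.h_q₁, hq₂]
  have η_p₀ : Φ.proj.map (η ≫ Q.p₀) = Φ.proj.map (f ≫ g ≫ a₁) := by
    have key : ∀ η' : d.A₁ ⟶ Φ.proj.obj Q.path, Φ.proj.map η = ψ₁ ≫ η' →
        η' ≫ Φ.proj.map Q.p₀ = d.f ≫ d.g ≫ d.a₁ →
        Φ.proj.map (η ≫ Q.p₀) = Φ.proj.map (f ≫ g ≫ a₁) := by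
      intro η' h₁ h₂
      rw [Functor.map_comp, Functor.map_comp, Functor.map_comp, h₁, Category.assoc, h₂, ha₁,
        reassoc_of% hg, reassoc_of% hf]
    exact key d.η hη d.η_p₀
  have η_p₁ : Φ.proj.map (η ≫ Q.p₁) = Φ.proj.map a₁ := by
    have key : ∀ η' : d.A₁ ⟶ Φ.proj.obj Q.path, Φ.proj.map η = ψ₁ ≫ η' →
        η' ≫ Φ.proj.map Q.p₁ = d.a₁ → Φ.proj.map (η ≫ Q.p₁) = Φ.proj.map a₁ := by
      intro η' h₁ h₂
      rw [Functor.map_comp, h₁, Category.assoc, h₂, ha₁]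
    exact key d.η hη d.η_p₁
  have ε_p₀ : Φ.proj.map (ε ≫ Q.p₀) = Φ.proj.map (h ≫ f ≫ a₂) := by
    have key : ∀ ε' : d.A₂ ⟶ Φ.proj.obj Q.path, Φ.proj.map ε = ψ₂ ≫ ε' →
        ε' ≫ Φ.proj.map Q.p₀ = d.h ≫ d.f ≫ d.a₂ →
        Φ.proj.map (ε ≫ Q.p₀) = Φ.proj.map (h ≫ f ≫ a₂) := by
      intro ε' h₁ h₂
      rw [Functor.map_comp, Functor.map_comp, Functor.map_comp, h₁, Category.assoc, h₂, ha₂,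
        reassoc_of% hf, reassoc_of% hh]
    exact key d.ε hε d.ε_p₀
  have ε_p₁ : Φ.proj.map (ε ≫ Q.p₁) = Φ.proj.map a₂ := by
    have key : ∀ ε' : d.A₂ ⟶ Φ.proj.obj Q.path, Φ.proj.map ε = ψ₂ ≫ ε' →
        ε' ≫ Φ.proj.map Q.p₁ = d.a₂ → Φ.proj.map (ε ≫ Q.p₁) = Φ.proj.map a₂ := by
      intro ε' h₁ h₂
      rw [Functor.map_comp, h₁, Category.assoc, h₂, ha₂]
    exact key d.ε hε d.ε_p₁
  obtain ⟨V, hV, f_q₂, g_q₁, h_q₁, η_p₀, η_p₁, ε_p₀, ε_p₁⟩ := (Φ.eventually_mem.and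
    ((Φ.eventually_fst_comp_eq f_q₂).and ((Φ.eventually_fst_comp_eq g_q₁).and
    ((Φ.eventually_fst_comp_eq h_q₁).and ((Φ.eventually_fst_comp_eq η_p₀).and
    ((Φ.eventually_fst_comp_eq η_p₁).and ((Φ.eventually_fst_comp_eq ε_p₀).and
    (Φ.eventually_fst_comp_eq ε_p₁)))))))).exists
  have i := Φ.isIso_proj_map_fst hV X
  let d₀ : EquivalenceData Q :=
    { base := X ⨯ V
      A₁ := A₁ ⨯ V
      A₂ := A₂ ⨯ V
      x₁ := prod.fst ≫ x₁
      x₂ := prod.fst ≫ x₂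
      a₁ := prod.fst ≫ a₁
      a₂ := prod.fst ≫ a₂
      q₁ := prod.map q₁ (𝟙 V)
      q₂ := prod.map q₂ (𝟙 V)
      isPullback₁ := (isPullback_prod_fst q₁ V).paste_horiz sq₁
      isPullback₂ := (isPullback_prod_fst q₂ V).paste_horiz sq₂
      f := prod.map f (𝟙 V)
      g := prod.map g (𝟙 V)
      h := prod.map h (𝟙 V)
      f_q₂ := by ext <;> simp [f_q₂]
      g_q₁ := by ext <;> simp [g_q₁]
      h_q₁ := by ext <;> simp [h_q₁]
      η := prod.fst ≫ η
      η_p₀ := by simp [η_p₀]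
      η_p₁ := by simp [η_p₁]
      ε := prod.fst ≫ ε
      ε_p₀ := by simp [ε_p₀]
      ε_p₁ := by simp [ε_p₁] }
  refine ⟨d₀,
    { φ := Φ.proj.map prod.fst ≫ ψ
      φ₁ := Φ.proj.map prod.fst ≫ ψ₁
      φ₂ := Φ.proj.map prod.fst ≫ ψ₂
      φ_x₁ := (Φ.map_fst_comp_eq hx₁).symm
      φ_x₂ := (Φ.map_fst_comp_eq hx₂).symm
      φ₁_a₁ := (Φ.map_fst_comp_eq ha₁).symm
      φ₂_a₂ := (Φ.map_fst_comp_eq ha₂).symm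
      φ₁_q₁ := (Φ.map_prod_map_comp_eq hq₁).symm
      φ₂_q₂ := (Φ.map_prod_map_comp_eq hq₂).symm
      φ₁_f := (Φ.map_prod_map_comp_eq hf).symm
      φ₂_g := (Φ.map_prod_map_comp_eq hg).symm
      φ₂_h := (Φ.map_prod_map_comp_eq hh).symm
      φ₁_η := (Φ.map_fst_comp_eq (T := Q.path) hη).symm
      φ₂_ε := (Φ.map_fst_comp_eq (T := Q.path) hε).symm }, ?_⟩
  exact inferInstanceAs (IsIso (Φ.proj.map (prod.fst : X ⨯ V ⟶ X) ≫ ψ))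

/-- Every family of equivalences in the filter quotient is isomorphic to the image of one in `C`. -/
lemma exists_hom_projEquivalenceData [HasPullbacks C] (d : EquivalenceData (Q.map Φ.proj)) :
    ∃ (d₀ : EquivalenceData Q) (m : Hom (Φ.projEquivalenceData d₀) d), IsIso m.φ := by
  obtain ⟨X, e, x₁, x₂, hx₁, hx₂⟩ := Φ.proj_isRightFractions.exists_iso_map₂ d.x₁ d.x₂
  -- Once `x₁` and `x₂` come from `C`, the objects `A₁` and `A₂` can be replaced by pullbacks formed
  -- in `C`, since `P_Φ` preserves these.
  have sq₁ := IsPullback.of_hasPullback π x₁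
  have sq₂ := IsPullback.of_hasPullback π x₂
  obtain ⟨α₁, ha₁, hq₁⟩ : ∃ α₁ : Φ.proj.obj (pullback π x₁) ⟶ d.A₁,
      α₁ ≫ d.a₁ = Φ.proj.map (pullback.fst π x₁) ∧
      α₁ ≫ d.q₁ = Φ.proj.map (pullback.snd π x₁) ≫ e.hom := by
    refine ⟨d.isPullback₁.lift _ _ ?_, d.isPullback₁.lift_fst _ _ _, d.isPullback₁.lift_snd _ _ _⟩
    rw [Category.assoc, hx₁]
    exact Φ.proj_map_comp_eq sq₁.w
  obtain ⟨α₂, ha₂, hq₂⟩ : ∃ α₂ : Φ.proj.obj (pullback π x₂) ⟶ d.A₂,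
      α₂ ≫ d.a₂ = Φ.proj.map (pullback.fst π x₂) ∧
      α₂ ≫ d.q₂ = Φ.proj.map (pullback.snd π x₂) ≫ e.hom := by
    refine ⟨d.isPullback₂.lift _ _ ?_, d.isPullback₂.lift_fst _ _ _, d.isPullback₂.lift_snd _ _ _⟩
    rw [Category.assoc, hx₂]
    exact Φ.proj_map_comp_eq sq₂.w
  have i₁ : IsIso α₁ := isIso_of_isPullback (Φ.isPullback_proj_map sq₁) d.isPullback₁ hx₁ ha₁ hq₁
    inferInstance
  have i₂ : IsIso α₂ := isIso_of_isPullback (Φ.isPullback_proj_map sq₂) d.isPullback₂ hx₂ ha₂ hq₂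
    inferInstance
  obtain ⟨U, hU, ⟨f, hf⟩, ⟨g, hg⟩, ⟨h, hh⟩, ⟨η, hη⟩, ⟨ε, hε⟩⟩ := (Φ.eventually_mem.and
    ((Φ.eventually_lift (α₁ ≫ d.f ≫ inv α₂)).and ((Φ.eventually_lift (α₂ ≫ d.g ≫ inv α₁)).and
    ((Φ.eventually_lift (α₂ ≫ d.h ≫ inv α₁)).and
    ((Φ.eventually_lift (Y := Q.path) (α₁ ≫ d.η)).and
    (Φ.eventually_lift (Y := Q.path) (α₂ ≫ d.ε))))))).exists
  have := fun X => Φ.isIso_proj_map_fst hU X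
  -- The maps `f`, `g`, `h` have to be composed with one another, so their lifts `S ⨯ U ⟶ T` are
  -- completed to maps `S ⨯ U ⟶ T ⨯ U`. The homotopies take values in `Q.path` and need no
  -- completion.
  have lift : ∀ {S T : C} (k : S ⨯ U ⟶ T) {S' T' : FilterQuotient Φ} (α : Φ.proj.obj S ⟶ S')
      (β : Φ.proj.obj T ⟶ T') [IsIso β] (k' : S' ⟶ T'),
      Φ.proj.map prod.fst ≫ α ≫ k' ≫ inv β = Φ.proj.map k →
      Φ.proj.map (prod.lift k prod.snd : S ⨯ U ⟶ T ⨯ U) ≫ Φ.proj.map prod.fst ≫ β =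
        (Φ.proj.map prod.fst ≫ α) ≫ k' := by
    intro S T k S' T' α β _ k' hk
    rw [← Functor.map_comp_assoc, prod.lift_fst, ← hk]
    simp
  exact Φ.exists_hom_of_lift d (prod.fst ≫ x₁) (prod.fst ≫ x₂) (prod.fst ≫ pullback.fst π x₁)
    (prod.fst ≫ pullback.fst π x₂) (prod.map (pullback.snd π x₁) (𝟙 U))
    (prod.map (pullback.snd π x₂) (𝟙 U)) ((isPullback_prod_fst _ U).paste_horiz sq₁)
    ((isPullback_prod_fst _ U).paste_horiz sq₂) (prod.lift f prod.snd) (prod.lift g prod.snd)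
    (prod.lift h prod.snd) η ε (Φ.proj.map prod.fst ≫ e.hom) (Φ.proj.map prod.fst ≫ α₁)
    (Φ.proj.map prod.fst ≫ α₂) (Φ.map_fst_comp_eq hx₁.symm) (Φ.map_fst_comp_eq hx₂.symm)
    (Φ.map_fst_comp_eq ha₁.symm) (Φ.map_fst_comp_eq ha₂.symm) (Φ.map_prod_map_comp_eq hq₁.symm)
    (Φ.map_prod_map_comp_eq hq₂.symm) (lift _ _ _ _ hf) (lift _ _ _ _ hg) (lift _ _ _ _ hh)
    (hη.symm.trans (Category.assoc _ _ _).symm) (hε.symm.trans (Category.assoc _ _ _).symm)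

/-- Base changes in the filter quotient between images of families in `C` lift at small levels. -/
lemma eventually_lift_equivalenceDataHom {d e : EquivalenceData Q}
    (m : Hom (Φ.projEquivalenceData d) (Φ.projEquivalenceData e)) :
    ∀ᶠ U in Φ.levels, ∃ φ : d.base ⨯ U ⟶ e.base, Φ.proj.map prod.fst ≫ m.φ = Φ.proj.map φ ∧
      ∀ᶠ V in Φ.levels, ∃ n : Hom ((d.restrict U).restrict V) e, n.φ = prod.fst ≫ φ := by
  obtain ⟨φ', hφ'⟩ : ∃ φ' : Φ.proj.obj d.base ⟶ Φ.proj.obj e.base, φ' = m.φ := ⟨_, rfl⟩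
  obtain ⟨φ₁', hφ₁'⟩ : ∃ φ₁' : Φ.proj.obj d.A₁ ⟶ Φ.proj.obj e.A₁, φ₁' = m.φ₁ := ⟨_, rfl⟩
  obtain ⟨φ₂', hφ₂'⟩ : ∃ φ₂' : Φ.proj.obj d.A₂ ⟶ Φ.proj.obj e.A₂, φ₂' = m.φ₂ := ⟨_, rfl⟩
  have key : ∀ {S S' T T' U : C} {a : Φ.proj.obj S ⟶ Φ.proj.obj S'}
      {b : Φ.proj.obj T ⟶ Φ.proj.obj T'} {s : S ⟶ T} {t : S' ⟶ T'} {a' : S ⨯ U ⟶ S'}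
      {b' : T ⨯ U ⟶ T'}, Φ.proj.map prod.fst ≫ a = Φ.proj.map a' →
      Φ.proj.map prod.fst ≫ b = Φ.proj.map b' → a ≫ Φ.proj.map t = Φ.proj.map s ≫ b →
      Φ.proj.map (a' ≫ t) = Φ.proj.map (prod.map s (𝟙 U) ≫ b') := by
    intro S S' T T' U a b s t a' b' h₁ h₂ h₃
    rw [Functor.map_comp, Functor.map_comp, ← h₁, ← h₂, Category.assoc, h₃,
      ← Functor.map_comp_assoc, ← Functor.map_comp_assoc, prod.map_fst]
  have key' : ∀ {S S' T U : C} {a : Φ.proj.obj S ⟶ Φ.proj.obj S'} {s : S ⟶ T} {t : S' ⟶ T}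
      {a' : S ⨯ U ⟶ S'}, Φ.proj.map prod.fst ≫ a = Φ.proj.map a' →
      a ≫ Φ.proj.map t = Φ.proj.map s → Φ.proj.map (a' ≫ t) = Φ.proj.map (prod.fst ≫ s) := by
    intro S S' T U a s t a' h₁ h₂
    rw [Functor.map_comp, Functor.map_comp, ← h₁, Category.assoc, h₂]
  -- A level `U` lifts the three components; a second level `V` makes the eleven equations of a base
  -- change hold in `C`.
  refine ((Φ.eventually_lift φ').and ((Φ.eventually_lift φ₁').and (Φ.eventually_lift φ₂'))).mono
    fun U ⟨⟨φ, hφ⟩, ⟨φ₁, hφ₁⟩, ⟨φ₂, hφ₂⟩⟩ => ⟨φ, (congrArg (_ ≫ ·) hφ'.symm).trans hφ, ?_⟩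
  subst hφ' hφ₁' hφ₂'
  refine ((Φ.eventually_fst_comp_eq (key' hφ m.φ_x₁)).and
    ((Φ.eventually_fst_comp_eq (key' hφ m.φ_x₂)).and
    ((Φ.eventually_fst_comp_eq (key' hφ₁ m.φ₁_a₁)).and
    ((Φ.eventually_fst_comp_eq (key' hφ₂ m.φ₂_a₂)).and
    ((Φ.eventually_fst_comp_eq (key hφ₁ hφ m.φ₁_q₁)).and
    ((Φ.eventually_fst_comp_eq (key hφ₂ hφ m.φ₂_q₂)).and
    ((Φ.eventually_fst_comp_eq (key hφ₁ hφ₂ m.φ₁_f)).and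
    ((Φ.eventually_fst_comp_eq (key hφ₂ hφ₁ m.φ₂_g)).and
    ((Φ.eventually_fst_comp_eq (key hφ₂ hφ₁ m.φ₂_h)).and
    ((Φ.eventually_fst_comp_eq (key' hφ₁ m.φ₁_η)).and
    (Φ.eventually_fst_comp_eq (key' hφ₂ m.φ₂_ε)))))))))))).mono
    fun V ⟨h₁, h₂, h₃, h₄, h₅, h₆, h₇, h₈, h₉, h₁₀, h₁₁⟩ => ⟨{
      φ := prod.fst ≫ φ
      φ₁ := prod.fst ≫ φ₁
      φ₂ := prod.fst ≫ φ₂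
      φ_x₁ := (Category.assoc _ _ _).trans h₁
      φ_x₂ := (Category.assoc _ _ _).trans h₂
      φ₁_a₁ := (Category.assoc _ _ _).trans h₃
      φ₂_a₂ := (Category.assoc _ _ _).trans h₄
      φ₁_q₁ := (Category.assoc _ _ _).trans (h₅.trans (prod.map_fst_assoc _ _ _).symm)
      φ₂_q₂ := (Category.assoc _ _ _).trans (h₆.trans (prod.map_fst_assoc _ _ _).symm)
      φ₁_f := (Category.assoc _ _ _).trans (h₇.trans (prod.map_fst_assoc _ _ _).symm)
      φ₂_g := (Category.assoc _ _ _).trans (h₈.trans (prod.map_fst_assoc _ _ _).symm)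
      φ₂_h := (Category.assoc _ _ _).trans (h₉.trans (prod.map_fst_assoc _ _ _).symm)
      φ₁_η := (Category.assoc _ _ _).trans h₁₀
      φ₂_ε := (Category.assoc _ _ _).trans h₁₁ }, rfl⟩

/-- A family in the quotient is isomorphic to the image of some `d₀`, whose classifying base change
projects to the required one. Two competitors lift to base changes of one restriction of `d₀`, where
they agree by universality of `e`. -/
lemma isUniversal_projEquivalenceData [HasPullbacks C] {e : EquivalenceData Q}
    (he : e.IsUniversal) : (Φ.projEquivalenceData e).IsUniversal := by
  intro d
  obtain ⟨d₀, i, hi⟩ := Φ.exists_hom_projEquivalenceData d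
  obtain ⟨n, -⟩ := (he d₀).some
  suffices uniq : ∀ m m' : Hom d (Φ.projEquivalenceData e), m = m' from
    ⟨⟨⟨(i.inverse hi).comp (Φ.projEquivalenceDataHom n.default)⟩, fun m => uniq _ _⟩⟩
  intro m m'
  refine Hom.ext_of_base ?_
  rw [← cancel_epi i.φ]
  obtain ⟨U, hU, ⟨φ, hφ, h⟩, ⟨φ', hφ', h'⟩⟩ := (Φ.eventually_mem.and
    ((Φ.eventually_lift_equivalenceDataHom (i.comp m)).and
    (Φ.eventually_lift_equivalenceDataHom (i.comp m')))).exists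
  obtain ⟨V, hV, ⟨n₁, h₁⟩, ⟨n₂, h₂⟩⟩ := (Φ.eventually_mem.and (h.and h')).exists
  have i₁ := Φ.isIso_proj_map_fst hU d₀.base
  have i₂ := Φ.isIso_proj_map_fst hV (d₀.base ⨯ U)
  have hn : n₁ = n₂ := by
    obtain ⟨u⟩ := he ((d₀.restrict U).restrict V)
    exact Subsingleton.elim _ _
  rw [hn, h₂] at h₁
  have h₃ : Φ.proj.map φ' = Φ.proj.map φ := by
    rw [← cancel_epi (Φ.proj.map (prod.fst : (d₀.base ⨯ U) ⨯ V ⟶ _)), ← Functor.map_comp,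
      ← Functor.map_comp, h₁]
  exact (cancel_epi (Φ.proj.map (prod.fst : d₀.base ⨯ U ⟶ d₀.base))).1
    (hφ.trans (h₃.symm.trans hφ'.symm))

section

variable {C : Type u} [Category.{v} C] [ModelCategory C] {Φ : SubterminalFilter C}
  {E B : C} {π : E ⟶ B} {Q : FibrewisePath π}

lemma IsModelFilter.isUnivalent_map (hΦ : Φ.IsModelFilter)
    (hQ : IsUnivalent Q) : IsUnivalent (Q.map Φ.proj) where
  isPathObject :=
    { weakEquivalence := ⟨hΦ.isStable_weakEquivalences.descend_proj_map
        hQ.isPathObject.weakEquivalence.mem⟩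
      fibration := by
        obtain ⟨K, k₀, k₁, sq, d, h₀, h₁, hd⟩ := hQ.isPathObject.fibration
        exact ⟨_, _, _, Φ.isPullback_proj_map sq, Φ.proj.map d, Φ.proj_map_comp_eq_map h₀,
          Φ.proj_map_comp_eq_map h₁, ⟨Φ.isStable_fibrations.descend_proj_map hd.mem⟩⟩ }
  idtoequiv := by
    obtain ⟨e, he, k, hk⟩ := hQ.idtoequiv
    exact ⟨_, Φ.isUniversal_projEquivalenceData he, Φ.projEquivalenceDataReflHom k,
      ⟨hΦ.isStable_weakEquivalences.descend_proj_map hk.mem⟩⟩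

end

end SubterminalFilter

/-! ### Types -/

/-- A left adjoint preserves the recursion principle of a natural numbers object. -/
lemma IsNaturalNumbersObject.existsUnique_of_isLeftAdjoint {C D : Type*} [Category C] [Category D]
    {T N : C} {zero : T ⟶ N} {succ : N ⟶ N} (h : IsNaturalNumbersObject zero succ) (L : C ⥤ D)
    [L.IsLeftAdjoint] {A : D} (a : L.obj T ⟶ A) (t : A ⟶ A) :
    ∃! r : L.obj N ⟶ A, L.map zero ≫ r = a ∧ L.map succ ≫ r = r ≫ t := by
  let adj := Adjunction.ofIsLeftAdjoint L
  obtain ⟨r, ⟨h₁, h₂⟩, hr⟩ := h.existsUnique (adj.homEquiv _ _ a) (L.rightAdjoint.map t)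
  refine ⟨(adj.homEquiv _ _).symm r, ⟨?_, ?_⟩, fun r' ⟨h₁', h₂'⟩ =>
    (Equiv.eq_symm_apply _).2 (hr _ ⟨?_, ?_⟩)⟩
  · rw [← adj.homEquiv_naturality_left_symm, h₁, Equiv.symm_apply_apply]
  · rw [← adj.homEquiv_naturality_left_symm, h₂, adj.homEquiv_naturality_right_symm]
  · rw [← adj.homEquiv_naturality_left, h₁']
  · rw [← adj.homEquiv_naturality_left, h₂', adj.homEquiv_naturality_right]

namespace SubterminalFilter

open FibredStructure

lemma contains_projTotal {C : Type u} [Category.{v} C] [HasFiniteProducts C]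
    (Φ : SubterminalFilter C) {F : FibredStructure.{w} C} {a : F.Total} {X : C}
    (h : a.Contains X) : (Φ.projTotal a).Contains (Φ.proj.obj X) := by
  obtain ⟨T, hT, s, ⟨m⟩⟩ := h
  exact ⟨Φ.proj.obj T, Φ.isTerminalProj hT, (Φ.projTotal ⟨⟨hT.from X⟩, s⟩).str,
    ⟨(Φ.projTotalFunctor F).map m⟩⟩

/-- As `- × U` is a left adjoint, `N ⨯ U` inherits the recursion principle in `C`. Existence is
recursion at a level where `a` and `t` lift; uniqueness is uniqueness of recursion after one more
restriction, where the lifted equations hold. -/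
lemma isNaturalNumbersObject_proj {C : Type u} [Category.{v} C] [HasFiniteLimits C]
    (Φ : SubterminalFilter C) (hC : IsLocallyCartesianClosed C) {T N : C} {zero : T ⟶ N}
    {succ : N ⟶ N} (h : IsNaturalNumbersObject zero succ) :
    IsNaturalNumbersObject (Φ.proj.map zero) (Φ.proj.map succ) where
  isTerminal := ⟨Φ.isTerminalProj h.isTerminal.some⟩
  existsUnique {A'} a t := by
    obtain ⟨A, rfl⟩ : ∃ A, A' = Φ.proj.obj A := ⟨A'.as, rfl⟩
    have hR := restrict_isLeftAdjoint hC
    -- Lifts are taken with codomain `A ⨯ U`, so that the lift of `t` is again an endomorphism and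
    -- can be iterated.
    have lift : ∀ {X : C} (m : Φ.proj.obj X ⟶ Φ.proj.obj A), ∀ᶠ U in Φ.levels,
        ∃ m' : X ⨯ U ⟶ A ⨯ U, Φ.proj.map m' ≫ Φ.proj.map prod.fst = Φ.proj.map prod.fst ≫ m := by
      intro X m
      refine (Φ.eventually_lift m).mono fun U ⟨f, hf⟩ => ⟨prod.lift f prod.snd, ?_⟩
      rw [← Functor.map_comp, prod.lift_fst, hf]
    have comm : ∀ {S S' : C} (k : S ⟶ S') (U : C), Φ.proj.map (prod.map k (𝟙 U)) ≫
        Φ.proj.map prod.fst = Φ.proj.map prod.fst ≫ Φ.proj.map k :=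
      fun k U => Φ.proj_map_comp_eq (prod.map_fst _ _)
    refine existsUnique_of_exists_of_unique ?_ fun r r' ⟨h₁, h₂⟩ ⟨h₁', h₂'⟩ => ?_
    · obtain ⟨U, hU, ⟨a', ha⟩, ⟨t', ht⟩⟩ := (Φ.eventually_mem.and ((lift a).and (lift t))).exists
      have := Φ.isIso_proj_map_fst hU
      obtain ⟨r, h₁, h₂⟩ : ∃ r : N ⨯ U ⟶ A ⨯ U, prod.map zero (𝟙 U) ≫ r = a' ∧
          prod.map succ (𝟙 U) ≫ r = r ≫ t' :=
        (h.existsUnique_of_isLeftAdjoint (restrict U) a' t').exists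
      replace h₁ := Φ.proj_map_comp_eq_map h₁
      replace h₂ := Φ.proj_map_comp_eq h₂
      refine ⟨inv (Φ.proj.map (prod.fst : N ⨯ U ⟶ N)) ≫ Φ.proj.map r ≫ Φ.proj.map prod.fst, ?_, ?_⟩
      · rw [← cancel_epi (Φ.proj.map (prod.fst : T ⨯ U ⟶ T)), ← ha, ← h₁, ← Category.assoc,
          ← comm zero U]
        simp
      · rw [← cancel_epi (Φ.proj.map (prod.fst : N ⨯ U ⟶ N)), Category.assoc, Category.assoc,
          IsIso.hom_inv_id_assoc, ← ht, ← Category.assoc, ← comm succ U, ← reassoc_of% h₂]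
        simp
    · obtain ⟨U, hU, ⟨⟨a', ha⟩, ⟨t', ht⟩⟩, ⟨s, hs⟩, ⟨s', hs'⟩⟩ := (Φ.eventually_mem.and
        (((lift a).and (lift t)).and ((lift r).and (lift r')))).exists
      have := Φ.isIso_proj_map_fst hU
      have key : ∀ {r : Φ.proj.obj N ⟶ Φ.proj.obj A} {s : N ⨯ U ⟶ A ⨯ U},
          Φ.proj.map zero ≫ r = a → Φ.proj.map succ ≫ r = r ≫ t →
          Φ.proj.map s ≫ Φ.proj.map prod.fst = Φ.proj.map prod.fst ≫ r →
          Φ.proj.map (prod.map zero (𝟙 U) ≫ s) = Φ.proj.map a' ∧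
          Φ.proj.map (prod.map succ (𝟙 U) ≫ s) = Φ.proj.map (s ≫ t') := by
        intro r s h₁ h₂ hs
        refine ⟨?_, ?_⟩
        · rw [← cancel_mono (Φ.proj.map (prod.fst : A ⨯ U ⟶ A)), Functor.map_comp, Category.assoc,
            hs, ha, reassoc_of% (comm zero U), h₁]
        · rw [← cancel_mono (Φ.proj.map (prod.fst : A ⨯ U ⟶ A)), Functor.map_comp,
            Functor.map_comp, Category.assoc, Category.assoc, hs, ht, reassoc_of% (comm succ U), h₂,
            reassoc_of% hs]
      obtain ⟨k₁, k₂⟩ := key h₁ h₂ hs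
      obtain ⟨k₁', k₂'⟩ := key h₁' h₂' hs'
      obtain ⟨V, hV, ⟨e₁, e₂⟩, e₁', e₂'⟩ := (Φ.eventually_mem.and
        (((Φ.eventually_fst_comp_eq k₁).and (Φ.eventually_fst_comp_eq k₂)).and
        ((Φ.eventually_fst_comp_eq k₁').and (Φ.eventually_fst_comp_eq k₂')))).exists
      have := Φ.isIso_proj_map_fst hV
      have hmap : ∀ {S S' : C} {f g : S ⟶ S'}, (prod.fst : S ⨯ V ⟶ S) ≫ f = prod.fst ≫ g →
          (restrict V).map f = (restrict V).map g := fun e =>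
        Limits.prod.hom_ext ((prod.map_fst _ _).trans (e.trans (prod.map_fst _ _).symm))
          ((prod.map_snd _ _).trans (prod.map_snd _ _).symm)
      have hss : (prod.map s (𝟙 V) : (N ⨯ U) ⨯ V ⟶ (A ⨯ U) ⨯ V) = prod.map s' (𝟙 V) :=
        (h.existsUnique_of_isLeftAdjoint (restrict U ⋙ restrict V) (prod.map a' (𝟙 V))
          (prod.map t' (𝟙 V))).unique
          ⟨((restrict V).map_comp _ _).symm.trans (hmap e₁),
            ((restrict V).map_comp _ _).symm.trans ((hmap e₂).trans ((restrict V).map_comp _ _))⟩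
          ⟨((restrict V).map_comp _ _).symm.trans (hmap e₁'),
            ((restrict V).map_comp _ _).symm.trans ((hmap e₂').trans ((restrict V).map_comp _ _))⟩
      have hss' : Φ.proj.map s = Φ.proj.map s' := by
        rw [← cancel_epi (Φ.proj.map (prod.fst : (N ⨯ U) ⨯ V ⟶ _)), ← comm, ← comm, hss]
      rw [← cancel_epi (Φ.proj.map (prod.fst : N ⨯ U ⟶ N)), ← hs, ← hs', hss']

/-! ### Fibrant objects, spheres and cell complexes -/

section

variable {C : Type u} [Category.{v} C] [ModelCategory C] {Φ : SubterminalFilter C}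

lemma isFibrant_proj {X : C} (h : IsFibrant X) : IsFibrant (Φ.proj.obj X) := by
  have : (fibrations (FilterQuotient Φ)).RespectsIso := Φ.isStable_fibrations.respectsIso_descend
  exact (isFibrant_iff_of_isTerminal (Φ.proj.map (terminal.from X))
    (Φ.isTerminalProj terminalIsTerminal)).2 ⟨Φ.isStable_fibrations.descend_proj_map h.mem⟩

namespace IsModelFilter

variable (hΦ : Φ.IsModelFilter)
include hΦ

lemma cofibration_proj {X Y : C} {f : X ⟶ Y} (h : Cofibration f) : Cofibration (Φ.proj.map f) :=
  ⟨hΦ.isStable_cofibrations.descend_proj_map h.mem⟩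

lemma weakEquivalence_proj {X Y : C} {f : X ⟶ Y} (h : WeakEquivalence f) :
    WeakEquivalence (Φ.proj.map f) :=
  ⟨hΦ.isStable_weakEquivalences.descend_proj_map h.mem⟩

lemma isWeaklyContractible_proj {D : C} (h : IsWeaklyContractible D) :
    IsWeaklyContractible (Φ.proj.obj D) := by
  obtain ⟨T, hT, h⟩ := h
  refine ⟨Φ.proj.obj T, Φ.isTerminalProj hT, ?_⟩
  rw [Φ.proj_hom_eq_of_isTerminal hT ((Φ.isTerminalProj hT).from (Φ.proj.obj D))]
  exact hΦ.weakEquivalence_proj h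

variable [PreservesFiniteColimits Φ.proj]

lemma isCellBoundary_proj {n : ℕ} {S D : C} {i : S ⟶ D} (h : IsCellBoundary n i) :
    IsCellBoundary n (Φ.proj.map i) := by
  induction h with
  | zero i hS hi hD =>
    exact .zero _ (hS.isInitialObj Φ.proj _) (hΦ.cofibration_proj hi)
      (hΦ.isWeaklyContractible_proj hD)
  | succ i₁ i₂ j₁ j₂ _ _ sq i hi hD h₁ h₂ =>
    exact .succ _ _ _ _ h₁ h₂ (sq.map Φ.proj) _ (hΦ.cofibration_proj hi)
      (hΦ.isWeaklyContractible_proj hD)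

lemma isSphere_proj {n : ℕ} {X : C} (h : IsSphere n X) : IsSphere n (Φ.proj.obj X) := by
  obtain ⟨S, D, i, f, hi, hf⟩ := h
  exact ⟨_, _, _, _, hΦ.isCellBoundary_proj hi, hΦ.weakEquivalence_proj hf⟩

lemma isCellComplex_proj {J : Type} [PartialOrder J] [Finite J] {X : C} (h : IsCellComplex J X) :
    IsCellComplex J (Φ.proj.obj X) := by
  -- This is needed both for the colimit over `J` and for the latching colimits over the finite
  -- posets `{i // i < j}`.
  have fin : ∀ (K : Type) [PartialOrder K] [Finite K], PreservesColimitsOfShape K Φ.proj := by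
    intro K _ _
    let _ : FinCategory K :=
      { fintypeObj := Fintype.ofFinite K
        fintypeHom := fun _ _ => Fintype.ofFinite _ }
    infer_instance
  obtain ⟨Q, c, hc, f, hQ, hl, hf⟩ := h
  have := fin J
  refine ⟨Q ⋙ Φ.proj, _, isColimitOfPreserves Φ.proj hc, Φ.proj.map f,
    fun j => hΦ.isWeaklyContractible_proj (hQ j), fun j => ?_, hΦ.weakEquivalence_proj hf⟩
  obtain ⟨l, hl, h⟩ := hl j
  have := fin {i : J // i < j}
  refine ⟨Φ.proj.mapCocone l, isColimitOfPreserves Φ.proj hl, ?_⟩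
  -- Since the latching colimit is preserved, the latching map of the image diagram is the image of
  -- the latching map, and cofibrations are preserved.
  have e : (isColimitOfPreserves Φ.proj hl).desc (latchingCocone (Q ⋙ Φ.proj) j) =
      Φ.proj.map (hl.desc (latchingCocone Q j)) :=
    ((isColimitOfPreserves Φ.proj hl).uniq (latchingCocone (Q ⋙ Φ.proj) j) _ fun i =>
      Φ.proj_map_comp_eq_map (hl.fac (latchingCocone Q j) i)).symm
  rw [e]
  exact hΦ.cofibration_proj h

end IsModelFilter

end

end SubterminalFilter

end FilterQuot

open FilterQuot in
theorem proposition3p41 {C : Type u} [Category.{v} C] [ModelCategory C]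
    (hC : IsLocallyCartesianClosed C)
    (Φ : SubterminalFilter C) (hΦ : Φ.IsModelFilter)
    (F : FibredStructure.{w} C) (hF : F.IsLPaRANoFScaF) :
    -- the filter quotient with the induced classes is a model category
    ∃ _ : ModelCategory (FilterQuotient Φ),
      fibrations (FilterQuotient Φ) = Φ.descend (fibrations C) ∧
      cofibrations (FilterQuotient Φ) = Φ.descend (cofibrations C) ∧
      weakEquivalences (FilterQuotient Φ) = Φ.descend (weakEquivalences C) ∧
      -- the induced notion of fibred structure has the properties required of `F`
      (Φ.induced F).IsLPaRANoFScaF ∧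
      (Small.{w} (Subobject (⊤_ C)) → ∀ f, Small.{w} ((Φ.induced F).obj f)) ∧
      -- `P_Φ` preserves finite limits and colimits and the three classes of morphisms
      PreservesFiniteLimits Φ.proj ∧ PreservesFiniteColimits Φ.proj ∧
      (∀ {X Y : C} (f : X ⟶ Y), Fibration f → Fibration (Φ.proj.map f)) ∧
      (∀ {X Y : C} (f : X ⟶ Y), Cofibration f → Cofibration (Φ.proj.map f)) ∧
      (∀ {X Y : C} (f : X ⟶ Y), WeakEquivalence f → WeakEquivalence (Φ.proj.map f)) ∧
      ∀ u : F.Total, u.IsUniverse →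
        -- (1) universes, (2) fibrancy, (3) univalence
        (Φ.projTotal u).IsUniverse ∧
        (IsFibrant u.arrow.right → IsFibrant (Φ.projTotal u).arrow.right) ∧
        (∀ Q : FibrewisePath u.arrow.hom, IsUnivalent Q → IsUnivalent (Q.map Φ.proj)) ∧
        -- (4) contained types
        ∀ X : C, u.Contains X →
          (Φ.projTotal u).Contains (Φ.proj.obj X) ∧
          (Nonempty (IsInitial X) → Nonempty (IsInitial (Φ.proj.obj X))) ∧
          (Nonempty (IsTerminal X) → Nonempty (IsTerminal (Φ.proj.obj X))) ∧
          (∀ {T : C} (zero : T ⟶ X) (succ : X ⟶ X), IsNaturalNumbersObject zero succ →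
            IsNaturalNumbersObject (Φ.proj.map zero) (Φ.proj.map succ)) ∧
          (∀ n : ℕ, IsSphere n X → IsSphere n (Φ.proj.obj X)) ∧
          (∀ (J : Type) [PartialOrder J] [Finite J],
            IsCellComplex J X → IsCellComplex J (Φ.proj.obj X))
 := by
  have hP := Φ.preservesFiniteColimits_proj hC
  open SubterminalFilter in
  refine ⟨hΦ.modelCategory hC, rfl, rfl, rfl, hΦ.isLPaRANoFScaF_induced hF,
    fun h f => Φ.small_induced h f, inferInstance, hP,
    fun f hf => ⟨Φ.isStable_fibrations.descend_proj_map hf.mem⟩,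
    fun f hf => hΦ.cofibration_proj hf, fun f hf => hΦ.weakEquivalence_proj hf, fun a ha =>
    ⟨hΦ.isUniverse_projTotal ha, fun h => SubterminalFilter.isFibrant_proj h,
      fun Q hQ => hΦ.isUnivalent_map hQ, fun X hX => ⟨Φ.contains_projTotal hX,
        fun ⟨h⟩ => ⟨h.isInitialObj Φ.proj _⟩, fun ⟨h⟩ => ⟨Φ.isTerminalProj h⟩,
        fun _ _ h => Φ.isNaturalNumbersObject_proj hC h, fun _ h => hΦ.isSphere_proj h,
        fun J _ _ h => hΦ.isCellComplex_proj h⟩⟩⟩
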